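/- Let $n,K$ be natural numbers with $K\ge 2$, let $\mathbb{T}^n=(\mathbb{R}/2\pi\mathbb{Z})^n$, and let $a:\mathbb{T}^n\to\mathbb{R}$ satisfy $a\ge C_0$ for some constant $C_0>0$. For $j\in J=\{0,\dots,K-1\}^n$ let $x_j=\frac{2\pi}{K}j$ and let $D_j\subset\mathbb{T}^n$ be the open cube with centre $x_j$ and side length $L=\frac{4\pi}{K}$. Let $\mathcal{F}_{D_j}$ be the Fourier series transform on $D_j$, $(\mathcal{F}_{D_j}u)(k)=L^{-n}\int_{D_j}u(y)e^{-i\xi_k\cdot y}\,dy$ with $\xi_k=\frac{2\pi}{L}k=\frac K2 k$, $k\in\mathbb{Z}^n$, let $\mathcal{F}_{D_j}^{-1}$ be its inverse $b\mapsto\sum_k b_k e^{i\xi_k\cdot x}$, let $M$ be multiplication by $1+a(x_j)|\xi_k|^2$, and put $S_j=\mathcal{F}_{D_j}^{-1}M^{-1/2}\mathcal{F}_{D_j}$. Let the real window functions $g_j\in C_0^\infty(D_j)$, $j\in J$, satisfy $\sum_{j\in J}g_j^2=1$ on $\mathbb{T}^n$, and put $P=\sum_{j\in J}g_jS_jg_j$,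 where the function $g_jS_jg_ju$ on $D_j$ is extended by zero to $\mathbb{T}^n$. For a torus $\mathbb{T}^n_L$ of period $L$ in each coordinate, with exponentials $e_k(x)=e^{i(2\pi/L)k\cdot x}$, call a continuous linear operator $A:C^\infty(\mathbb{T}^n_L)\to C^\infty(\mathbb{T}^n_L)$ a periodic pseudodifferential operator of order $m$ if $Au(x)=\sum_{k\in\mathbb{Z}^n}\sigma_A(x,k)\hat u(k)e_k(x)$ with symbol $\sigma_A(x,k)=e_k(x)^{-1}(Ae_k)(x)$ in $S^m_{1,0}(\mathbb{T}^n_L\times\mathbb{Z}^n)$, that is, $\sigma_A$ is smooth in $x$ and for all multi-indices $\alpha,\beta\in\mathbb{N}^n$ there is a constant $C_{\alpha\beta}$ with $|\Delta_k^\alpha\partial_x^\beta\sigma_A(x,k)|\le C_{\alpha\beta}(1+|k|^2)^{(m-|\alpha|)/2}$ for all $x,k$, where $\Delta_k$ denotes forward differences. Call $A$ elliptic if moreover $|\sigma_A(x,k)|\ge C|k|^m$ for all $x$ and all $|k|\ge R$, for some $C,R>0$. Then each $S_j$, acting on functions of period $\frac{4\pi}{K}$ in each coordinate, is a periodic elliptic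 pseudodifferential operator of order $-1$ on the torus of period $\frac{4\pi}{K}$, and $P$ is a periodic elliptic pseudodifferential operator of order $-1$ on $\mathbb{T}^n$. -/

import Mathlib

open scoped ContDiff

noncomputable section

namespace ToroidalPsDO

/-! ### Functions on the torus

A function on the torus of period `L` is a function on `ℝⁿ` that is `L`-periodic in each
coordinate direction.  The standard torus is the case `L = 2 * π`. -/

/-- `u ∈ C^∞(𝕋ⁿ)` for the torus of period `L`. -/
structure IsTestFunction {n : ℕ} (L : ℝ) (u : (Fin n → ℝ) → ℂ) : Prop where
  smooth : ContDiff ℝ ∞ u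
  periodic : ∀ (x : Fin n → ℝ) (m : Fin n → ℤ), u (fun i => x i + L * (m i : ℝ)) = u x

/-- The exponential `e_k(x) = exp (i (2π/L) k · x)`, `k ∈ ℤⁿ`; for `L = 2π` it is `e^{i x·k}`. -/
def expo {n : ℕ} (L : ℝ) (k : Fin n → ℤ) (x : Fin n → ℝ) : ℂ :=
  Complex.exp (Complex.I * (((2 * Real.pi / L) * ∑ i, (k i : ℝ) * x i : ℝ) : ℂ))

/-- The open cube with centre `c` and side length `L`. -/
def cube {n : ℕ} (L : ℝ) (c : Fin n → ℝ) : Set (Fin n → ℝ) :=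
  {x | ∀ i, x i ∈ Set.Ioo (c i - L / 2) (c i + L / 2)}

/-- Fourier coefficients `k ↦ L⁻ⁿ ∫_{cube} u(y) exp (-i (2π/L) k · y) dy` of (the restriction of)
`u` on the cube with centre `c` and side length `L`. -/
def fourierOn {n : ℕ} (L : ℝ) (c : Fin n → ℝ) (u : (Fin n → ℝ) → ℂ) (k : Fin n → ℤ) : ℂ :=
  ((L ^ n : ℝ) : ℂ)⁻¹ * ∫ y in cube L c, u y * expo L (-k) y

/-- The inverse transform: the Fourier series with coefficients `b`. -/
def fourierInv {n : ℕ} (L : ℝ) (b : (Fin n → ℤ) → ℂ) (x : Fin n → ℝ) : ℂ :=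
  ∑' k, b k * expo L k x

/-! ### Multi-index derivatives and differences -/

/-- `∂^β f` for a multi-index `β ∈ ℕⁿ`. -/
def mderiv {n : ℕ} (β : Fin n → ℕ) (f : (Fin n → ℝ) → ℂ) : (Fin n → ℝ) → ℂ :=
  (List.finRange n).foldr
    (fun i h => (fun (v : (Fin n → ℝ) → ℂ) (x : Fin n → ℝ) =>
      fderiv ℝ v x (Pi.single i 1))^[β i] h) f

/-- `Δ^α f` for a multi-index `α ∈ ℕⁿ`, with the forward differences
`Δ_i f (ξ) = f (ξ + e_i) - f ξ`. -/
def mdiff {n : ℕ} (α : Fin n → ℕ) (f : (Fin n → ℤ) → ℂ) : (Fin n → ℤ) → ℂ :=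
  (List.finRange n).foldr (fun i h => (fwdDiff (Pi.single i 1))^[α i] h) f

/-- The Euclidean length of `ξ ∈ ℤⁿ`. -/
def len {n : ℕ} (ξ : Fin n → ℤ) : ℝ := Real.sqrt (∑ i, (ξ i : ℝ) ^ 2)

/-- `⟨ξ⟩ = (1 + |ξ|²)^{1/2}`. -/
def bracket {n : ℕ} (ξ : Fin n → ℤ) : ℝ := Real.sqrt (1 + len ξ ^ 2)

/-! ### Periodic pseudodifferential operators -/

/-- `σ ∈ S^m_{ρ,δ}(𝕋ⁿ × ℤⁿ)`, for the torus of period `L`. -/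
structure IsToroidalSymbol {n : ℕ} (L m ρ δ : ℝ) (σ : (Fin n → ℝ) → (Fin n → ℤ) → ℂ) :
    Prop where
  smooth : ∀ ξ, IsTestFunction L (fun x => σ x ξ)
  bound : ∀ α β : Fin n → ℕ, ∃ C : ℝ, ∀ (x : Fin n → ℝ) (ξ : Fin n → ℤ),
    ‖mdiff α (fun η => mderiv β (fun y => σ y η) x) ξ‖ ≤
      C * bracket ξ ^ (m - ρ * ((∑ i, α i : ℕ) : ℝ) + δ * ((∑ i, β i : ℕ) : ℝ))

/-- The symbol `σ_A(x, ξ) = e^{-i x·ξ} (A e^{i x·ξ})(x)` of an operator `A`. -/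
def symbol {n : ℕ} (L : ℝ) (A : ((Fin n → ℝ) → ℂ) → ((Fin n → ℝ) → ℂ))
    (x : Fin n → ℝ) (ξ : Fin n → ℤ) : ℂ :=
  expo L (-ξ) x * A (expo L ξ) x

/-- `A ∈ Op S^m_{ρ,δ}(𝕋ⁿ × ℤⁿ)`, for the torus of period `L`: `A` restricts to a continuous linear
operator of `C^∞(𝕋ⁿ)` into itself, its symbol is in `S^m_{ρ,δ}(𝕋ⁿ × ℤⁿ)`, and `A` is given by the
quantization of its symbol.  Continuity is with respect to the seminorms `sup |∂^β u|`. -/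
structure IsPeriodicPsDO {n : ℕ} (L m ρ δ : ℝ)
    (A : ((Fin n → ℝ) → ℂ) → ((Fin n → ℝ) → ℂ)) : Prop where
  mapsTo : ∀ u, IsTestFunction L u → IsTestFunction L (A u)
  map_add : ∀ u v, IsTestFunction L u → IsTestFunction L v → A (u + v) = A u + A v
  map_smul : ∀ (c : ℂ) (u), IsTestFunction L u → A (c • u) = c • A u
  continuous : ∀ β : Fin n → ℕ, ∃ (N : ℕ) (C : ℝ), ∀ u, IsTestFunction L u → ∀ B : ℝ,
    (∀ γ : Fin n → ℕ, ∑ i, γ i ≤ N → ∀ y, ‖mderiv γ u y‖ ≤ B) →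
      ∀ x, ‖mderiv β (A u) x‖ ≤ C * B
  symbol_mem : IsToroidalSymbol L m ρ δ (symbol L A)
  quantization : ∀ u, IsTestFunction L u → ∀ x,
    HasSum (fun ξ => symbol L A x ξ * fourierOn L 0 u ξ * expo L ξ x) (A u x)

/-- A periodic pseudodifferential operator in `Op S^m_{ρ,δ}(𝕋ⁿ × ℤⁿ)` that is elliptic:
`|σ_A(x, ξ)| ≥ C |ξ|^m` for all `x` and all sufficiently large `ξ`. -/
structure IsEllipticPeriodicPsDO {n : ℕ} (L m ρ δ : ℝ)
    (A : ((Fin n → ℝ) → ℂ) → ((Fin n → ℝ) → ℂ)) : Prop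
    extends IsPeriodicPsDO L m ρ δ A where
  elliptic : ∃ C : ℝ, 0 < C ∧ ∃ R : ℝ, 0 < R ∧ ∀ (x : Fin n → ℝ) (ξ : Fin n → ℤ),
    R ≤ len ξ → C * len ξ ^ m ≤ ‖symbol L A x ξ‖

/-! ### The windowed Fourier frame preconditioner on `𝕋ⁿ = [0, 2π)ⁿ` -/

/-- The side length `4π/K` of the overlapping subdomains. -/
def side (K : ℕ) : ℝ := 4 * Real.pi / K

/-- The midpoint `x_j = (2π/K) j` of the subdomain with index `j ∈ {0, …, K-1}ⁿ`. -/
def mid {n K : ℕ} (j : Fin n → Fin K) : Fin n → ℝ :=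
  fun i => 2 * Real.pi / K * ((j i : ℕ) : ℝ)

/-- The subdomain `D_j`, as a cube in `ℝⁿ` that represents it modulo `2π`. -/
def dom {n K : ℕ} (j : Fin n → Fin K) : Set (Fin n → ℝ) := cube (side K) (mid j)

/-- All points of `ℝⁿ` whose class modulo `2π` is in `D_j`. -/
def domLift {n K : ℕ} (j : Fin n → Fin K) : Set (Fin n → ℝ) :=
  {x | ∃ m : Fin n → ℤ, (fun i => x i + 2 * Real.pi * (m i : ℝ)) ∈ dom j}

/-- Extension by zero of a function on `D_j` to a function on `𝕋ⁿ`: outside of the cube the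
function is replaced by zero, then it is made `2π`-periodic. -/
def extendZero {n K : ℕ} (j : Fin n → Fin K) (v : (Fin n → ℝ) → ℂ) (x : Fin n → ℝ) : ℂ :=
  ∑' m : Fin n → ℤ, (dom j).indicator v (fun i => x i + 2 * Real.pi * (m i : ℝ))

/-- The window functions: real `g_j ∈ C_0^∞(D_j)` on `𝕋ⁿ` (the closed support is in the open
set `D_j`) with `∑ g_j² = 1`. -/
structure IsWindowFamily {n K : ℕ} (g : (Fin n → Fin K) → (Fin n → ℝ) → ℝ) : Prop where
  smooth : ∀ j, ContDiff ℝ ∞ (g j)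
  periodic : ∀ (j) (x : Fin n → ℝ) (m : Fin n → ℤ),
    g j (fun i => x i + 2 * Real.pi * (m i : ℝ)) = g j x
  support : ∀ j, tsupport (g j) ⊆ domLift j
  sum_sq : ∀ x, ∑ j, g j x ^ 2 = 1

/-- The diagonal entries `1 + a(x_j) |ξ_k|²` of `M`, where `ξ_k = (2π / (4π/K)) k` is the
frequency with index `k ∈ ℤⁿ` on `D_j`. -/
def diagM {n K : ℕ} (a : (Fin n → ℝ) → ℝ) (j : Fin n → Fin K) (k : Fin n → ℤ) : ℝ :=
  1 + a (mid j) * ∑ i, (2 * Real.pi / side K * (k i : ℝ)) ^ 2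

/-- `S_j = F_{D_j}⁻¹ M^{-1/2} F_{D_j}`.  It only uses the values of `u` on `D_j`, and `S_j u` is
periodic with period `4π/K`. -/
def opS {n K : ℕ} (a : (Fin n → ℝ) → ℝ) (j : Fin n → Fin K) (u : (Fin n → ℝ) → ℂ) :
    (Fin n → ℝ) → ℂ :=
  fourierInv (side K)
    (fun k => ((diagM a j k ^ (-(1 / 2) : ℝ) : ℝ) : ℂ) * fourierOn (side K) (mid j) u k)

/-- `P = ∑_j g_j S_j g_j`; the function `S_j (g_j u)` on `D_j` is multiplied by the window
`g_j` after extension by zero to `𝕋ⁿ`. -/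
def opP {n K : ℕ} (a : (Fin n → ℝ) → ℝ) (g : (Fin n → Fin K) → (Fin n → ℝ) → ℝ)
    (u : (Fin n → ℝ) → ℂ) (x : Fin n → ℝ) : ℂ :=
  ∑ j, (g j x : ℂ) * extendZero j (opS a j (fun y => (g j y : ℂ) * u y)) x

end ToroidalPsDO

end

/-!
The argument takes place on the Fourier side of the cubes `D_j`, whose side length `4π/K` is at most
the period `2π` because `2 ≤ K`.

The operator `S_j` is a Fourier multiplier with the symbol `(1 + A |ξ_k|²)^{-1/2}`, `A = a(x_j)`.
That this is a discrete symbol of order `-1` is `isSym_weight_rpow`: a forward difference of a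
negative power of the weight is expanded by Taylor's formula (`exists_taylor_rpow`), and the terms of
the expansion are products of the increment, of order `1`, with lower powers of the weight.

The symbol of `P` is a sum over `j` of the functions `e_{-ξ} g_j S_j (g_j e_ξ)`, which are, near each
point, either zero or translates of a product `g_j · conjOp` on `D_j` (`symbolTerm_local`). On `D_j`
the function `g_j e_ξ` is smooth and vanishes near the boundary, so it is the sum of its Fourier
series, although `e_ξ` itself need not have the period of the cube. Write `Y = 1 + A |ξ_k|²` and
`X = 1 + A |ξ|²`. Taylor's formula for `Y^{-1/2}` around `X` gives an expansion of
`e_{-ξ} S_j (f e_ξ)` in decreasing powers of `X` (`exists_conjOp_expansion`): multiplication of the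
Fourier coefficients by `Y - X` is the action on `f` of the differential operator
`lam A = -A Δ - 2 i A ξ · ∇`, which is of degree `1` in `ξ`. The remainder is summed by Peetre's
inequality, since the Fourier coefficients of `f e_ξ` decay rapidly in `|ξ_k - ξ|`. An expansion of
sufficient length yields any finite number of symbol estimates (`isSym_conjOp`), and derivatives in
`x` do not change the structure, because `∂_i` commutes with the conjugated operator (`pd_conjOp`).

The leading terms add up to `∑ g_j² (1 + a(x_j) |ξ|²)^{-1/2}`, with an error of order `-2`
(`exists_norm_symbol_opP_sub_le`). As `∑ g_j² = 1` and there are finitely many `j`, this sum is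
bounded below by a multiple of `(1 + |ξ|²)^{-1/2}`, which is ellipticity.

Finally, a linear operator that is continuous on smooth periodic functions is the quantization of its
symbol, because Fourier series of smooth functions converge with all derivatives (`hasSum_symbol`).
-/

open scoped ContDiff Topology Pointwise
open Filter

noncomputable section

namespace ToroidalPsDO

variable {n : ℕ}

/-! ### Multi-indices as lists of directions -/

/-- The list of directions in which the index `i` occurs `β i` times, in increasing order. -/
def multiList (β : Fin n → ℕ) : List (Fin n) :=
  (List.finRange n).flatMap fun i => List.replicate (β i) i

lemma foldr_iterate_eq_foldr_multiList {X : Type*} (F : Fin n → X → X) (β : Fin n → ℕ) (x : X) :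
    (List.finRange n).foldr (fun i h => (F i)^[β i] h) x = (multiList β).foldr F x := by
  have key : ∀ (i : Fin n) (k : ℕ) (y : X), (List.replicate k i).foldr F y = (F i)^[k] y := by
    intro i k y
    induction k with
    | zero => rfl
    | succ k ih => rw [List.replicate_succ, List.foldr_cons, ih, Function.iterate_succ_apply']
  unfold multiList
  induction List.finRange n with
  | nil => rfl
  | cons a l ih => rw [List.foldr_cons, ih, List.flatMap_cons, List.foldr_append, key]

lemma length_multiList (β : Fin n → ℕ) : (multiList β).length = ∑ i, β i := by
  simp [multiList, List.length_flatMap, List.sum_ofFn, ← List.ofFn_eq_map]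

lemma perm_multiList_count (l : List (Fin n)) : l.Perm (multiList fun i => l.count i) := by
  rw [List.perm_iff_count]
  intro a
  have h : ∀ m : List (Fin n), m.Nodup →
      (m.flatMap fun i => List.replicate (l.count i) i).count a =
        if a ∈ m then l.count a else 0 := by
    intro m hm
    induction m with
    | nil => simp
    | cons b m ih =>
      rw [List.nodup_cons] at hm
      rw [List.flatMap_cons, List.count_append, ih hm.2, List.count_replicate]
      by_cases hab : b = a
      · subst hab; simp [hm.1]
      · have : a ≠ b := fun h => hab h.symm
        simp [hab, this]
  rw [multiList, h _ (List.nodup_finRange n)]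
  simp

/-! ### Partial derivatives -/

/-- The partial derivative `∂_i v`. -/
def pd (i : Fin n) (v : (Fin n → ℝ) → ℂ) : (Fin n → ℝ) → ℂ :=
  fun x => fderiv ℝ v x (Pi.single i 1)

/-- The iterated partial derivative in the directions of a list, the last entry acting first. -/
def pdl (l : List (Fin n)) (v : (Fin n → ℝ) → ℂ) : (Fin n → ℝ) → ℂ := l.foldr pd v

lemma mderiv_eq_pdl (β : Fin n → ℕ) (v : (Fin n → ℝ) → ℂ) :
    mderiv β v = pdl (multiList β) v :=
  foldr_iterate_eq_foldr_multiList pd β v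

lemma pdl_append_singleton (l : List (Fin n)) (i : Fin n) (v : (Fin n → ℝ) → ℂ) :
    pdl (l ++ [i]) v = pdl l (pd i v) := by
  simp [pdl, List.foldr_append]

lemma contDiff_pd {v : (Fin n → ℝ) → ℂ} (hv : ContDiff ℝ ∞ v) (i : Fin n) :
    ContDiff ℝ ∞ (pd i v) :=
  (contDiff_infty_iff_fderiv.1 hv).2.clm_apply contDiff_const

lemma contDiff_pdl {v : (Fin n → ℝ) → ℂ} (hv : ContDiff ℝ ∞ v) (l : List (Fin n)) :
    ContDiff ℝ ∞ (pdl l v) := by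
  induction l with
  | nil => exact hv
  | cons i l ih => exact contDiff_pd ih i

lemma contDiff_differentiable {v : (Fin n → ℝ) → ℂ} (hv : ContDiff ℝ ∞ v) : Differentiable ℝ v :=
  hv.differentiable (by simp)

lemma pd_add {u v : (Fin n → ℝ) → ℂ} (hu : ContDiff ℝ ∞ u) (hv : ContDiff ℝ ∞ v) (i : Fin n) :
    pd i (fun x => u x + v x) = fun x => pd i u x + pd i v x := by
  funext x
  simp only [pd]
  rw [fderiv_fun_add (contDiff_differentiable hu x) (contDiff_differentiable hv x)]
  rfl

lemma pd_mul {u v : (Fin n → ℝ) → ℂ} (hu : ContDiff ℝ ∞ u) (hv : ContDiff ℝ ∞ v) (i : Fin n) :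
    pd i (fun x => u x * v x) = fun x => pd i u x * v x + u x * pd i v x := by
  funext x
  simp only [pd]
  rw [fderiv_fun_mul (contDiff_differentiable hu x) (contDiff_differentiable hv x)]
  simp [mul_comm, add_comm]

lemma pd_const_mul {v : (Fin n → ℝ) → ℂ} (hv : ContDiff ℝ ∞ v) (c : ℂ) (i : Fin n) :
    pd i (fun x => c * v x) = fun x => c * pd i v x := by
  funext x
  simp only [pd]
  rw [fderiv_const_mul (contDiff_differentiable hv x)]
  rfl

lemma pd_sum {ι : Type*} {s : Finset ι} {v : ι → (Fin n → ℝ) → ℂ}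
    (hv : ∀ j ∈ s, ContDiff ℝ ∞ (v j)) (i : Fin n) :
    pd i (fun x => ∑ j ∈ s, v j x) = fun x => ∑ j ∈ s, pd i (v j) x := by
  funext x
  simp only [pd]
  rw [fderiv_fun_sum fun j hj => contDiff_differentiable (hv j hj) x]
  simp

lemma pd_comm {v : (Fin n → ℝ) → ℂ} (hv : ContDiff ℝ ∞ v) (i j : Fin n) :
    pd i (pd j v) = pd j (pd i v) := by
  funext x
  have hd : DifferentiableAt ℝ (fderiv ℝ v) x :=
    ((contDiff_infty_iff_fderiv.1 hv).2.differentiable (by simp)) x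
  have h : ∀ a b : Fin n, pd a (pd b v) x =
      fderiv ℝ (fderiv ℝ v) x (Pi.single a 1) (Pi.single b 1) := by
    intro a b
    change fderiv ℝ (fun y => fderiv ℝ v y (Pi.single b 1)) x (Pi.single a 1) = _
    rw [fderiv_clm_apply hd (differentiableAt_const _)]
    simp
  have hs : IsSymmSndFDerivAt ℝ v x :=
    hv.contDiffAt.isSymmSndFDerivAt (by
      rw [minSmoothness_of_isRCLikeNormedField]
      exact WithTop.coe_le_coe.2 (le_top : (2 : ℕ∞) ≤ ⊤))
  rw [h, h, hs.eq]

lemma pdl_perm {v : (Fin n → ℝ) → ℂ} (hv : ContDiff ℝ ∞ v) {l m : List (Fin n)}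
    (h : l.Perm m) : pdl l v = pdl m v := by
  induction h with
  | nil => rfl
  | cons i _ ih => exact congrArg (pd i) ih
  | swap i j l => exact pd_comm (contDiff_pdl hv l) j i
  | trans _ _ h1 h2 => exact h1.trans h2

lemma pdl_eq_mderiv {v : (Fin n → ℝ) → ℂ} (hv : ContDiff ℝ ∞ v) (l : List (Fin n)) :
    ∃ β : Fin n → ℕ, ∑ i, β i = l.length ∧ pdl l v = mderiv β v :=
  ⟨fun i => l.count i, by rw [← length_multiList, ← (perm_multiList_count l).length_eq],
    by rw [mderiv_eq_pdl, ← pdl_perm hv (perm_multiList_count l)]⟩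

lemma pdl_add {u v : (Fin n → ℝ) → ℂ} (hu : ContDiff ℝ ∞ u) (hv : ContDiff ℝ ∞ v)
    (l : List (Fin n)) :
    pdl l (fun x => u x + v x) = fun x => pdl l u x + pdl l v x := by
  induction l with
  | nil => rfl
  | cons i l ih =>
    change pd i (pdl l _) = _
    rw [ih, pd_add (contDiff_pdl hu l) (contDiff_pdl hv l)]
    rfl

lemma pdl_const_mul {v : (Fin n → ℝ) → ℂ} (hv : ContDiff ℝ ∞ v) (c : ℂ) (l : List (Fin n)) :
    pdl l (fun x => c * v x) = fun x => c * pdl l v x := by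
  induction l with
  | nil => rfl
  | cons i l ih =>
    change pd i (pdl l _) = _
    rw [ih, pd_const_mul (contDiff_pdl hv l)]
    rfl

lemma pdl_sum {ι : Type*} {s : Finset ι} {v : ι → (Fin n → ℝ) → ℂ}
    (hv : ∀ j ∈ s, ContDiff ℝ ∞ (v j)) (l : List (Fin n)) :
    pdl l (fun x => ∑ j ∈ s, v j x) = fun x => ∑ j ∈ s, pdl l (v j) x := by
  induction l with
  | nil => rfl
  | cons i l ih =>
    change pd i (pdl l _) = _
    rw [ih, pd_sum fun j hj => contDiff_pdl (hv j hj) l]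
    rfl

lemma pd_congr {u v : (Fin n → ℝ) → ℂ} {x : Fin n → ℝ} (h : u =ᶠ[𝓝 x] v) (i : Fin n) :
    pd i u =ᶠ[𝓝 x] pd i v := by
  filter_upwards [h.fderiv (𝕜 := ℝ)] with y hy
  simp only [pd, hy]

lemma pdl_congr {u v : (Fin n → ℝ) → ℂ} {x : Fin n → ℝ} (h : u =ᶠ[𝓝 x] v)
    (l : List (Fin n)) : pdl l u =ᶠ[𝓝 x] pdl l v := by
  induction l with
  | nil => exact h
  | cons i l ih => exact pd_congr ih i

lemma pd_translate (v : (Fin n → ℝ) → ℂ) (a : Fin n → ℝ) (i : Fin n) :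
    pd i (fun x => v (x + a)) = fun x => pd i v (x + a) := by
  funext x
  simp only [pd]
  rw [fderiv_comp_add_right]

lemma pdl_translate (v : (Fin n → ℝ) → ℂ) (a : Fin n → ℝ) (l : List (Fin n)) :
    pdl l (fun x => v (x + a)) = fun x => pdl l v (x + a) := by
  induction l with
  | nil => rfl
  | cons i l ih =>
    change pd i (pdl l _) = _
    rw [ih, pd_translate]
    rfl

lemma pd_zero (i : Fin n) : pd i (fun _ => 0) = fun _ => 0 := by
  funext x; simp [pd]

lemma pdl_zero (l : List (Fin n)) : pdl l (fun _ => 0) = fun _ => 0 := by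
  induction l with
  | nil => rfl
  | cons i l ih =>
    change pd i (pdl l _) = _
    rw [ih, pd_zero]

/-- All partial derivatives of `v` of order at most `N` are bounded by `B`. -/
def DerivBound (N : ℕ) (B : ℝ) (v : (Fin n → ℝ) → ℂ) : Prop :=
  ∀ l : List (Fin n), l.length ≤ N → ∀ x, ‖pdl l v x‖ ≤ B

lemma derivBound_of_mderiv {N : ℕ} {B : ℝ} {v : (Fin n → ℝ) → ℂ} (hv : ContDiff ℝ ∞ v)
    (h : ∀ γ : Fin n → ℕ, ∑ i, γ i ≤ N → ∀ y, ‖mderiv γ v y‖ ≤ B) : DerivBound N B v := by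
  intro l hl x
  obtain ⟨β, hβ, he⟩ := pdl_eq_mderiv hv l
  rw [he]
  exact h β (hβ.trans_le hl) x

lemma DerivBound.norm_le {N : ℕ} {B : ℝ} {v : (Fin n → ℝ) → ℂ} (h : DerivBound N B v)
    (x : Fin n → ℝ) : ‖v x‖ ≤ B := h [] (Nat.zero_le _) x

lemma DerivBound.nonneg {N : ℕ} {B : ℝ} {v : (Fin n → ℝ) → ℂ} (h : DerivBound N B v) :
    0 ≤ B := (norm_nonneg _).trans (h.norm_le 0)

lemma DerivBound.mono {N N' : ℕ} {B B' : ℝ} {v : (Fin n → ℝ) → ℂ} (h : DerivBound N B v)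
    (hN : N' ≤ N) (hB : B ≤ B') : DerivBound N' B' v :=
  fun l hl x => (h l (hl.trans hN) x).trans hB

lemma DerivBound.pd {N : ℕ} {B : ℝ} {v : (Fin n → ℝ) → ℂ} (h : DerivBound (N + 1) B v)
    (i : Fin n) : DerivBound N B (pd i v) := by
  intro l hl x
  rw [← pdl_append_singleton]
  exact h _ (by simpa using hl) x

lemma DerivBound.add {N : ℕ} {A B : ℝ} {u v : (Fin n → ℝ) → ℂ} (hu : ContDiff ℝ ∞ u)
    (hv : ContDiff ℝ ∞ v) (h : DerivBound N A u) (h' : DerivBound N B v) :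
    DerivBound N (A + B) (fun x => u x + v x) := by
  intro l hl x
  rw [pdl_add hu hv]
  exact (norm_add_le _ _).trans (add_le_add (h l hl x) (h' l hl x))

lemma DerivBound.const_mul {N : ℕ} {B : ℝ} {v : (Fin n → ℝ) → ℂ} (hv : ContDiff ℝ ∞ v)
    (h : DerivBound N B v) (c : ℂ) : DerivBound N (‖c‖ * B) (fun x => c * v x) := by
  intro l hl x
  rw [pdl_const_mul hv, norm_mul]
  exact mul_le_mul_of_nonneg_left (h l hl x) (norm_nonneg _)

lemma DerivBound.sum {ι : Type*} {s : Finset ι} {N : ℕ} {B : ι → ℝ}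
    {v : ι → (Fin n → ℝ) → ℂ} (hv : ∀ j ∈ s, ContDiff ℝ ∞ (v j))
    (h : ∀ j ∈ s, DerivBound N (B j) (v j)) :
    DerivBound N (∑ j ∈ s, B j) (fun x => ∑ j ∈ s, v j x) := by
  intro l hl x
  rw [pdl_sum hv]
  exact (norm_sum_le _ _).trans (Finset.sum_le_sum fun j hj => h j hj l hl x)

lemma DerivBound.mul {N : ℕ} {A B : ℝ} {u v : (Fin n → ℝ) → ℂ} (hu : ContDiff ℝ ∞ u)
    (hv : ContDiff ℝ ∞ v) (h : DerivBound N A u) (h' : DerivBound N B v) :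
    DerivBound N (2 ^ N * (A * B)) (fun x => u x * v x) := by
  have key : ∀ N : ℕ, ∀ u v : (Fin n → ℝ) → ℂ, ContDiff ℝ ∞ u → ContDiff ℝ ∞ v →
      DerivBound N A u → DerivBound N B v →
      ∀ l : List (Fin n), l.length = N → ∀ x, ‖pdl l (fun x => u x * v x) x‖ ≤ 2 ^ N * (A * B) := by
    intro N
    induction N with
    | zero =>
      intro u v _ _ h h' l hl x
      rw [List.length_eq_zero_iff.1 hl]
      simpa [pdl] using mul_le_mul (h.norm_le x) (h'.norm_le x) (norm_nonneg _) h.nonneg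
    | succ N ih =>
      intro u v hu hv h h' l hl x
      obtain ⟨l', i, rfl⟩ : ∃ l' i, l = l' ++ [i] := by
        have hne : l ≠ [] := by rintro rfl; simp at hl
        exact ⟨l.dropLast, l.getLast hne, (List.dropLast_append_getLast hne).symm⟩
      have hl' : l'.length = N := by simpa using hl
      rw [pdl_append_singleton, pd_mul hu hv,
        pdl_add ((contDiff_pd hu i).mul hv) (hu.mul (contDiff_pd hv i))]
      have h1 := ih (ToroidalPsDO.pd i u) v (contDiff_pd hu i) hv (h.pd i)
        (h'.mono (Nat.le_succ N) le_rfl) l' hl' x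
      have h2 := ih u (ToroidalPsDO.pd i v) hu (contDiff_pd hv i)
        (h.mono (Nat.le_succ N) le_rfl) (h'.pd i) l' hl' x
      refine (norm_add_le _ _).trans ((add_le_add h1 h2).trans_eq ?_)
      ring
  intro l hl x
  refine (key l.length u v hu hv (h.mono hl le_rfl) (h'.mono hl le_rfl) l rfl x).trans ?_
  have := mul_nonneg h.nonneg h'.nonneg
  gcongr
  norm_num

/-! ### Exponentials and test functions -/

lemma expo_eq (L : ℝ) (k : Fin n → ℤ) (x : Fin n → ℝ) :
    expo L k x = Complex.exp (∑ i, Complex.I * (2 * Real.pi / L * k i) * x i) := by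
  unfold expo
  congr 1
  push_cast
  rw [Finset.mul_sum, Finset.mul_sum]
  exact Finset.sum_congr rfl fun i _ => by ring

lemma norm_expo (L : ℝ) (k : Fin n → ℤ) (x : Fin n → ℝ) : ‖expo L k x‖ = 1 := by
  unfold expo
  rw [mul_comm, Complex.norm_exp_ofReal_mul_I]

lemma expo_zero (L : ℝ) (x : Fin n → ℝ) : expo L 0 x = 1 := by simp [expo]

lemma expo_add (L : ℝ) (k l : Fin n → ℤ) (x : Fin n → ℝ) :
    expo L (k + l) x = expo L k x * expo L l x := by
  simp only [expo_eq, ← Complex.exp_add, ← Finset.sum_add_distrib]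
  congr 1
  refine Finset.sum_congr rfl fun i _ => ?_
  simp only [Pi.add_apply]
  push_cast
  ring

lemma expo_neg_mul (L : ℝ) (k : Fin n → ℤ) (x : Fin n → ℝ) : expo L (-k) x * expo L k x = 1 := by
  rw [← expo_add, neg_add_cancel, expo_zero]

lemma contDiff_expo (L : ℝ) (k : Fin n → ℤ) : ContDiff ℝ ∞ (expo L k) := by
  unfold expo
  refine ContDiff.cexp (contDiff_const.mul (Complex.ofRealCLM.contDiff.comp
    (contDiff_const.mul (ContDiff.sum fun i _ => ?_))))
  fun_prop

lemma pd_expo (L : ℝ) (k : Fin n → ℤ) (i : Fin n) :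
    pd i (expo L k) = fun x => Complex.I * (2 * Real.pi / L * k i) * expo L k x := by
  funext x
  have h1 : HasFDerivAt (fun y : Fin n → ℝ => (2 * Real.pi / L) * ∑ j, (k j : ℝ) * y j)
      ((2 * Real.pi / L) • ∑ j, (k j : ℝ) • ContinuousLinearMap.proj (R := ℝ)
        (φ := fun _ : Fin n => ℝ) j) x := by
    refine HasFDerivAt.const_mul ?_ _
    refine HasFDerivAt.fun_sum fun j _ => ?_
    exact (ContinuousLinearMap.hasFDerivAt (ContinuousLinearMap.proj (R := ℝ)
        (φ := fun _ : Fin n => ℝ) j)).const_mul _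
  have h2 := ((Complex.ofRealCLM.hasFDerivAt (x := (2 * Real.pi / L) * ∑ j, (k j : ℝ) * x j)).comp
    x h1).const_mul Complex.I |>.cexp
  have h3 : HasFDerivAt (expo L k) _ x := h2
  simp only [pd]
  rw [h3.fderiv]
  simp [expo, Pi.single_apply]
  ring

lemma expo_periodic {L : ℝ} (hL : L ≠ 0) (k : Fin n → ℤ) (x : Fin n → ℝ) (m : Fin n → ℤ) :
    expo L k (fun i => x i + L * (m i : ℝ)) = expo L k x := by
  unfold expo
  rw [Complex.exp_eq_exp_iff_exists_int]
  refine ⟨∑ i, k i * m i, ?_⟩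
  push_cast
  simp only [mul_add, Finset.sum_add_distrib, add_right_inj]
  simp only [Finset.mul_sum, Finset.sum_mul]
  refine Finset.sum_congr rfl fun i _ => ?_
  have : (L : ℂ) ≠ 0 := by exact_mod_cast hL
  field_simp

lemma isTestFunction_expo {L : ℝ} (hL : L ≠ 0) (k : Fin n → ℤ) : IsTestFunction L (expo L k) :=
  ⟨contDiff_expo L k, expo_periodic hL k⟩

lemma IsTestFunction.add {L : ℝ} {u v : (Fin n → ℝ) → ℂ} (hu : IsTestFunction L u)
    (hv : IsTestFunction L v) : IsTestFunction L (fun x => u x + v x) :=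
  ⟨hu.smooth.add hv.smooth, fun x m => by rw [hu.periodic, hv.periodic]⟩

lemma IsTestFunction.mul {L : ℝ} {u v : (Fin n → ℝ) → ℂ} (hu : IsTestFunction L u)
    (hv : IsTestFunction L v) : IsTestFunction L (fun x => u x * v x) :=
  ⟨hu.smooth.mul hv.smooth, fun x m => by rw [hu.periodic, hv.periodic]⟩

lemma IsTestFunction.const_mul {L : ℝ} {u : (Fin n → ℝ) → ℂ} (hu : IsTestFunction L u) (c : ℂ) :
    IsTestFunction L (fun x => c * u x) :=
  ⟨contDiff_const.mul hu.smooth, fun x m => by rw [hu.periodic]⟩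

lemma IsTestFunction.sum {ι : Type*} {s : Finset ι} {L : ℝ} {u : ι → (Fin n → ℝ) → ℂ}
    (hu : ∀ j ∈ s, IsTestFunction L (u j)) : IsTestFunction L (fun x => ∑ j ∈ s, u j x) :=
  ⟨ContDiff.sum fun j hj => (hu j hj).smooth,
    fun x m => Finset.sum_congr rfl fun j hj => (hu j hj).periodic x m⟩

lemma IsTestFunction.pd {L : ℝ} {u : (Fin n → ℝ) → ℂ} (hu : IsTestFunction L u) (i : Fin n) :
    IsTestFunction L (pd i u) := by
  refine ⟨contDiff_pd hu.smooth i, fun x m => ?_⟩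
  have h := congrFun (pd_translate u (fun i => L * (m i : ℝ)) i) x
  have h2 : (fun y => u (y + fun i => L * (m i : ℝ))) = u := funext fun y => hu.periodic y m
  rw [h2] at h
  exact h.symm

lemma IsTestFunction.pdl {L : ℝ} {u : (Fin n → ℝ) → ℂ} (hu : IsTestFunction L u)
    (l : List (Fin n)) : IsTestFunction L (pdl l u) := by
  induction l with
  | nil => exact hu
  | cons i l ih => exact ih.pd i

/-- A continuous periodic function is bounded. -/
lemma exists_bound_of_periodic {L : ℝ} (hL : 0 < L) {u : (Fin n → ℝ) → ℂ} (hc : Continuous u)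
    (hp : ∀ (x : Fin n → ℝ) (m : Fin n → ℤ), u (fun i => x i + L * (m i : ℝ)) = u x) :
    ∃ B, ∀ x, ‖u x‖ ≤ B := by
  obtain ⟨B, hB⟩ := (isCompact_Icc (a := (0 : Fin n → ℝ)) (b := fun _ => L)).exists_bound_of_continuousOn
    hc.continuousOn
  refine ⟨B, fun x => ?_⟩
  rw [← hp x (fun i => -⌊x i / L⌋)]
  apply hB
  constructor
  · intro i
    have := Int.floor_le (x i / L)
    rw [le_div_iff₀ hL] at this
    simp only [Pi.zero_apply]; push_cast; linarith
  · intro i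
    have := Int.lt_floor_add_one (x i / L)
    rw [div_lt_iff₀ hL] at this
    push_cast; linarith

lemma IsTestFunction.exists_derivBound {L : ℝ} (hL : 0 < L) {u : (Fin n → ℝ) → ℂ}
    (hu : IsTestFunction L u) (N : ℕ) : ∃ B, DerivBound N B u := by
  have hfin : {l : List (Fin n) | l.length ≤ N}.Finite := List.finite_length_le (Fin n) N
  have h : ∀ l : List (Fin n), ∃ B, ∀ x, ‖ToroidalPsDO.pdl l u x‖ ≤ B := fun l =>
    exists_bound_of_periodic hL (hu.pdl l).smooth.continuous (hu.pdl l).periodic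
  choose B hB using h
  obtain ⟨M, hM⟩ := (hfin.image B).bddAbove
  exact ⟨M, fun l hl x => (hB l x).trans (hM ⟨l, hl, rfl⟩)⟩

/-! ### Fourier coefficients on a cube -/

lemma cube_eq_pi (L : ℝ) (c : Fin n → ℝ) :
    cube L c = Set.pi Set.univ fun i => Set.Ioo (c i - L / 2) (c i + L / 2) := by
  ext x; simp [cube]

lemma isOpen_cube (L : ℝ) (c : Fin n → ℝ) : IsOpen (cube L c) := by
  rw [cube_eq_pi]
  exact isOpen_set_pi Set.finite_univ fun i _ => isOpen_Ioo

lemma cube_ae_eq_Icc (L : ℝ) (c : Fin n → ℝ) :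
    cube L c =ᵐ[MeasureTheory.volume] Set.Icc (fun i => c i - L / 2) (fun i => c i + L / 2) := by
  rw [cube_eq_pi]
  exact MeasureTheory.Measure.univ_pi_Ioo_ae_eq_Icc

lemma volume_cube (L : ℝ) (c : Fin n → ℝ) :
    MeasureTheory.volume (cube L c) = ENNReal.ofReal L ^ n := by
  rw [cube_eq_pi, Real.volume_pi_Ioo]
  simp

lemma integrableOn_cube (L : ℝ) (c : Fin n → ℝ) {f : (Fin n → ℝ) → ℂ} (hf : Continuous f) :
    MeasureTheory.IntegrableOn f (cube L c) :=
  (hf.continuousOn.integrableOn_compact isCompact_Icc).congr_set_ae (cube_ae_eq_Icc L c)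

lemma integrableOn_cube_mul (L : ℝ) (c : Fin n → ℝ) {f h : (Fin n → ℝ) → ℂ}
    (hf : Continuous f) (hh : Continuous h) :
    MeasureTheory.IntegrableOn (fun x => f x * h x) (cube L c) :=
  integrableOn_cube L c (hf.mul hh)

lemma fourierOn_congr {L : ℝ} {c : Fin n → ℝ} {f h : (Fin n → ℝ) → ℂ}
    (e : ∀ x ∈ cube L c, f x = h x) : fourierOn L c f = fourierOn L c h := by
  funext k
  unfold fourierOn
  rw [MeasureTheory.setIntegral_congr_fun (isOpen_cube L c).measurableSet]
  intro x hx
  simp only [e x hx]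

lemma fourierOn_add (L : ℝ) (c : Fin n → ℝ) {f h : (Fin n → ℝ) → ℂ} (hf : Continuous f)
    (hh : Continuous h) (k : Fin n → ℤ) :
    fourierOn L c (fun x => f x + h x) k = fourierOn L c f k + fourierOn L c h k := by
  have he := (contDiff_expo (n := n) L (-k)).continuous
  unfold fourierOn
  rw [← mul_add, ← MeasureTheory.integral_add (integrableOn_cube_mul L c hf he)
    (integrableOn_cube_mul L c hh he)]
  simp only [add_mul]

lemma fourierOn_const_mul (L : ℝ) (c : Fin n → ℝ) (f : (Fin n → ℝ) → ℂ) (a : ℂ)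
    (k : Fin n → ℤ) :
    fourierOn L c (fun x => a * f x) k = a * fourierOn L c f k := by
  unfold fourierOn
  simp only [mul_assoc]
  rw [MeasureTheory.integral_const_mul]
  ring

lemma fourierOn_sum {ι : Type*} (s : Finset ι) (L : ℝ) (c : Fin n → ℝ)
    {f : ι → (Fin n → ℝ) → ℂ} (hf : ∀ j ∈ s, Continuous (f j)) (k : Fin n → ℤ) :
    fourierOn L c (fun x => ∑ j ∈ s, f j x) k = ∑ j ∈ s, fourierOn L c (f j) k := by
  have he := (contDiff_expo (n := n) L (-k)).continuous
  unfold fourierOn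
  rw [← Finset.mul_sum, ← MeasureTheory.integral_finsetSum s
    fun j hj => integrableOn_cube_mul L c (hf j hj) he]
  simp only [Finset.sum_mul]

lemma norm_fourierOn_le {L : ℝ} (hL : 0 < L) (c : Fin n → ℝ) {f : (Fin n → ℝ) → ℂ} {B : ℝ}
    (hB : ∀ x ∈ cube L c, ‖f x‖ ≤ B) (k : Fin n → ℤ) : ‖fourierOn L c f k‖ ≤ B := by
  have h := MeasureTheory.norm_setIntegral_le_of_norm_le_const (μ := MeasureTheory.volume)
    (s := cube L c) (f := fun y => f y * expo L (-k) y) (C := B)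
    (by rw [volume_cube]; exact ENNReal.pow_lt_top ENNReal.ofReal_lt_top)
    (fun x hx => by rw [norm_mul, norm_expo, mul_one]; exact hB x hx)
  rw [MeasureTheory.measureReal_def, volume_cube, ENNReal.toReal_pow,
    ENNReal.toReal_ofReal hL.le] at h
  unfold fourierOn
  rw [norm_mul, norm_inv, Complex.norm_real, Real.norm_eq_abs, abs_of_pos (pow_pos hL n)]
  rw [inv_mul_le_iff₀ (pow_pos hL n), mul_comm]
  exact h

/-! ### Integration by parts -/

/-- Smooth functions that agree near opposite faces of the cube with centre `c` and side length
`L`, so that integration by parts on the cube produces no boundary terms.  This covers both the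
functions of period `L` and the functions that vanish near the boundary of the cube. -/
structure FaceMatching (L : ℝ) (c : Fin n → ℝ) (f : (Fin n → ℝ) → ℂ) : Prop where
  smooth : ContDiff ℝ ∞ f
  matching : ∀ (i : Fin n) (x : Fin n → ℝ), x i = c i - L / 2 →
    ∀ᶠ y in 𝓝 x, f (y + Pi.single i L) = f y

lemma IsTestFunction.faceMatching {L : ℝ} {f : (Fin n → ℝ) → ℂ} (hf : IsTestFunction L f)
    (c : Fin n → ℝ) : FaceMatching L c f := by
  refine ⟨hf.smooth, fun i x _ => Eventually.of_forall fun y => ?_⟩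
  rw [← hf.periodic y (Pi.single i 1)]
  congr 1
  funext l
  by_cases h : l = i
  · subst h; simp
  · simp [h]

lemma FaceMatching.pd {L : ℝ} {c : Fin n → ℝ} {f : (Fin n → ℝ) → ℂ} (hf : FaceMatching L c f)
    (j : Fin n) : FaceMatching L c (pd j f) := by
  refine ⟨contDiff_pd hf.smooth j, fun i x hx => ?_⟩
  have h : (fun y => f (y + Pi.single i L)) =ᶠ[𝓝 x] f := hf.matching i x hx
  have h2 := pd_congr h j
  rwa [pd_translate] at h2

lemma FaceMatching.add {L : ℝ} {c : Fin n → ℝ} {f h : (Fin n → ℝ) → ℂ}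
    (hf : FaceMatching L c f) (hh : FaceMatching L c h) :
    FaceMatching L c (fun x => f x + h x) := by
  refine ⟨hf.smooth.add hh.smooth, fun i x hx => ?_⟩
  filter_upwards [hf.matching i x hx, hh.matching i x hx] with y h1 h2
  rw [h1, h2]

lemma FaceMatching.mul {L : ℝ} {c : Fin n → ℝ} {f h : (Fin n → ℝ) → ℂ}
    (hf : FaceMatching L c f) (hh : FaceMatching L c h) :
    FaceMatching L c (fun x => f x * h x) := by
  refine ⟨hf.smooth.mul hh.smooth, fun i x hx => ?_⟩
  filter_upwards [hf.matching i x hx, hh.matching i x hx] with y h1 h2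
  rw [h1, h2]

lemma FaceMatching.const_mul {L : ℝ} {c : Fin n → ℝ} {f : (Fin n → ℝ) → ℂ}
    (hf : FaceMatching L c f) (a : ℂ) : FaceMatching L c (fun x => a * f x) := by
  refine ⟨contDiff_const.mul hf.smooth, fun i x hx => ?_⟩
  filter_upwards [hf.matching i x hx] with y h1
  rw [h1]

lemma FaceMatching.sum {ι : Type*} (s : Finset ι) {L : ℝ} {c : Fin n → ℝ}
    {f : ι → (Fin n → ℝ) → ℂ} (hf : ∀ j ∈ s, FaceMatching L c (f j)) :
    FaceMatching L c (fun x => ∑ j ∈ s, f j x) := by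
  refine ⟨ContDiff.sum fun j hj => (hf j hj).smooth, fun i x hx => ?_⟩
  have := (Filter.eventually_all_finset s).2 fun j hj => (hf j hj).matching i x hx
  filter_upwards [this] with y hy
  exact Finset.sum_congr rfl hy

/-- The divergence theorem for one component: the boundary terms on opposite faces cancel. -/
lemma integral_cube_pd_eq_zero {L : ℝ} (hL : 0 < L) {c : Fin n → ℝ} {f : (Fin n → ℝ) → ℂ}
    (hf : FaceMatching L c f) (i : Fin n) : ∫ y in cube L c, pd i f y = 0 := by
  rcases n with _ | n
  · exact i.elim0
  rw [MeasureTheory.setIntegral_congr_set (cube_ae_eq_Icc L c)]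
  have hd := contDiff_differentiable hf.smooth
  set a : Fin (n + 1) → ℝ := fun l => c l - L / 2 with ha
  set b : Fin (n + 1) → ℝ := fun l => c l + L / 2 with hb
  -- the vector field has the component `f` in the direction `i` and no others
  have key := MeasureTheory.integral_divergence_of_hasFDerivAt_off_countable' (E := ℂ) a b
    (fun l => by simp only [ha, hb]; linarith)
    (fun l => if l = i then f else 0) (fun l => if l = i then fderiv ℝ f else 0) ∅
    Set.countable_empty
    (fun l => by
      by_cases h : l = i
      · simpa [h] using hf.smooth.continuous.continuousOn
      · rw [if_neg h]
        exact continuousOn_const)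
    (fun x _ l => by
      by_cases h : l = i
      · simpa [h] using (hd x).hasFDerivAt
      · rw [if_neg h, if_neg h]
        exact hasFDerivAt_const (0 : ℂ) x)
    (by
      have : (fun x => ∑ l : Fin (n + 1),
          (if l = i then fderiv ℝ f else 0) x (Pi.single l 1)) = pd i f := by
        funext x
        rw [Finset.sum_eq_single i (fun l _ h => by simp [h]) (by simp)]
        simp [pd]
      rw [this]
      exact (contDiff_pd hf.smooth i).continuous.continuousOn.integrableOn_compact isCompact_Icc)
  have h1 : (∫ x in Set.Icc a b, ∑ l : Fin (n + 1),
      (if l = i then fderiv ℝ f else 0) x (Pi.single l 1)) = ∫ x in Set.Icc a b, pd i f x := by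
    congr 1
    funext x
    rw [Finset.sum_eq_single i (fun l _ h => by simp [h]) (by simp)]
    simp [pd]
  rw [h1, Finset.sum_eq_single i (fun l _ h => by simp [h]) (by simp)] at key
  rw [key, sub_eq_zero]
  congr 1
  funext x
  simp only [if_true]
  have h2 := (hf.matching i (i.insertNth (a i) x) (by simp [ha])).self_of_nhds
  rw [← h2]
  congr 1
  funext l
  refine Fin.succAboveCases i ?_ (fun l => ?_) l
  · simp [ha, hb]; ring
  · simp

lemma fourierOn_pd {L : ℝ} (hL : 0 < L) {c : Fin n → ℝ} {f : (Fin n → ℝ) → ℂ}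
    (hf : FaceMatching L c f) (i : Fin n) (k : Fin n → ℤ) :
    fourierOn L c (pd i f) k = Complex.I * (2 * Real.pi / L * k i) * fourierOn L c f k := by
  have he := (isTestFunction_expo hL.ne' (-k)).faceMatching c
  have h := integral_cube_pd_eq_zero hL (hf.mul he) i
  rw [pd_mul hf.smooth he.smooth, MeasureTheory.integral_add
    (integrableOn_cube_mul L c (hf.pd i).smooth.continuous he.smooth.continuous)
    (integrableOn_cube_mul L c hf.smooth.continuous (he.pd i).smooth.continuous), pd_expo] at h
  have h2 : ∀ y, f y * (Complex.I * (2 * Real.pi / L * ((-k) i : ℤ)) * expo L (-k) y) =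
      -(Complex.I * (2 * Real.pi / L * k i)) * (f y * expo L (-k) y) := by
    intro y
    simp only [Pi.neg_apply]
    push_cast
    ring
  simp only [h2] at h
  rw [MeasureTheory.integral_const_mul] at h
  unfold fourierOn
  linear_combination ((L ^ n : ℝ) : ℂ)⁻¹ * h

lemma fourierOn_expo {L : ℝ} (hL : 0 < L) (c : Fin n → ℝ) (ξ k : Fin n → ℤ) :
    fourierOn L c (expo L ξ) k = if k = ξ then 1 else 0 := by
  by_cases h : k = ξ
  · subst h
    simp only [if_true]
    unfold fourierOn
    have : ∀ y, expo L k y * expo L (-k) y = 1 := fun y => by rw [mul_comm, expo_neg_mul]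
    simp only [this]
    rw [MeasureTheory.setIntegral_const, MeasureTheory.measureReal_def, volume_cube,
      ENNReal.toReal_pow, ENNReal.toReal_ofReal hL.le]
    have : ((L ^ n : ℝ) : ℂ) ≠ 0 := by exact_mod_cast (pow_pos hL n).ne'
    rw [Complex.real_smul, mul_one, inv_mul_cancel₀ this]
  · rw [if_neg h]
    obtain ⟨i, hi⟩ := Function.ne_iff.1 h
    have h1 := fourierOn_pd hL ((isTestFunction_expo hL.ne' ξ).faceMatching c) i k
    rw [pd_expo, fourierOn_const_mul] at h1
    have h2 : Complex.I * (2 * Real.pi / L) * ((ξ i : ℂ) - k i) * fourierOn L c (expo L ξ) k = 0 := by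
      linear_combination h1
    have hL' : (L : ℂ) ≠ 0 := by exact_mod_cast hL.ne'
    have hpi : (Real.pi : ℂ) ≠ 0 := by exact_mod_cast Real.pi_ne_zero
    have h3 : (ξ i : ℂ) - k i ≠ 0 := sub_ne_zero.2 fun h => hi (by exact_mod_cast h.symm)
    refine (mul_eq_zero.1 h2).resolve_left (mul_ne_zero (mul_ne_zero Complex.I_ne_zero ?_) h3)
    exact div_ne_zero (mul_ne_zero two_ne_zero hpi) hL'

/-! ### Fourier inversion -/

/-- A continuous function of period `L` with summable Fourier coefficients is the sum of its
Fourier series. -/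
lemma hasSum_fourierOn_of_periodic {L : ℝ} (hL : 0 < L) (c : Fin n → ℝ) {u : (Fin n → ℝ) → ℂ}
    (hu : Continuous u)
    (hp : ∀ (x : Fin n → ℝ) (m : Fin n → ℤ), u (fun i => x i + L * (m i : ℝ)) = u x)
    (hs : Summable (fourierOn L c u)) (x : Fin n → ℝ) :
    HasSum (fun k => fourierOn L c u k * expo L k x) (u x) := by
  -- Mathlib's inversion theorem is for the unit torus: `F` is `u`, rescaled, on the quotient
  let q : (Fin n → ℝ) → UnitAddTorus (Fin n) := Pi.map fun _ => ((↑) : ℝ → UnitAddCircle)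
  have hq : IsOpenQuotientMap q := IsOpenQuotientMap.piMap fun _ =>
    QuotientAddGroup.isOpenQuotientMap_mk
  have hfac : ∀ s t : Fin n → ℝ, q s = q t → u (L • s) = u (L • t) := by
    intro s t h
    have h1 : ∀ i, ∃ m : ℤ, s i - t i = m := by
      intro i
      have h2 : ((s i : ℝ) : UnitAddCircle) = (t i : ℝ) := congrFun h i
      have h3 : ((s i - t i : ℝ) : UnitAddCircle) = 0 := by
        rw [AddCircle.coe_sub, h2, sub_self]
      obtain ⟨m, hm⟩ := (AddCircle.coe_eq_zero_iff (1 : ℝ)).1 h3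
      exact ⟨m, by simpa using hm.symm⟩
    choose m hm using h1
    rw [← hp (L • t) m]
    congr 1
    funext i
    simp only [Pi.smul_apply, smul_eq_mul, ← hm]
    ring
  obtain ⟨F, hF⟩ : ∃ F : UnitAddTorus (Fin n) → ℂ, ∀ s, F (q s) = u (L • s) := by
    refine ⟨fun t => u (L • (hq.surjective t).choose), fun s => ?_⟩
    exact hfac _ _ (hq.surjective (q s)).choose_spec
  have hFc : Continuous F := by
    rw [hq.isQuotientMap.continuous_iff]
    have : F ∘ q = fun s => u (L • s) := funext hF
    rw [this]
    exact hu.comp (continuous_const_smul L)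
  have hexp : ∀ (k : Fin n → ℤ) (s : Fin n → ℝ),
      UnitAddTorus.mFourier k (q s) = expo L k (L • s) := by
    intro k s
    have hL' : (L : ℂ) ≠ 0 := by exact_mod_cast hL.ne'
    simp only [UnitAddTorus.mFourier, ContinuousMap.coe_mk, expo_eq, Complex.exp_sum, q, Pi.map]
    refine Finset.prod_congr rfl fun i _ => ?_
    rw [fourier_coe_apply]
    congr 1
    simp only [Pi.smul_apply, smul_eq_mul]
    push_cast
    field_simp
  have hcoef : ∀ k, UnitAddTorus.mFourierCoeff F k = fourierOn L c u k := by
    intro k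
    rw [UnitAddTorus.mFourierCoeff_eq_integral F k fun i => c i / L - 1 / 2]
    have h1 : ∀ s : Fin n → ℝ, UnitAddTorus.mFourier (-k) (fun i => (s i : UnitAddCircle)) •
        F (fun i => (s i : UnitAddCircle)) = u (L • s) * expo L (-k) (L • s) := by
      intro s
      have h2 : UnitAddTorus.mFourier (-k) (fun i => (s i : UnitAddCircle)) = _ := hexp (-k) s
      have h3 : F (fun i => (s i : UnitAddCircle)) = _ := hF s
      rw [h2, h3, smul_eq_mul, mul_comm]
    simp only [h1]
    have h4 : {s : Fin n → ℝ | ∀ i, s i ∈ Set.Ioc (c i / L - 1 / 2) (c i / L - 1 / 2 + 1)}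
        =ᵐ[MeasureTheory.volume] (L⁻¹ • cube L c) := by
      have h5 : {s : Fin n → ℝ | ∀ i, s i ∈ Set.Ioc (c i / L - 1 / 2) (c i / L - 1 / 2 + 1)} =
          Set.pi Set.univ fun i => Set.Ioc (c i / L - 1 / 2) (c i / L - 1 / 2 + 1) := by
        ext s; simp
      have h6 : L⁻¹ • cube L c =
          Set.pi Set.univ fun i => Set.Ioo (c i / L - 1 / 2) (c i / L - 1 / 2 + 1) := by
        ext s
        rw [Set.mem_inv_smul_set_iff₀ hL.ne']
        simp only [cube, Set.mem_ofPred_eq, Set.mem_pi, Set.mem_univ, true_imp_iff, Set.mem_Ioo,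
          Pi.smul_apply, smul_eq_mul]
        refine forall_congr' fun i => ?_
        have e1 : c i / L - 1 / 2 < s i ↔ c i - L / 2 < L * s i := by
          rw [← mul_lt_mul_iff_right₀ hL]
          have : L * (c i / L - 1 / 2) = c i - L / 2 := by field_simp
          rw [this]
        have e2 : s i < c i / L - 1 / 2 + 1 ↔ L * s i < c i + L / 2 := by
          rw [← mul_lt_mul_iff_right₀ hL]
          have : L * (c i / L - 1 / 2 + 1) = c i + L / 2 := by field_simp; ring
          rw [this]
        rw [e1, e2]
      rw [h5, h6]
      exact (MeasureTheory.Measure.univ_pi_Ioc_ae_eq_Icc).trans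
        (MeasureTheory.Measure.univ_pi_Ioo_ae_eq_Icc).symm
    rw [MeasureTheory.setIntegral_congr_set h4]
    have h7 := MeasureTheory.Measure.setIntegral_comp_smul_of_pos
      (MeasureTheory.volume : MeasureTheory.Measure (Fin n → ℝ))
      (fun y => u y * expo L (-k) y) (L⁻¹ • cube L c) hL
    rw [smul_inv_smul₀ hL.ne'] at h7
    rw [h7]
    simp [fourierOn]
  have hsum := UnitAddTorus.hasSum_mFourier_series_apply_of_summable (f := ⟨F, hFc⟩)
    (by
      have : UnitAddTorus.mFourierCoeff F = fourierOn L c u := funext hcoef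
      simpa [this] using hs) (q (L⁻¹ • x))
  simp only [ContinuousMap.coe_mk, hcoef, hexp, hF, smul_inv_smul₀ hL.ne', smul_eq_mul] at hsum
  exact hsum

/-- Fourier inversion on the cube for a continuous function that vanishes near its boundary. -/
lemma hasSum_fourierOn_of_support {L : ℝ} (hL : 0 < L) (c : Fin n → ℝ) {f : (Fin n → ℝ) → ℂ}
    (hf : Continuous f) {ρ : ℝ} (hρ : ρ < L / 2)
    (hsupp : ∀ z, (∀ i, |z i - c i| ≤ L / 2) → f z ≠ 0 → ∀ i, |z i - c i| ≤ ρ)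
    (hs : Summable (fourierOn L c f)) {x : Fin n → ℝ} (hx : x ∈ cube L c) :
    HasSum (fun k => fourierOn L c f k * expo L k x) (f x) := by
  -- `r x` is the lattice vector that moves `x` into the closed cube
  let r : (Fin n → ℝ) → Fin n → ℤ := fun y i => -round ((y i - c i) / L)
  -- `w` is the extension of `f` from the cube to a function of period `L`; it is continuous because
  -- `f` vanishes where `r` jumps
  let w : (Fin n → ℝ) → ℂ := fun y => f fun i => y i + L * (r y i : ℝ)
  have hr : ∀ y i (m : ℤ), |y i + L * (r y i : ℝ) - c i| ≤ |y i + L * (m : ℝ) - c i| := by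
    intro y i m
    have h := round_le ((y i - c i) / L) (-m)
    have e : ∀ z : ℝ, |y i + L * z - c i| = L * |(y i - c i) / L + z| := by
      intro z
      rw [← abs_of_pos hL, ← abs_mul, abs_of_pos hL]
      congr 1
      field_simp
      ring
    rw [e, e]
    refine mul_le_mul_of_nonneg_left ?_ hL.le
    simp only [r]
    push_cast at h ⊢
    rw [← sub_eq_add_neg]
    simpa using h
  have hr2 : ∀ y i, |y i + L * (r y i : ℝ) - c i| ≤ L / 2 := by
    intro y i
    have h := abs_sub_round ((y i - c i) / L)
    have e : y i + L * (r y i : ℝ) - c i = L * ((y i - c i) / L - round ((y i - c i) / L)) := by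
      simp only [r]
      push_cast
      field_simp
      ring
    rw [e, abs_mul, abs_of_pos hL]
    calc _ ≤ L * (1 / 2) := mul_le_mul_of_nonneg_left h hL.le
      _ = L / 2 := by ring
  have huniq : ∀ y (m : Fin n → ℤ), (∀ i, |y i + L * (m i : ℝ) - c i| < L / 2) → r y = m := by
    intro y m h
    funext i
    have h1 := h i
    have h2 := hr2 y i
    have h3 : |L * ((r y i - m i : ℤ) : ℝ)| < L := by
      have : L * ((r y i - m i : ℤ) : ℝ) =
        (y i + L * (r y i : ℝ) - c i) - (y i + L * (m i : ℝ) - c i) := by push_cast; ring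
      rw [this]
      refine (abs_sub _ _).trans_lt ?_
      linarith
    rw [abs_mul, abs_of_pos hL] at h3
    have h4 : |((r y i - m i : ℤ) : ℝ)| < 1 := by
      by_contra h5
      rw [not_lt] at h5
      nlinarith
    rw [← Int.cast_abs] at h4
    have h5 : |r y i - m i| < 1 := by exact_mod_cast h4
    have := Int.abs_lt_one_iff.1 h5
    omega
  have hwp : ∀ (y : Fin n → ℝ) (m : Fin n → ℤ), w (fun i => y i + L * (m i : ℝ)) = w y := by
    intro y m
    simp only [w]
    congr 1
    funext i
    simp only [r]
    have : (y i + L * (m i : ℝ) - c i) / L = (y i - c i) / L + (m i : ℝ) := by field_simp; ring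
    rw [this, round_add_intCast]
    push_cast
    ring
  have hwc : Continuous w := by
    rw [continuous_iff_continuousAt]
    intro y
    by_cases hy : ∀ i, |y i + L * (r y i : ℝ) - c i| < L / 2
    · have h1 : ∀ᶠ z in 𝓝 y, ∀ i, |z i + L * (r y i : ℝ) - c i| < L / 2 := by
        rw [eventually_all]
        intro i
        have : Continuous fun z : Fin n → ℝ => |z i + L * (r y i : ℝ) - c i| := by fun_prop
        exact this.continuousAt.eventually_lt_const (hy i)
      have h2 : (fun z => f fun i => z i + L * (r y i : ℝ)) =ᶠ[𝓝 y] w := by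
        filter_upwards [h1] with z hz
        simp only [w]
        rw [huniq z (r y) hz]
      refine ContinuousAt.congr ?_ h2
      exact (hf.comp (by fun_prop)).continuousAt
    · push Not at hy
      obtain ⟨i, hi⟩ := hy
      have h1 : ∀ᶠ z in 𝓝 y, |z i - y i| < L / 2 - ρ := by
        have : Continuous fun z : Fin n → ℝ => |z i - y i| := by fun_prop
        refine this.continuousAt.eventually_lt_const ?_
        simpa using hρ
      have h2 : (fun _ => (0 : ℂ)) =ᶠ[𝓝 y] w := by
        filter_upwards [h1] with z hz
        by_contra hne
        have h3 := hsupp _ (hr2 z) (Ne.symm hne) i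
        have h4 := hr y i (r z i)
        have h5 : |y i + L * (r z i : ℝ) - c i| ≤
            |z i + L * (r z i : ℝ) - c i| + |z i - y i| := by
          have : y i + L * (r z i : ℝ) - c i =
            (z i + L * (r z i : ℝ) - c i) - (z i - y i) := by ring
          rw [this]
          exact abs_sub _ _
        linarith
      exact continuousAt_const.congr h2
  have hwf : ∀ y ∈ cube L c, w y = f y := by
    intro y hy
    have : r y = 0 := by
      apply huniq
      intro i
      have := hy i
      simp only [Pi.zero_apply, Int.cast_zero, mul_zero, add_zero]
      rw [abs_lt]
      constructor <;> linarith [this.1, this.2]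
    simp [w, this]
  have hco : fourierOn L c w = fourierOn L c f := fourierOn_congr hwf
  have := hasSum_fourierOn_of_periodic hL c hwc hwp (by rwa [hco]) x
  rwa [hco, hwf x hx] at this

/-! ### Weights on the dual lattice -/

/-- The multiplier `1 + A |2πk/L|²` of `1 - A Δ` on the torus of period `L`. -/
def weight (A L : ℝ) (k : Fin n → ℤ) : ℝ := 1 + A * ∑ i, (2 * Real.pi / L * (k i : ℝ)) ^ 2

lemma one_le_weight {A : ℝ} (hA : 0 ≤ A) (L : ℝ) (k : Fin n → ℤ) : 1 ≤ weight A L k := by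
  have : 0 ≤ A * ∑ i, (2 * Real.pi / L * (k i : ℝ)) ^ 2 :=
    mul_nonneg hA (Finset.sum_nonneg fun i _ => sq_nonneg _)
  unfold weight; linarith

lemma weight_pos {A : ℝ} (hA : 0 ≤ A) (L : ℝ) (k : Fin n → ℤ) : 0 < weight A L k :=
  one_pos.trans_le (one_le_weight hA L k)

lemma summable_inv_one_add_mul_sq {b : ℝ} (hb : 0 < b) :
    Summable fun k : ℤ => (1 + b * (k : ℝ) ^ 2)⁻¹ := by
  have h1 : Summable fun k : ℤ => b⁻¹ * (1 / (k : ℝ) ^ 2) :=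
    (Real.summable_one_div_int_pow.2 one_lt_two).mul_left _
  have h2 : Summable fun k : ℤ => if k = 0 then (1 : ℝ) else 0 :=
    summable_of_ne_finset_zero (s := {0}) (fun k hk => by simpa using hk)
  refine (h1.add h2).of_nonneg_of_le (fun k => by positivity) fun k => ?_
  by_cases hk : k = 0
  · simp [hk]
  · have hk' : (0 : ℝ) < (k : ℝ) ^ 2 := by positivity
    rw [if_neg hk, add_zero, one_div, ← mul_inv]
    exact inv_anti₀ (by positivity) (by linarith)

lemma summable_prod_inv {b : ℝ} (hb : 0 < b) (n : ℕ) :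
    Summable fun k : Fin n → ℤ => ∏ i, (1 + b * (k i : ℝ) ^ 2)⁻¹ := by
  induction n with
  | zero => exact Summable.of_finite
  | succ n ih =>
    rw [← (Fin.consEquiv fun _ : Fin (n + 1) => ℤ).summable_iff]
    have := (summable_inv_one_add_mul_sq hb).mul_of_nonneg ih (fun k => by positivity)
      (fun k => Finset.prod_nonneg fun i _ => by positivity)
    refine this.congr fun p => ?_
    simp [Fin.consEquiv, Fin.prod_univ_succ, mul_comm]

lemma summable_inv_weight_pow {A L : ℝ} (hA : 0 < A) (hL : 0 < L) :
    Summable fun k : Fin n → ℤ => (weight A L k ^ n)⁻¹ := by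
  have hb : 0 < A * (2 * Real.pi / L) ^ 2 := by have := Real.pi_pos; positivity
  refine (summable_prod_inv hb n).of_nonneg_of_le
    (fun k => inv_nonneg.2 (pow_nonneg (weight_pos hA.le L k).le n)) fun k => ?_
  rw [Finset.prod_inv_distrib]
  refine inv_anti₀ (Finset.prod_pos fun i _ => by positivity) ?_
  calc ∏ i, (1 + A * (2 * Real.pi / L) ^ 2 * (k i : ℝ) ^ 2) ≤ ∏ _i : Fin n, weight A L k := by
        refine Finset.prod_le_prod (fun i _ => by positivity) fun i _ => ?_
        unfold weight
        have := Finset.single_le_sum (f := fun i => (2 * Real.pi / L * (k i : ℝ)) ^ 2)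
          (fun i _ => sq_nonneg _) (Finset.mem_univ i)
        have := mul_le_mul_of_nonneg_left this hA.le
        simp only [mul_pow] at this ⊢
        linarith
    _ = weight A L k ^ n := by simp

/-- The differential operator `1 - A Δ`. -/
def helm (A : ℝ) (f : (Fin n → ℝ) → ℂ) : (Fin n → ℝ) → ℂ :=
  fun x => f x + (-A : ℂ) * ∑ i, pd i (pd i f) x

lemma FaceMatching.helm {L A : ℝ} {c : Fin n → ℝ} {f : (Fin n → ℝ) → ℂ}
    (hf : FaceMatching L c f) : FaceMatching L c (helm A f) :=
  hf.add ((FaceMatching.sum _ fun i _ => (hf.pd i).pd i).const_mul _)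

lemma FaceMatching.helm_iterate {L A : ℝ} {c : Fin n → ℝ} {f : (Fin n → ℝ) → ℂ}
    (hf : FaceMatching L c f) (M : ℕ) : FaceMatching L c ((ToroidalPsDO.helm A)^[M] f) := by
  induction M with
  | zero => exact hf
  | succ M ih => rw [Function.iterate_succ_apply']; exact ih.helm

lemma fourierOn_helm {L : ℝ} (hL : 0 < L) (A : ℝ) {c : Fin n → ℝ} {f : (Fin n → ℝ) → ℂ}
    (hf : FaceMatching L c f) (k : Fin n → ℤ) :
    fourierOn L c (helm A f) k = weight A L k * fourierOn L c f k := by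
  unfold helm
  have h1 := (FaceMatching.sum Finset.univ fun i _ => (hf.pd i).pd i)
  rw [fourierOn_add L c hf.smooth.continuous (h1.const_mul _).smooth.continuous,
    fourierOn_const_mul, fourierOn_sum _ L c fun i _ => ((hf.pd i).pd i).smooth.continuous]
  have h2 : ∀ i, fourierOn L c (pd i (pd i f)) k =
      -((2 * Real.pi / L * k i) ^ 2) * fourierOn L c f k := by
    intro i
    rw [fourierOn_pd hL (hf.pd i), fourierOn_pd hL hf]
    linear_combination (2 * Real.pi / L * k i : ℂ) ^ 2 * fourierOn L c f k * Complex.I_sq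
  simp only [h2, ← Finset.sum_mul, Finset.sum_neg_distrib]
  unfold weight
  push_cast
  ring

lemma fourierOn_helm_iterate {L : ℝ} (hL : 0 < L) (A : ℝ) {c : Fin n → ℝ}
    {f : (Fin n → ℝ) → ℂ} (hf : FaceMatching L c f) (M : ℕ) (k : Fin n → ℤ) :
    fourierOn L c ((helm A)^[M] f) k = weight A L k ^ M * fourierOn L c f k := by
  induction M with
  | zero => simp
  | succ M ih =>
    rw [Function.iterate_succ_apply', fourierOn_helm hL A (hf.helm_iterate M), ih]
    ring

lemma contDiff_helm {A : ℝ} {f : (Fin n → ℝ) → ℂ} (hf : ContDiff ℝ ∞ f) :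
    ContDiff ℝ ∞ (helm A f) :=
  hf.add (contDiff_const.mul (ContDiff.sum fun i _ => contDiff_pd (contDiff_pd hf i) i))

lemma DerivBound.helm {A : ℝ} {N : ℕ} {B : ℝ} {f : (Fin n → ℝ) → ℂ} (hf : ContDiff ℝ ∞ f)
    (h : DerivBound (N + 2) B f) : DerivBound N ((1 + |A| * n) * B) (helm A f) := by
  have h2 : ∀ i ∈ (Finset.univ : Finset (Fin n)), ContDiff ℝ ∞ (ToroidalPsDO.pd i (ToroidalPsDO.pd i f)) :=
    fun i _ => contDiff_pd (contDiff_pd hf i) i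
  have h1 := (h.mono (Nat.le_add_right N 2) le_rfl).add hf (contDiff_const.mul (ContDiff.sum h2))
    ((DerivBound.sum h2 fun i _ => (h.pd i).pd i).const_mul (ContDiff.sum h2) (-A : ℂ))
  refine h1.mono le_rfl (le_of_eq ?_)
  simp
  ring

lemma DerivBound.helm_iterate {A : ℝ} {N : ℕ} {B : ℝ} {f : (Fin n → ℝ) → ℂ}
    (hf : ContDiff ℝ ∞ f) (M : ℕ) (h : DerivBound (N + 2 * M) B f) :
    DerivBound N ((1 + |A| * n) ^ M * B) ((ToroidalPsDO.helm A)^[M] f) := by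
  induction M generalizing f B with
  | zero => simpa using h
  | succ M ih =>
    rw [Function.iterate_succ_apply]
    have := ih (contDiff_helm hf) (DerivBound.helm (A := A) (N := N + 2 * M) hf h)
    refine this.mono le_rfl (le_of_eq ?_)
    ring

/-- Decay of Fourier coefficients, from integration by parts. -/
lemma norm_fourierOn_le_of_derivBound {A L : ℝ} (hA : 0 ≤ A) (hL : 0 < L) {c : Fin n → ℝ}
    {f : (Fin n → ℝ) → ℂ} (hf : FaceMatching L c f) (M : ℕ) {B : ℝ}
    (h : DerivBound (2 * M) B f) (k : Fin n → ℤ) :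
    ‖fourierOn L c f k‖ ≤ (1 + A * n) ^ M * B * (weight A L k ^ M)⁻¹ := by
  have hw := pow_pos (weight_pos hA L k) M
  have h1 := DerivBound.helm_iterate (A := A) (N := 0) hf.smooth M (by simpa using h)
  have h2 := norm_fourierOn_le hL c (fun x _ => h1.norm_le x) k
  rw [fourierOn_helm_iterate hL A hf, norm_mul, norm_pow, Complex.norm_real, Real.norm_eq_abs,
    abs_of_pos (weight_pos hA L k), abs_of_nonneg hA] at h2
  rw [← div_eq_mul_inv, le_div_iff₀ hw, mul_comm]
  exact h2

/-! ### Fourier series with rapidly decaying coefficients -/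

/-- Rapidly decaying coefficients. -/
def RapidDecay (L : ℝ) (b : (Fin n → ℤ) → ℂ) : Prop :=
  ∀ M : ℕ, ∃ C : ℝ, ∀ k, ‖b k‖ ≤ C * (weight 1 L k ^ M)⁻¹

lemma abs_freq_le_weight (L : ℝ) (k : Fin n → ℤ) (i : Fin n) :
    |2 * Real.pi / L * (k i : ℝ)| ≤ weight 1 L k := by
  have := Finset.single_le_sum (f := fun i => (2 * Real.pi / L * (k i : ℝ)) ^ 2)
    (fun i _ => sq_nonneg _) (Finset.mem_univ i)
  unfold weight
  rw [one_mul]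
  nlinarith [sq_nonneg (|2 * Real.pi / L * (k i : ℝ)| - 1), sq_abs (2 * Real.pi / L * (k i : ℝ)),
    abs_nonneg (2 * Real.pi / L * (k i : ℝ))]

lemma norm_freq_le_weight (L : ℝ) (k : Fin n → ℤ) (i : Fin n) :
    ‖Complex.I * (2 * Real.pi / L * k i)‖ ≤ weight 1 L k := by
  refine le_trans (le_of_eq ?_) (abs_freq_le_weight L k i)
  rw [norm_mul, Complex.norm_I, one_mul, ← Real.norm_eq_abs, ← Complex.norm_real]
  push_cast
  rfl

lemma RapidDecay.summable_weight {L : ℝ} (hL : 0 < L) {b : (Fin n → ℤ) → ℂ}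
    (hb : RapidDecay L b) (M : ℕ) : Summable fun k => weight 1 L k ^ M * ‖b k‖ := by
  obtain ⟨C, hC⟩ := hb (M + n)
  refine ((summable_inv_weight_pow one_pos hL).mul_left C).of_nonneg_of_le
    (fun k => mul_nonneg (pow_nonneg (weight_pos zero_le_one L k).le M) (norm_nonneg _)) fun k => ?_
  have hw := weight_pos zero_le_one L k
  refine (mul_le_mul_of_nonneg_left (hC k) (pow_nonneg hw.le M)).trans (le_of_eq ?_)
  rw [pow_add]
  field_simp

lemma RapidDecay.summable_norm {L : ℝ} (hL : 0 < L) {b : (Fin n → ℤ) → ℂ}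
    (hb : RapidDecay L b) : Summable fun k => ‖b k‖ := by
  simpa using hb.summable_weight hL 0

lemma RapidDecay.of_norm_le {L : ℝ} {b b' : (Fin n → ℤ) → ℂ} (hb : RapidDecay L b)
    (h : ∀ k, ‖b' k‖ ≤ ‖b k‖) : RapidDecay L b' := fun M =>
  let ⟨C, hC⟩ := hb M
  ⟨C, fun k => (h k).trans (hC k)⟩

lemma RapidDecay.freq_mul {L : ℝ} {b : (Fin n → ℤ) → ℂ} (hb : RapidDecay L b) (i : Fin n) :
    RapidDecay L fun k => Complex.I * (2 * Real.pi / L * k i) * b k := by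
  intro M
  obtain ⟨C, hC⟩ := hb (M + 1)
  refine ⟨C, fun k => ?_⟩
  have hw := weight_pos zero_le_one L k
  rw [norm_mul]
  refine (mul_le_mul (norm_freq_le_weight L k i) (hC k) (norm_nonneg _) hw.le).trans
    (le_of_eq ?_)
  rw [pow_succ]
  field_simp

lemma FaceMatching.rapidDecay {L : ℝ} (hL : 0 < L) {c : Fin n → ℝ} {f : (Fin n → ℝ) → ℂ}
    (hf : FaceMatching L c f) : RapidDecay L (fourierOn L c f) := by
  intro M
  obtain ⟨B, hB⟩ := (isCompact_Icc (a := fun i => c i - L / 2)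
    (b := fun i => c i + L / 2)).exists_bound_of_continuousOn
    (hf.helm_iterate (A := 1) M).smooth.continuous.continuousOn
  refine ⟨B, fun k => ?_⟩
  have hw := pow_pos (weight_pos zero_le_one L k) M
  have h2 := norm_fourierOn_le hL c (fun x hx => hB x
    ⟨fun i => (hx i).1.le, fun i => (hx i).2.le⟩) k
  rw [fourierOn_helm_iterate hL 1 hf, norm_mul, norm_pow, Complex.norm_real, Real.norm_eq_abs,
    abs_of_pos (weight_pos zero_le_one L k)] at h2
  rw [← div_eq_mul_inv, le_div_iff₀ hw, mul_comm]
  exact h2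

lemma summable_mul_expo {L : ℝ} {b : (Fin n → ℤ) → ℂ} (hb : Summable fun k => ‖b k‖)
    (x : Fin n → ℝ) : Summable fun k => b k * expo L k x :=
  Summable.of_norm (by simpa [norm_mul, norm_expo] using hb)

lemma norm_fourierInv_le {L : ℝ} {b : (Fin n → ℤ) → ℂ} (hb : Summable fun k => ‖b k‖)
    (x : Fin n → ℝ) : ‖fourierInv L b x‖ ≤ ∑' k, ‖b k‖ := by
  unfold fourierInv
  refine (norm_tsum_le_tsum_norm (by simpa [norm_expo] using hb)).trans (le_of_eq ?_)
  simp [norm_expo]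

lemma fderiv_eq_sum_pd {v : (Fin n → ℝ) → ℂ} (x y : Fin n → ℝ) :
    fderiv ℝ v x y = ∑ i, (y i : ℂ) * pd i v x := by
  conv_lhs => rw [← Finset.univ_sum_single y]
  rw [map_sum]
  refine Finset.sum_congr rfl fun i _ => ?_
  have : (Pi.single i (y i) : Fin n → ℝ) = y i • Pi.single i 1 := by
    rw [← Pi.single_smul, smul_eq_mul, mul_one]
  rw [this, map_smul, pd, Complex.real_smul]

lemma norm_fderiv_le_sum_pd {v : (Fin n → ℝ) → ℂ} (x : Fin n → ℝ) :
    ‖fderiv ℝ v x‖ ≤ ∑ i, ‖pd i v x‖ := by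
  refine ContinuousLinearMap.opNorm_le_bound _ (Finset.sum_nonneg fun i _ => norm_nonneg _)
    fun y => ?_
  rw [fderiv_eq_sum_pd, Finset.sum_mul]
  refine (norm_sum_le _ _).trans (Finset.sum_le_sum fun i _ => ?_)
  rw [norm_mul, mul_comm, Complex.norm_real]
  exact mul_le_mul_of_nonneg_left (norm_le_pi_norm y i) (norm_nonneg _)

lemma hasFDerivAt_fourierInv {L : ℝ} (hL : 0 < L) {b : (Fin n → ℤ) → ℂ} (hb : RapidDecay L b)
    (x : Fin n → ℝ) :
    HasFDerivAt (fourierInv L b) (∑' k, fderiv ℝ (fun y => b k * expo L k y) x) x ∧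
    Summable fun k => fderiv ℝ (fun y => b k * expo L k y) x := by
  have hpd : ∀ k i, pd i (fun y => b k * expo L k y) =
      fun y => b k * (Complex.I * (2 * Real.pi / L * k i) * expo L k y) := by
    intro k i
    rw [pd_const_mul (contDiff_expo L k), pd_expo]
  have hbound : ∀ k y, ‖fderiv ℝ (fun y => b k * expo L k y) y‖ ≤
      n * (weight 1 L k ^ 1 * ‖b k‖) := by
    intro k y
    refine (norm_fderiv_le_sum_pd y).trans ?_
    have : ∀ i ∈ (Finset.univ : Finset (Fin n)), ‖pd i (fun y => b k * expo L k y) y‖ ≤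
        weight 1 L k ^ 1 * ‖b k‖ := by
      intro i _
      rw [hpd, norm_mul, norm_mul, norm_expo, mul_one, mul_comm, pow_one]
      exact mul_le_mul_of_nonneg_right (norm_freq_le_weight L k i) (norm_nonneg _)
    refine (Finset.sum_le_sum this).trans (le_of_eq ?_)
    simp
  have hsum := (hb.summable_weight hL 1).mul_left (n : ℝ)
  have hd : ∀ k y, HasFDerivAt (fun z => b k * expo L k z)
      (fderiv ℝ (fun z => b k * expo L k z) y) y := fun k y =>
    (contDiff_differentiable (contDiff_const.mul (contDiff_expo L k)) y).hasFDerivAt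
  have h0 : Summable fun k => b k * expo L k 0 := summable_mul_expo (hb.summable_norm hL) 0
  constructor
  · exact hasFDerivAt_tsum (𝕜 := ℝ) hsum hd hbound h0 x
  · exact Summable.of_norm_bounded hsum fun k => hbound k x

/-- A Fourier series with rapidly decaying coefficients may be differentiated termwise. -/
lemma pd_fourierInv {L : ℝ} (hL : 0 < L) {b : (Fin n → ℤ) → ℂ} (hb : RapidDecay L b)
    (i : Fin n) :
    pd i (fourierInv L b) =
      fourierInv L fun k => Complex.I * (2 * Real.pi / L * k i) * b k := by
  funext x
  obtain ⟨h1, h2⟩ := hasFDerivAt_fourierInv hL hb x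
  rw [pd, h1.fderiv, ← ContinuousLinearMap.apply_apply (Pi.single i 1 : Fin n → ℝ),
    ContinuousLinearMap.map_tsum _ h2]
  unfold fourierInv
  refine tsum_congr fun k => ?_
  have : pd i (fun y => b k * expo L k y) x = _ :=
    congrFun (pd_const_mul (contDiff_expo L k) (b k) i) x
  rw [pd, pd_expo] at this
  rw [ContinuousLinearMap.apply_apply, this]
  ring

lemma contDiff_fourierInv {L : ℝ} (hL : 0 < L) {b : (Fin n → ℤ) → ℂ} (hb : RapidDecay L b) :
    ContDiff ℝ ∞ (fourierInv L b) := by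
  rw [contDiff_infty]
  intro m
  induction m generalizing b with
  | zero =>
    rw [Nat.cast_zero, contDiff_zero]
    exact continuous_iff_continuousAt.2 fun x => (hasFDerivAt_fourierInv hL hb x).1.continuousAt
  | succ m ih =>
    rw [Nat.cast_succ, contDiff_succ_iff_fderiv_apply]
    refine ⟨fun x => (hasFDerivAt_fourierInv hL hb x).1.differentiableAt, by simp, fun y => ?_⟩
    simp only [fderiv_eq_sum_pd]
    refine ContDiff.sum fun i _ => contDiff_const.mul ?_
    rw [pd_fourierInv hL hb]
    exact ih (hb.freq_mul i)

lemma isTestFunction_fourierInv {L : ℝ} (hL : 0 < L) {b : (Fin n → ℤ) → ℂ}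
    (hb : RapidDecay L b) : IsTestFunction L (fourierInv L b) := by
  refine ⟨contDiff_fourierInv hL hb, fun x m => ?_⟩
  unfold fourierInv
  simp only [expo_periodic hL.ne']

lemma derivBound_fourierInv {L : ℝ} (hL : 0 < L) {b : (Fin n → ℤ) → ℂ} (hb : RapidDecay L b)
    (N : ℕ) : DerivBound N (∑' k, weight 1 L k ^ N * ‖b k‖) (fourierInv L b) := by
  intro l hl x
  have h1 : ‖pdl l (fourierInv L b) x‖ ≤ ∑' k, weight 1 L k ^ l.length * ‖b k‖ := by
    clear hl
    induction l using List.reverseRecOn generalizing b with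
    | nil => simpa [pdl] using norm_fourierInv_le (hb.summable_norm hL) x
    | append_singleton l i ih =>
      rw [pdl_append_singleton, pd_fourierInv hL hb]
      refine (ih (hb.freq_mul i)).trans ?_
      refine Summable.tsum_le_tsum (fun k => ?_) ((hb.freq_mul i).summable_weight hL _)
        (hb.summable_weight hL _)
      rw [List.length_append, List.length_singleton, norm_mul, pow_succ, mul_assoc]
      exact mul_le_mul_of_nonneg_left (mul_le_mul_of_nonneg_right (norm_freq_le_weight L k i)
        (norm_nonneg _)) (pow_nonneg (weight_pos zero_le_one L k).le _)
  refine h1.trans (Summable.tsum_le_tsum (fun k => ?_) (hb.summable_weight hL _)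
        (hb.summable_weight hL _))
  exact mul_le_mul_of_nonneg_right (pow_le_pow_right₀ (one_le_weight zero_le_one L k) hl)
    (norm_nonneg _)

lemma fourierInv_add {L : ℝ} {b b' : (Fin n → ℤ) → ℂ} (hb : Summable fun k => ‖b k‖)
    (hb' : Summable fun k => ‖b' k‖) (x : Fin n → ℝ) :
    fourierInv L (fun k => b k + b' k) x = fourierInv L b x + fourierInv L b' x := by
  unfold fourierInv
  rw [← (summable_mul_expo hb x).tsum_add (summable_mul_expo hb' x)]
  simp only [add_mul]

lemma fourierInv_const_mul {L : ℝ} (b : (Fin n → ℤ) → ℂ) (a : ℂ) (x : Fin n → ℝ) :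
    fourierInv L (fun k => a * b k) x = a * fourierInv L b x := by
  unfold fourierInv
  simp only [mul_assoc]
  rw [tsum_mul_left]

/-! ### Fourier multipliers -/

/-- The Fourier multiplier with symbol `μ` on the cube with centre `c` and side length `L`. -/
def multiplier (L : ℝ) (c : Fin n → ℝ) (μ : (Fin n → ℤ) → ℂ) (u : (Fin n → ℝ) → ℂ) :
    (Fin n → ℝ) → ℂ :=
  fourierInv L fun k => μ k * fourierOn L c u k

section Multiplier

variable {L : ℝ} (hL : 0 < L) {c : Fin n → ℝ} {μ : (Fin n → ℤ) → ℂ} (hμ : ∀ k, ‖μ k‖ ≤ 1)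

include hL hμ

lemma rapidDecay_multiplier {f : (Fin n → ℝ) → ℂ} (hf : FaceMatching L c f) :
    RapidDecay L fun k => μ k * fourierOn L c f k :=
  (hf.rapidDecay hL).of_norm_le fun k => by
    rw [norm_mul]; exact mul_le_of_le_one_left (norm_nonneg _) (hμ k)

lemma isTestFunction_multiplier {f : (Fin n → ℝ) → ℂ} (hf : FaceMatching L c f) :
    IsTestFunction L (multiplier L c μ f) :=
  isTestFunction_fourierInv hL (rapidDecay_multiplier hL hμ hf)

lemma pd_multiplier {f : (Fin n → ℝ) → ℂ} (hf : FaceMatching L c f) (i : Fin n) :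
    pd i (multiplier L c μ f) = multiplier L c μ (pd i f) := by
  unfold multiplier
  rw [pd_fourierInv hL (rapidDecay_multiplier hL hμ hf)]
  congr 1
  funext k
  rw [fourierOn_pd hL hf]
  ring

lemma pdl_multiplier {f : (Fin n → ℝ) → ℂ} (hf : FaceMatching L c f) (l : List (Fin n)) :
    FaceMatching L c (pdl l f) ∧ pdl l (multiplier L c μ f) = multiplier L c μ (pdl l f) := by
  induction l with
  | nil => exact ⟨hf, rfl⟩
  | cons i l ih =>
    refine ⟨ih.1.pd i, ?_⟩
    change pd i (pdl l _) = _
    rw [ih.2, pd_multiplier hL hμ ih.1]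
    rfl

lemma multiplier_add {f h : (Fin n → ℝ) → ℂ} (hf : FaceMatching L c f)
    (hh : FaceMatching L c h) (x : Fin n → ℝ) :
    multiplier L c μ (fun y => f y + h y) x = multiplier L c μ f x + multiplier L c μ h x := by
  unfold multiplier
  rw [← fourierInv_add ((rapidDecay_multiplier hL hμ hf).summable_norm hL)
    ((rapidDecay_multiplier hL hμ hh).summable_norm hL)]
  congr 1
  funext k
  rw [fourierOn_add L c hf.smooth.continuous hh.smooth.continuous, mul_add]

omit hL hμ in
lemma multiplier_const_mul (f : (Fin n → ℝ) → ℂ) (a : ℂ) (x : Fin n → ℝ) :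
    multiplier L c μ (fun y => a * f y) x = a * multiplier L c μ f x := by
  unfold multiplier
  rw [← fourierInv_const_mul]
  congr 1
  funext k
  rw [fourierOn_const_mul]
  ring

/-- A bounded Fourier multiplier loses at most `2n` derivatives in the sup norm. -/
lemma derivBound_multiplier :
    ∃ C, 0 ≤ C ∧ ∀ (f : (Fin n → ℝ) → ℂ), FaceMatching L c f → ∀ (N : ℕ) (B : ℝ),
      DerivBound (N + 2 * n) B f → DerivBound N (C * B) (multiplier L c μ f) := by
  have hs := summable_inv_weight_pow (n := n) one_pos hL
  have hw : ∀ k : Fin n → ℤ, 0 ≤ (weight 1 L k ^ n)⁻¹ := fun k =>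
    inv_nonneg.2 (pow_nonneg (weight_pos zero_le_one L k).le n)
  refine ⟨(1 + n) ^ n * ∑' k : Fin n → ℤ, (weight 1 L k ^ n)⁻¹,
    mul_nonneg (by positivity) (tsum_nonneg hw), fun f hf N B hB l hl x => ?_⟩
  obtain ⟨h1, h2⟩ := pdl_multiplier hL hμ hf l
  rw [h2]
  refine (norm_fourierInv_le ((rapidDecay_multiplier hL hμ h1).summable_norm hL) x).trans ?_
  have h3 : DerivBound (2 * n) B (pdl l f) := by
    intro l' hl' x
    have : pdl l' (pdl l f) = pdl (l' ++ l) f := by simp [pdl, List.foldr_append]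
    rw [this]
    exact hB _ (by rw [List.length_append]; omega) x
  have h4 : ∀ k, ‖μ k * fourierOn L c (pdl l f) k‖ ≤ (1 + n) ^ n * B * (weight 1 L k ^ n)⁻¹ := by
    intro k
    rw [norm_mul]
    refine (mul_le_of_le_one_left (norm_nonneg _) (hμ k)).trans ?_
    simpa using norm_fourierOn_le_of_derivBound zero_le_one hL h1 n h3 k
  refine (Summable.tsum_le_tsum h4 ((rapidDecay_multiplier hL hμ h1).summable_norm hL)
    (hs.mul_left _)).trans (le_of_eq ?_)
  rw [tsum_mul_left]
  ring

end Multiplier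

/-! ### Quantization -/

/-- A continuous linear operator on `C^∞` of the torus is the quantization of its symbol, because
Fourier series of smooth functions converge with all derivatives. -/
lemma hasSum_symbol {L : ℝ} (hL : 0 < L) {A : ((Fin n → ℝ) → ℂ) → ((Fin n → ℝ) → ℂ)}
    (hadd : ∀ u v, IsTestFunction L u → IsTestFunction L v → A (u + v) = A u + A v)
    (hsmul : ∀ (c : ℂ) (u), IsTestFunction L u → A (c • u) = c • A u)
    {N : ℕ} {C : ℝ} (hcont : ∀ u, IsTestFunction L u → ∀ B : ℝ, DerivBound N B u →
      ∀ x, ‖A u x‖ ≤ C * B)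
    {u : (Fin n → ℝ) → ℂ} (hu : IsTestFunction L u) (x : Fin n → ℝ) :
    HasSum (fun ξ => symbol L A x ξ * fourierOn L 0 u ξ * expo L ξ x) (A u x) := by
  classical
  set b := fourierOn L 0 u with hb
  have hbr : RapidDecay L b := (hu.faceMatching 0).rapidDecay hL
  have hinv : ∀ y, HasSum (fun k => b k * expo L k y) (u y) := fun y =>
    hasSum_fourierOn_of_periodic hL 0 hu.smooth.continuous hu.periodic
      (hbr.summable_norm hL).of_norm y
  have hterm : ∀ ξ, symbol L A x ξ * b ξ * expo L ξ x = b ξ * A (expo L ξ) x := by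
    intro ξ
    unfold symbol
    linear_combination b ξ * A (expo L ξ) x * expo_neg_mul L ξ x
  simp only [hterm]
  have he : ∀ s : Finset (Fin n → ℤ), IsTestFunction L (fun y => ∑ k ∈ s, b k * expo L k y) :=
    fun s => IsTestFunction.sum fun k _ => (isTestFunction_expo hL.ne' k).const_mul (b k)
  have hA : ∀ s : Finset (Fin n → ℤ),
      A (fun y => ∑ k ∈ s, b k * expo L k y) = fun y => ∑ k ∈ s, b k * A (expo L k) y := by
    intro s
    induction s using Finset.induction_on with
    | empty =>
      have h0 := hsmul 0 (expo L 0) (isTestFunction_expo hL.ne' 0)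
      rw [zero_smul, zero_smul] at h0
      simpa [Pi.zero_def] using h0
    | insert a s ha ih =>
      have e1 : (fun y => ∑ k ∈ insert a s, b k * expo L k y) =
          b a • expo L a + fun y => ∑ k ∈ s, b k * expo L k y := by
        funext y; simp [Finset.sum_insert ha]
      rw [e1, hadd (b a • expo L a) _ ((isTestFunction_expo hL.ne' a).const_mul (b a)) (he s),
        hsmul _ _ (isTestFunction_expo hL.ne' a), ih]
      funext y; simp [Finset.sum_insert ha]
  -- the remainder of the Fourier series is small with all derivatives up to order `N`
  have hrem : ∀ s : Finset (Fin n → ℤ),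
      ‖A u x - ∑ k ∈ s, b k * A (expo L k) x‖ ≤
        C * ∑' k, (weight 1 L k ^ N * ‖b k‖ - if k ∈ s then weight 1 L k ^ N * ‖b k‖ else 0) := by
    intro s
    let bs : (Fin n → ℤ) → ℂ := fun k => if k ∈ s then 0 else b k
    have hbs : RapidDecay L bs := hbr.of_norm_le fun k => by
      by_cases h : k ∈ s <;> simp [bs, h]
    have hdec : u = (fun y => ∑ k ∈ s, b k * expo L k y) + fourierInv L bs := by
      funext y
      have h1 : HasSum (fun k => if k ∈ s then b k * expo L k y else 0)
          (∑ k ∈ s, b k * expo L k y) := by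
        have := hasSum_sum_of_ne_finset_zero (L := .unconditional _) (s := s)
          (f := fun k => if k ∈ s then b k * expo L k y else 0) (fun k hk => if_neg hk)
        rwa [Finset.sum_congr rfl fun k hk => if_pos hk] at this
      have h2 := (hinv y).sub h1
      have h3 : HasSum (fun k => bs k * expo L k y) (u y - ∑ k ∈ s, b k * expo L k y) := by
        refine HasSum.congr_fun h2 fun k => ?_
        by_cases h : k ∈ s <;> simp [bs, h]
      simp only [Pi.add_apply, fourierInv, h3.tsum_eq]
      ring
    have htest := isTestFunction_fourierInv hL hbs
    have h4 := hcont _ htest _ (derivBound_fourierInv hL hbs N) x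
    have h5 : A u x - ∑ k ∈ s, b k * A (expo L k) x = A (fourierInv L bs) x := by
      conv_lhs => rw [hdec]
      rw [hadd _ _ (he s) htest, hA]
      simp
    rw [h5]
    refine h4.trans (le_of_eq ?_)
    congr 2
    funext k
    by_cases h : k ∈ s <;> simp [bs, h]
  have hsum := hbr.summable_weight hL N
  have hlim : Tendsto (fun s : Finset (Fin n → ℤ) => C * ∑' k, (weight 1 L k ^ N * ‖b k‖ -
      if k ∈ s then weight 1 L k ^ N * ‖b k‖ else 0)) atTop (𝓝 0) := by
    have h1 : ∀ s : Finset (Fin n → ℤ), ∑' k, (weight 1 L k ^ N * ‖b k‖ -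
        if k ∈ s then weight 1 L k ^ N * ‖b k‖ else 0) =
        ∑' k, weight 1 L k ^ N * ‖b k‖ - ∑ k ∈ s, weight 1 L k ^ N * ‖b k‖ := by
      intro s
      have h2 : HasSum (fun k => if k ∈ s then weight 1 L k ^ N * ‖b k‖ else 0)
          (∑ k ∈ s, weight 1 L k ^ N * ‖b k‖) := by
        have := hasSum_sum_of_ne_finset_zero (L := .unconditional _) (s := s)
          (f := fun k => if k ∈ s then weight 1 L k ^ N * ‖b k‖ else 0) (fun k hk => if_neg hk)
        rwa [Finset.sum_congr rfl fun k hk => if_pos hk] at this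
      exact (hsum.hasSum.sub h2).tsum_eq
    simp only [h1]
    have h3 := ((tendsto_const_nhds (x := ∑' k, weight 1 L k ^ N * ‖b k‖)).sub
      hsum.hasSum).const_mul C
    simpa using h3
  change Tendsto _ _ _
  rw [tendsto_iff_norm_sub_tendsto_zero]
  refine squeeze_zero (fun s => norm_nonneg _) (fun s => ?_) hlim
  rw [norm_sub_rev]
  exact hrem s

/-! ### Discrete symbol classes -/

lemma bracket_sq (ξ : Fin n → ℤ) : bracket ξ ^ 2 = 1 + ∑ i, (ξ i : ℝ) ^ 2 := by
  have h : 0 ≤ ∑ i, (ξ i : ℝ) ^ 2 := Finset.sum_nonneg fun i _ => sq_nonneg _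
  unfold bracket len
  rw [Real.sq_sqrt (by positivity), Real.sq_sqrt h]

lemma one_le_bracket (ξ : Fin n → ℤ) : 1 ≤ bracket ξ := by
  unfold bracket
  rw [Real.one_le_sqrt]
  nlinarith [sq_nonneg (len ξ)]

lemma bracket_pos (ξ : Fin n → ℤ) : 0 < bracket ξ := one_pos.trans_le (one_le_bracket ξ)

lemma abs_le_bracket (ξ : Fin n → ℤ) (i : Fin n) : |(ξ i : ℝ)| ≤ bracket ξ := by
  refine abs_le_of_sq_le_sq ?_ (bracket_pos ξ).le
  rw [bracket_sq]
  have := Finset.single_le_sum (f := fun i => (ξ i : ℝ) ^ 2) (fun i _ => sq_nonneg _)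
    (Finset.mem_univ i)
  linarith

lemma sum_sq_add_single (ξ : Fin n → ℤ) (i : Fin n) :
    ∑ j, (((ξ + Pi.single i 1 : Fin n → ℤ) j : ℤ) : ℝ) ^ 2 = ∑ j, (ξ j : ℝ) ^ 2 + (2 * ξ i + 1) := by
  have h : ∀ j, (((ξ + Pi.single i 1 : Fin n → ℤ) j : ℤ) : ℝ) ^ 2 =
      (ξ j : ℝ) ^ 2 + if j = i then (2 * ξ i + 1 : ℝ) else 0 := by
    intro j
    by_cases hj : j = i
    · subst hj; simp; ring
    · simp [hj]
  simp only [h, Finset.sum_add_distrib]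
  simp

lemma bracket_add_single_le (ξ : Fin n → ℤ) (i : Fin n) :
    bracket (ξ + Pi.single i 1) ≤ 2 * bracket ξ := by
  have h0 := bracket_pos ξ
  have h1 := bracket_pos (ξ + Pi.single i 1)
  refine (pow_le_pow_iff_left₀ h1.le (by positivity) two_ne_zero).1 ?_
  rw [bracket_sq, sum_sq_add_single, mul_pow, bracket_sq]
  have := Finset.single_le_sum (f := fun i => (ξ i : ℝ) ^ 2) (fun i _ => sq_nonneg _)
    (Finset.mem_univ i)
  nlinarith [sq_nonneg ((ξ i : ℝ) - 1)]

lemma bracket_le_add_single (ξ : Fin n → ℤ) (i : Fin n) :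
    bracket ξ ≤ 2 * bracket (ξ + Pi.single i 1) := by
  have h0 := bracket_pos ξ
  have h1 := bracket_pos (ξ + Pi.single i 1)
  refine (pow_le_pow_iff_left₀ h0.le (by positivity) two_ne_zero).1 ?_
  rw [mul_pow, bracket_sq, bracket_sq, sum_sq_add_single]
  have := Finset.single_le_sum (f := fun i => (ξ i : ℝ) ^ 2) (fun i _ => sq_nonneg _)
    (Finset.mem_univ i)
  nlinarith [sq_nonneg (3 * (ξ i : ℝ) + 4)]

lemma bracket_add_single_rpow_le (m : ℝ) (ξ : Fin n → ℤ) (i : Fin n) :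
    bracket (ξ + Pi.single i 1) ^ m ≤ 2 ^ |m| * bracket ξ ^ m := by
  have h0 := bracket_pos ξ
  have h1 := bracket_pos (ξ + Pi.single i 1)
  rcases le_total 0 m with hm | hm
  · rw [abs_of_nonneg hm, ← Real.mul_rpow two_pos.le h0.le]
    exact Real.rpow_le_rpow h1.le (bracket_add_single_le ξ i) hm
  · rw [abs_of_nonpos hm, Real.rpow_neg two_pos.le, ← Real.inv_rpow two_pos.le,
      ← Real.mul_rpow (by positivity) h0.le]
    refine Real.rpow_le_rpow_of_nonpos (by positivity) ?_ hm
    have := bracket_le_add_single ξ i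
    linarith

/-- The forward difference in the direction `i`. -/
def dif (i : Fin n) (f : (Fin n → ℤ) → ℂ) : (Fin n → ℤ) → ℂ := fwdDiff (Pi.single i 1) f

lemma dif_apply (i : Fin n) (f : (Fin n → ℤ) → ℂ) (ξ : Fin n → ℤ) :
    dif i f ξ = f (ξ + Pi.single i 1) - f ξ := rfl

/-- Families of functions on `ℤⁿ` that satisfy the estimates of a symbol of order `m`, uniformly in
the parameter, for all iterated differences of length at most `l`. -/
def IsSym {T : Type*} : ℕ → ℝ → (T → (Fin n → ℤ) → ℂ) → Prop
  | 0, m, f => ∃ C : ℝ, ∀ t ξ, ‖f t ξ‖ ≤ C * bracket ξ ^ m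
  | l + 1, m, f => (∃ C : ℝ, ∀ t ξ, ‖f t ξ‖ ≤ C * bracket ξ ^ m) ∧
      ∀ i, IsSym l (m - 1) fun t => dif i (f t)

namespace IsSym

variable {T : Type*} {f h : T → (Fin n → ℤ) → ℂ} {l : ℕ} {m m' : ℝ}

lemma bound (hf : IsSym l m f) : ∃ C : ℝ, 0 ≤ C ∧ ∀ t ξ, ‖f t ξ‖ ≤ C * bracket ξ ^ m := by
  have : ∃ C : ℝ, ∀ t ξ, ‖f t ξ‖ ≤ C * bracket ξ ^ m := by
    cases l with
    | zero => exact hf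
    | succ l => exact hf.1
  obtain ⟨C, hC⟩ := this
  exact ⟨max C 0, le_max_right _ _, fun t ξ => (hC t ξ).trans
    (mul_le_mul_of_nonneg_right (le_max_left _ _) (Real.rpow_nonneg (bracket_pos ξ).le m))⟩

lemma mono_order (hf : IsSym l m f) (hm : m ≤ m') : IsSym l m' f := by
  have key : ∃ C : ℝ, ∀ t ξ, ‖f t ξ‖ ≤ C * bracket ξ ^ m' := by
    obtain ⟨C, hC0, hC⟩ := hf.bound
    exact ⟨C, fun t ξ => (hC t ξ).trans (mul_le_mul_of_nonneg_left
      (Real.rpow_le_rpow_of_exponent_le (one_le_bracket ξ) hm) hC0)⟩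
  induction l generalizing f m m' with
  | zero => exact key
  | succ l ih =>
    refine ⟨key, fun i => ih (hf.2 i) (by linarith) ?_⟩
    obtain ⟨C, hC0, hC⟩ := (hf.2 i).bound
    exact ⟨C, fun t ξ => (hC t ξ).trans (mul_le_mul_of_nonneg_left
      (Real.rpow_le_rpow_of_exponent_le (one_le_bracket ξ) (by linarith)) hC0)⟩

lemma of_succ (hf : IsSym (l + 1) m f) : IsSym l m f := by
  induction l generalizing f m with
  | zero => exact hf.1
  | succ l ih => exact ⟨hf.1, fun i => ih (hf.2 i)⟩

lemma mono_length {l' : ℕ} (hf : IsSym l m f) (hl : l' ≤ l) : IsSym l' m f := by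
  induction hl with
  | refl => exact hf
  | step _ ih => exact ih hf.of_succ

lemma congr (hf : IsSym l m f) (e : ∀ t ξ, f t ξ = h t ξ) : IsSym l m h := by
  have : f = h := funext fun t => funext fun ξ => e t ξ
  rwa [← this]

lemma add (hf : IsSym l m f) (hh : IsSym l m h) : IsSym l m fun t ξ => f t ξ + h t ξ := by
  have key : ∃ C : ℝ, ∀ t ξ, ‖f t ξ + h t ξ‖ ≤ C * bracket ξ ^ m := by
    obtain ⟨C, _, hC⟩ := hf.bound
    obtain ⟨D, _, hD⟩ := hh.bound
    exact ⟨C + D, fun t ξ => (norm_add_le _ _).trans (by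
      rw [add_mul]; exact add_le_add (hC t ξ) (hD t ξ))⟩
  induction l generalizing f h m with
  | zero => exact key
  | succ l ih =>
    refine ⟨key, fun i => ?_⟩
    have h1 := hf.2 i
    have h2 := hh.2 i
    refine (ih h1 h2 ?_).congr fun t ξ => ?_
    · obtain ⟨C, _, hC⟩ := h1.bound
      obtain ⟨D, _, hD⟩ := h2.bound
      exact ⟨C + D, fun t ξ => (norm_add_le _ _).trans (by
        rw [add_mul]; exact add_le_add (hC t ξ) (hD t ξ))⟩
    · simp only [dif_apply]; ring

lemma zero : IsSym l m fun (_ : T) (_ : Fin n → ℤ) => (0 : ℂ) := by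
  induction l generalizing m with
  | zero => exact ⟨0, fun t ξ => by simp⟩
  | succ l ih =>
    exact ⟨⟨0, fun t ξ => by simp⟩, fun i => ih.congr fun t ξ => by simp [dif_apply]⟩

lemma sum {ι : Type*} {s : Finset ι} {f : ι → T → (Fin n → ℤ) → ℂ}
    (hf : ∀ j ∈ s, IsSym l m (f j)) : IsSym l m fun t ξ => ∑ j ∈ s, f j t ξ := by
  classical
  induction s using Finset.induction_on with
  | empty => simpa using zero
  | insert a s ha ih =>
    simp only [Finset.sum_insert ha]
    exact (hf a (Finset.mem_insert_self a s)).add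
      (ih fun j hj => hf j (Finset.mem_insert_of_mem hj))

/-- Functions that do not depend on `ξ` and are bounded in the parameter have order `0`. -/
lemma of_const {c : T → ℂ} (hc : ∃ C, ∀ t, ‖c t‖ ≤ C) :
    IsSym l 0 fun t (_ : Fin n → ℤ) => c t := by
  obtain ⟨C, hC⟩ := hc
  have key : ∃ C : ℝ, ∀ t (ξ : Fin n → ℤ), ‖c t‖ ≤ C * bracket ξ ^ (0 : ℝ) :=
    ⟨C, fun t ξ => by simpa using hC t⟩
  cases l with
  | zero => exact key
  | succ l => exact ⟨key, fun i => zero.congr fun t ξ => by simp [dif_apply]⟩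

lemma coord (i : Fin n) : IsSym l 1 fun (_ : T) ξ => ((ξ i : ℤ) : ℂ) := by
  have key : ∃ C : ℝ, ∀ (t : T) (ξ : Fin n → ℤ), ‖((ξ i : ℤ) : ℂ)‖ ≤ C * bracket ξ ^ (1 : ℝ) :=
    ⟨1, fun t ξ => by
      rw [Real.rpow_one, one_mul, Complex.norm_intCast]
      exact abs_le_bracket ξ i⟩
  cases l with
  | zero => exact key
  | succ l =>
    refine ⟨key, fun j => ?_⟩
    rw [sub_self]
    refine (of_const (c := fun _ => ((Pi.single j (1 : ℤ) : Fin n → ℤ) i : ℂ))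
      ⟨_, fun _ => le_rfl⟩).congr fun t ξ => ?_
    simp [dif_apply]

lemma shift (hf : IsSym l m f) (i : Fin n) : IsSym l m fun t ξ => f t (ξ + Pi.single i 1) := by
  have key : ∀ (m : ℝ) (f : T → (Fin n → ℤ) → ℂ), (∃ C : ℝ, 0 ≤ C ∧ ∀ t ξ, ‖f t ξ‖ ≤ C * bracket ξ ^ m) →
      ∃ C : ℝ, ∀ t ξ, ‖f t (ξ + Pi.single i 1)‖ ≤ C * bracket ξ ^ m := by
    rintro m f ⟨C, hC0, hC⟩
    refine ⟨C * 2 ^ |m|, fun t ξ => (hC t _).trans ?_⟩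
    rw [mul_assoc]
    exact mul_le_mul_of_nonneg_left (bracket_add_single_rpow_le m ξ i) hC0
  induction l generalizing f m with
  | zero => exact key m f hf.bound
  | succ l ih =>
    refine ⟨key m f hf.bound, fun j => (ih (hf.2 j)).congr fun t ξ => ?_⟩
    simp only [dif_apply]
    rw [add_right_comm]

/-- A family that is `O(⟨ξ⟩^(m-l))` trivially has the first `l` symbol estimates of order `m`. -/
lemma of_bound (hf : ∃ C : ℝ, ∀ t ξ, ‖f t ξ‖ ≤ C * bracket ξ ^ (m - l)) : IsSym l m f := by
  have h0 : IsSym 0 (m - l) f := hf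
  clear hf
  induction l generalizing f m with
  | zero => simpa using h0
  | succ l ih =>
    obtain ⟨C, hC0, hC⟩ := h0.bound
    refine ⟨⟨C, fun t ξ => (hC t ξ).trans (mul_le_mul_of_nonneg_left
      (Real.rpow_le_rpow_of_exponent_le (one_le_bracket ξ) ?_) hC0)⟩, fun i => ih ?_⟩
    · have : (0 : ℝ) ≤ ((l + 1 : ℕ) : ℝ) := Nat.cast_nonneg _
      linarith
    · have e : m - 1 - (l : ℝ) = m - ((l + 1 : ℕ) : ℝ) := by push_cast; ring
      rw [e]
      have h1 : IsSym 0 (m - ((l + 1 : ℕ) : ℝ)) fun t ξ => -f t ξ :=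
        ⟨C, fun t ξ => by rw [norm_neg]; exact hC t ξ⟩
      refine ((h0.shift i).add h1).congr fun t ξ => ?_
      rw [dif_apply, sub_eq_add_neg]

lemma mul (hf : IsSym l m f) (hh : IsSym l m' h) :
    IsSym l (m + m') fun t ξ => f t ξ * h t ξ := by
  have key : ∀ (m m' : ℝ) (f h : T → (Fin n → ℤ) → ℂ), (∃ C : ℝ, 0 ≤ C ∧ ∀ t ξ, ‖f t ξ‖ ≤ C * bracket ξ ^ m) →
      (∃ C : ℝ, 0 ≤ C ∧ ∀ t ξ, ‖h t ξ‖ ≤ C * bracket ξ ^ m') →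
      ∃ C : ℝ, ∀ t ξ, ‖f t ξ * h t ξ‖ ≤ C * bracket ξ ^ (m + m') := by
    rintro m m' f h ⟨C, hC0, hC⟩ ⟨D, hD0, hD⟩
    refine ⟨C * D, fun t ξ => ?_⟩
    rw [norm_mul, Real.rpow_add (bracket_pos ξ)]
    refine (mul_le_mul (hC t ξ) (hD t ξ) (norm_nonneg _)
      (mul_nonneg hC0 (Real.rpow_nonneg (bracket_pos ξ).le _))).trans (le_of_eq ?_)
    ring
  induction l generalizing f h m m' with
  | zero => exact key m m' f h hf.bound hh.bound
  | succ l ih =>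
    refine ⟨key m m' f h hf.bound hh.bound, fun i => ?_⟩
    have h1 := ih (hf.2 i) ((hh.shift i).of_succ)
    have h2 := ih hf.of_succ (hh.2 i)
    have e1 : m - 1 + m' = m + m' - 1 := by ring
    have e2 : m + (m' - 1) = m + m' - 1 := by ring
    rw [e1] at h1
    rw [e2] at h2
    refine (h1.add h2).congr fun t ξ => ?_
    simp only [dif_apply]
    ring

lemma const_mul (hf : IsSym l m f) (c : ℂ) : IsSym l m fun t ξ => c * f t ξ := by
  have := (of_const (T := T) (n := n) (l := l) (c := fun _ => c) ⟨_, fun _ => le_rfl⟩).mul hf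
  rwa [zero_add] at this

lemma pow (hf : IsSym l m f) (p : ℕ) : IsSym l (p * m) fun t ξ => f t ξ ^ p := by
  induction p with
  | zero => simpa using of_const (T := T) (n := n) (l := l) (c := fun _ => 1) ⟨_, fun _ => le_rfl⟩
  | succ p ih =>
    have e : ((p + 1 : ℕ) : ℝ) * m = p * m + m := by push_cast; ring
    rw [e]
    exact (ih.mul hf).congr fun t ξ => (pow_succ _ _).symm

/-- The estimates pass to families each of whose members is zero or a member of `h`. -/
lemma of_select {T' : Type*} {f : T' → (Fin n → ℤ) → ℂ} (hh : IsSym l m h)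
    (hf : ∀ t, (∀ ξ, f t ξ = 0) ∨ ∃ t', ∀ ξ, f t ξ = h t' ξ) : IsSym l m f := by
  have key : ∀ (m : ℝ) (f : T' → (Fin n → ℤ) → ℂ) (h : T → (Fin n → ℤ) → ℂ),
      (∃ C : ℝ, 0 ≤ C ∧ ∀ t ξ, ‖h t ξ‖ ≤ C * bracket ξ ^ m) →
      (∀ t, (∀ ξ, f t ξ = 0) ∨ ∃ t', ∀ ξ, f t ξ = h t' ξ) →
      ∃ C : ℝ, ∀ t ξ, ‖f t ξ‖ ≤ C * bracket ξ ^ m := by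
    rintro m f h ⟨C, hC0, hC⟩ hf
    refine ⟨C, fun t ξ => ?_⟩
    rcases hf t with h1 | ⟨t', h1⟩
    · rw [h1, norm_zero]
      exact mul_nonneg hC0 (Real.rpow_nonneg (bracket_pos ξ).le _)
    · rw [h1]; exact hC t' ξ
  induction l generalizing f h m with
  | zero => exact key m f h hh.bound hf
  | succ l ih =>
    refine ⟨key m f h hh.bound hf, fun i => ih (hh.2 i) fun t => ?_⟩
    rcases hf t with h1 | ⟨t', h1⟩
    · exact Or.inl fun ξ => by rw [dif_apply, h1, h1, sub_zero]
    · exact Or.inr ⟨t', fun ξ => by rw [dif_apply, dif_apply, h1, h1]⟩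

lemma mdiff_bound (α : Fin n → ℕ) (hf : IsSym (∑ i, α i) m f) :
    ∃ C : ℝ, ∀ t ξ, ‖mdiff α (f t) ξ‖ ≤ C * bracket ξ ^ (m - ((∑ i, α i : ℕ) : ℝ)) := by
  have key : ∀ (s : List (Fin n)) (m : ℝ) (f : T → (Fin n → ℤ) → ℂ), IsSym s.length m f →
      ∃ C : ℝ, ∀ t ξ, ‖s.foldr dif (f t) ξ‖ ≤ C * bracket ξ ^ (m - (s.length : ℝ)) := by
    intro s
    induction s using List.reverseRecOn with
    | nil => intro m f hf; simpa [IsSym] using hf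
    | append_singleton s i ih =>
      intro m f hf
      rw [List.length_append, List.length_singleton] at hf ⊢
      have e : m - ((s.length + 1 : ℕ) : ℝ) = m - 1 - (s.length : ℝ) := by push_cast; ring
      rw [e]
      obtain ⟨C, hC⟩ := ih (m - 1) _ (hf.2 i)
      exact ⟨C, fun t ξ => by simpa [List.foldr_append] using hC t ξ⟩
  have h := key (multiList α) m f (by rwa [length_multiList])
  rw [length_multiList] at h
  obtain ⟨C, hC⟩ := h
  refine ⟨C, fun t ξ => ?_⟩
  have e : mdiff α (f t) = (multiList α).foldr dif (f t) :=
    foldr_iterate_eq_foldr_multiList dif α (f t)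
  rw [e]
  exact hC t ξ

end IsSym

/-! ### Taylor expansion of negative powers -/

/-- Taylor expansion of `y ↦ y⁻ˢ` at `x`, with a remainder estimate that is uniform in
`x, y > 0`. -/
lemma exists_taylor_rpow (N : ℕ) {s : ℝ} (hs : 0 < s) :
    ∃ (c : ℕ → ℝ) (C : ℝ), c 0 = 1 ∧ 0 ≤ C ∧ ∀ x y : ℝ, 0 < x → 0 < y →
      |y ^ (-s) - ∑ p ∈ Finset.range N, c p * x ^ (-s - p) * (y - x) ^ p| ≤
        C * |y - x| ^ N * (x ^ (-s - N) + y ^ (-s - N)) := by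
  induction N generalizing s with
  | zero =>
    refine ⟨fun _ => 1, 1, rfl, zero_le_one, fun x y hx hy => ?_⟩
    have h1 := Real.rpow_nonneg hx.le (-s)
    have h2 := Real.rpow_nonneg hy.le (-s)
    simp only [Finset.range_zero, Finset.sum_empty, sub_zero, pow_zero, Nat.cast_zero, mul_one,
      one_mul]
    rw [abs_of_nonneg h2]
    linarith
  | succ N ih =>
    obtain ⟨c, C, _, hC0, hC⟩ := ih (s := s + 1) (by linarith)
    refine ⟨fun p => if p = 0 then 1 else -s * c (p - 1) / p, s * (C * 2), by simp,
      by positivity, fun x y hx hy => ?_⟩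
    rw [Finset.sum_range_succ']
    have e1 : ∀ p ∈ Finset.range N, (if p + 1 = 0 then (1 : ℝ) else -s * c (p + 1 - 1) / ((p + 1 : ℕ) : ℝ)) *
        x ^ (-s - ((p + 1 : ℕ) : ℝ)) * (y - x) ^ (p + 1) =
        -s * (c p * x ^ (-(s + 1) - p)) * ((y - x) ^ (p + 1) / (p + 1)) := by
      intro p _
      have : -s - ((p + 1 : ℕ) : ℝ) = -(s + 1) - p := by push_cast; ring
      rw [this]
      simp
      ring
    rw [Finset.sum_congr rfl e1]
    -- `F` is the remainder in `z`; its derivative is `-s` times the remainder for `s + 1` with one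
    -- term less
    let F : ℝ → ℝ := fun z => z ^ (-s) - ((∑ p ∈ Finset.range N,
      -s * (c p * x ^ (-(s + 1) - p)) * ((z - x) ^ (p + 1) / (p + 1))) + x ^ (-s))
    have hpos : ∀ z ∈ Set.uIcc x y, 0 < z := fun z hz =>
      (lt_min hx hy).trans_le hz.1
    have hderiv : ∀ z ∈ Set.uIcc x y, HasDerivWithinAt F (-s * (z ^ (-(s + 1)) -
        ∑ p ∈ Finset.range N, c p * x ^ (-(s + 1) - p) * (z - x) ^ p)) (Set.uIcc x y) z := by
      intro z hz
      have h1 := Real.hasDerivAt_rpow_const (p := -s) (Or.inl (hpos z hz).ne')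
      have h2 : HasDerivAt (fun z => ∑ p ∈ Finset.range N,
          -s * (c p * x ^ (-(s + 1) - p)) * ((z - x) ^ (p + 1) / (p + 1)))
          (∑ p ∈ Finset.range N, -s * (c p * x ^ (-(s + 1) - p)) * (z - x) ^ p) z := by
        refine HasDerivAt.fun_sum fun p _ => ?_
        have h3 := ((hasDerivAt_id z).sub_const x).pow (p + 1) |>.div_const ((p : ℝ) + 1)
          |>.const_mul (-s * (c p * x ^ (-(s + 1) - p)))
        convert! h3 using 1
        have : (p : ℝ) + 1 ≠ 0 := by positivity
        simp only [id, add_tsub_cancel_right]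
        push_cast
        field_simp
      have h4 := h1.sub (h2.add_const (x ^ (-s)))
      convert! h4.hasDerivWithinAt using 1
      have : -s - 1 = -(s + 1) := by ring
      rw [this, mul_sub, Finset.mul_sum]
      simp only [mul_assoc]
    have hbound : ∀ z ∈ Set.uIcc x y, ‖-s * (z ^ (-(s + 1)) -
        ∑ p ∈ Finset.range N, c p * x ^ (-(s + 1) - p) * (z - x) ^ p)‖ ≤
        s * (C * |y - x| ^ N * (2 * (x ^ (-s - (N + 1 : ℕ)) + y ^ (-s - (N + 1 : ℕ))))) := by
      intro z hz
      rw [norm_mul, norm_neg, Real.norm_eq_abs, Real.norm_eq_abs, abs_of_pos hs]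
      refine mul_le_mul_of_nonneg_left ((hC x z hx (hpos z hz)).trans ?_) hs.le
      have e2 : -(s + 1) - (N : ℝ) = -s - (N + 1 : ℕ) := by push_cast; ring
      rw [e2]
      have hx' := Real.rpow_nonneg hx.le (-s - (N + 1 : ℕ))
      have hy' := Real.rpow_nonneg hy.le (-s - (N + 1 : ℕ))
      have h5 : |z - x| ≤ |y - x| := Set.abs_sub_left_of_mem_uIcc hz
      have hneg : -s - ((N + 1 : ℕ) : ℝ) ≤ 0 := by
        have : (0 : ℝ) ≤ ((N + 1 : ℕ) : ℝ) := Nat.cast_nonneg _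
        linarith
      have h6 : z ^ (-s - (N + 1 : ℕ)) ≤ x ^ (-s - (N + 1 : ℕ)) + y ^ (-s - (N + 1 : ℕ)) := by
        rcases le_total x y with hxy | hxy
        · have := Real.rpow_le_rpow_of_nonpos hx (by simpa [hxy] using hz.1) hneg
          linarith
        · have := Real.rpow_le_rpow_of_nonpos hy (by simpa [hxy] using hz.1) hneg
          linarith
      have hz' := Real.rpow_nonneg (hpos z hz).le (-s - (N + 1 : ℕ))
      refine mul_le_mul (mul_le_mul_of_nonneg_left (pow_le_pow_left₀ (abs_nonneg _) h5 N) hC0)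
        (by linarith) (by linarith) (by positivity)
    have hmv := (convex_uIcc x y).norm_image_sub_le_of_norm_hasDerivWithin_le hderiv hbound
      Set.left_mem_uIcc Set.right_mem_uIcc
    have hFx : F x = 0 := by simp [F]
    rw [hFx, sub_zero, Real.norm_eq_abs, Real.norm_eq_abs] at hmv
    simp only [F] at hmv
    simp only [Nat.cast_zero, sub_zero, pow_zero, mul_one, if_true, one_mul]
    refine hmv.trans (le_of_eq ?_)
    rw [pow_succ]
    ring

/-! ### Powers of the weight as discrete symbols -/

lemma weight_eq (A L : ℝ) (ξ : Fin n → ℤ) :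
    weight A L ξ = 1 + A * (2 * Real.pi / L) ^ 2 * ∑ i, (ξ i : ℝ) ^ 2 := by
  unfold weight
  simp only [mul_pow, ← Finset.mul_sum]
  ring

lemma exists_bracket_sq_le_weight {A L : ℝ} (hA : 0 < A) (hL : 0 < L) :
    ∃ c : ℝ, 0 < c ∧ ∀ ξ : Fin n → ℤ, c * bracket ξ ^ 2 ≤ weight A L ξ := by
  have hb : 0 < A * (2 * Real.pi / L) ^ 2 := by have := Real.pi_pos; positivity
  refine ⟨min 1 (A * (2 * Real.pi / L) ^ 2), lt_min one_pos hb, fun ξ => ?_⟩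
  have h : 0 ≤ ∑ i, (ξ i : ℝ) ^ 2 := Finset.sum_nonneg fun i _ => sq_nonneg _
  rw [bracket_sq, weight_eq, mul_add, mul_one]
  exact add_le_add (min_le_left _ _) (mul_le_mul_of_nonneg_right (min_le_right _ _) h)

lemma exists_weight_le_bracket_sq {A L : ℝ} (hA : 0 < A) :
    ∃ c : ℝ, 0 < c ∧ ∀ ξ : Fin n → ℤ, weight A L ξ ≤ c * bracket ξ ^ 2 := by
  have hb : 0 ≤ A * (2 * Real.pi / L) ^ 2 := by positivity
  refine ⟨1 + A * (2 * Real.pi / L) ^ 2, by linarith, fun ξ => ?_⟩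
  have h : 0 ≤ ∑ i, (ξ i : ℝ) ^ 2 := Finset.sum_nonneg fun i _ => sq_nonneg _
  rw [bracket_sq, weight_eq]
  nlinarith

lemma exists_weight_rpow_le {A L : ℝ} (hA : 0 < A) (hL : 0 < L) {s : ℝ} (hs : 0 ≤ s) :
    ∃ C : ℝ, 0 ≤ C ∧ ∀ ξ : Fin n → ℤ, weight A L ξ ^ (-s) ≤ C * bracket ξ ^ (-2 * s) := by
  obtain ⟨c, hc, h⟩ := exists_bracket_sq_le_weight (n := n) hA hL
  refine ⟨c ^ (-s), Real.rpow_nonneg hc.le _, fun ξ => ?_⟩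
  have hb := bracket_pos ξ
  have e : bracket ξ ^ (-2 * s) = (bracket ξ ^ 2) ^ (-s) := by
    rw [← Real.rpow_natCast, ← Real.rpow_mul hb.le]; congr 1; push_cast; ring
  rw [e, ← Real.mul_rpow hc.le (by positivity)]
  exact Real.rpow_le_rpow_of_nonpos (by positivity) (h ξ) (by linarith)

/-- Negative powers of the weight are symbols; the induction on the number of differences expands
`(X + δ)⁻ˢ - X⁻ˢ` by Taylor's formula, where `δ` has order `1` and `X` has order `2`. -/
lemma isSym_weight_rpow {T : Type*} {A L : ℝ} (hA : 0 < A) (hL : 0 < L) (l : ℕ) {s : ℝ}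
    (hs : 0 < s) :
    IsSym l (-2 * s) fun (_ : T) (ξ : Fin n → ℤ) => ((weight A L ξ ^ (-s) : ℝ) : ℂ) := by
  have key : ∀ {s : ℝ}, 0 ≤ s → ∃ C : ℝ, ∀ (_ : T) (ξ : Fin n → ℤ),
      ‖((weight A L ξ ^ (-s) : ℝ) : ℂ)‖ ≤ C * bracket ξ ^ (-2 * s) := by
    intro s hs
    obtain ⟨C, _, hC⟩ := exists_weight_rpow_le (n := n) hA hL hs
    refine ⟨C, fun _ ξ => ?_⟩
    rw [Complex.norm_real, Real.norm_eq_abs,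
      abs_of_nonneg (Real.rpow_nonneg (weight_pos hA.le L ξ).le _)]
    exact hC ξ
  induction l generalizing s with
  | zero => exact key hs.le
  | succ l ih =>
    refine ⟨key hs.le, fun i => ?_⟩
    set b := A * (2 * Real.pi / L) ^ 2 with hb
    obtain ⟨c, C, hc0, hC0, hC⟩ := exists_taylor_rpow (l + 1) hs
    -- `δ` is the increment of the weight, `R` the remainder of length `l + 1`, of order
    -- `(l + 1) - 2 (s + l + 1) = (-2 s - 1) - l`
    let δ : (Fin n → ℤ) → ℂ := fun ξ => (b : ℂ) * (2 * (ξ i : ℂ) + 1)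
    have hδ : ∀ ξ, weight A L (ξ + Pi.single i 1) - weight A L ξ = b * (2 * ξ i + 1) := by
      intro ξ
      rw [weight_eq, weight_eq, sum_sq_add_single]
      ring
    have hδs : IsSym l 1 fun (_ : T) ξ => δ ξ := by
      have h1 : IsSym l 1 fun (_ : T) (ξ : Fin n → ℤ) => (2 : ℂ) * (ξ i : ℂ) :=
        (IsSym.coord i).const_mul 2
      have h2 : IsSym l 1 fun (_ : T) (_ : Fin n → ℤ) => (1 : ℂ) :=
        (IsSym.of_const ⟨_, fun _ => le_rfl⟩).mono_order zero_le_one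
      exact (h1.add h2).const_mul _
    let R : (Fin n → ℤ) → ℂ := fun ξ => ((weight A L (ξ + Pi.single i 1) ^ (-s) -
      ∑ p ∈ Finset.range (l + 1), c p * weight A L ξ ^ (-s - p) *
        (weight A L (ξ + Pi.single i 1) - weight A L ξ) ^ p : ℝ) : ℂ)
    have hR : IsSym l (-2 * s - 1) fun (_ : T) ξ => R ξ := by
      apply IsSym.of_bound
      obtain ⟨D, hD0, hD⟩ := (hδs.mono_length (Nat.zero_le l)).bound
      obtain ⟨E, hE0, hE⟩ := exists_weight_rpow_le (n := n) hA hL (s := s + (l + 1 : ℕ))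
        (by positivity)
      refine ⟨C * D ^ (l + 1) * (E * (1 + 2 ^ |-2 * (s + (l + 1 : ℕ))|)), fun t ξ => ?_⟩
      have hbr := bracket_pos ξ
      simp only [R, Complex.norm_real, Real.norm_eq_abs]
      refine (hC _ _ (weight_pos hA.le L ξ) (weight_pos hA.le L _)).trans ?_
      rw [hδ]
      have h1 : |b * (2 * (ξ i : ℝ) + 1)| ^ (l + 1) ≤ D ^ (l + 1) * bracket ξ ^ ((l + 1 : ℕ) : ℝ) := by
        rw [Real.rpow_natCast, ← mul_pow]
        refine pow_le_pow_left₀ (abs_nonneg _) ?_ _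
        have := hD t ξ
        rw [Real.rpow_one] at this
        refine le_trans (le_of_eq ?_) this
        rw [← Real.norm_eq_abs, ← Complex.norm_real]
        simp only [δ]
        push_cast
        rfl
      have e1 : -s - ((l + 1 : ℕ) : ℝ) = -(s + (l + 1 : ℕ)) := by ring
      rw [e1]
      have h2 := hE ξ
      have h3 := (hE (ξ + Pi.single i 1)).trans (mul_le_mul_of_nonneg_left
        (bracket_add_single_rpow_le _ ξ i) hE0)
      have e2 : bracket ξ ^ (-2 * s - 1 - (l : ℝ)) =
          bracket ξ ^ ((l + 1 : ℕ) : ℝ) * bracket ξ ^ (-2 * (s + (l + 1 : ℕ))) := by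
        rw [← Real.rpow_add hbr]; congr 1; push_cast; ring
      rw [e2]
      have hw1 := Real.rpow_nonneg (weight_pos hA.le L ξ).le (-(s + (l + 1 : ℕ)))
      have hw2 := Real.rpow_nonneg (weight_pos hA.le L (ξ + Pi.single i 1)).le (-(s + (l + 1 : ℕ)))
      calc _ ≤ C * (D ^ (l + 1) * bracket ξ ^ ((l + 1 : ℕ) : ℝ)) *
            (E * bracket ξ ^ (-2 * (s + (l + 1 : ℕ))) +
              E * (2 ^ |-2 * (s + (l + 1 : ℕ))| * bracket ξ ^ (-2 * (s + (l + 1 : ℕ))))) :=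
            mul_le_mul (mul_le_mul_of_nonneg_left h1 hC0) (add_le_add h2 h3)
              (add_nonneg hw1 hw2) (by positivity)
        _ = _ := by ring
    have hterm : ∀ p ∈ Finset.range l, IsSym l (-2 * s - 1) fun (_ : T) ξ =>
        (c (p + 1) : ℂ) * (((weight A L ξ ^ (-(s + (p + 1 : ℕ))) : ℝ) : ℂ) * δ ξ ^ (p + 1)) := by
      intro p _
      refine (((ih (s := s + (p + 1 : ℕ)) (by positivity)).mul (hδs.pow (p + 1))).mono_order
        ?_).const_mul _
      push_cast
      have : (0 : ℝ) ≤ p := Nat.cast_nonneg _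
      linarith
    refine (hR.add (IsSym.sum hterm)).congr fun t ξ => ?_
    simp only [R, δ, dif_apply]
    rw [Finset.sum_range_succ', hδ]
    have e3 : ∀ p : ℕ, -(s + ((p + 1 : ℕ) : ℝ)) = -s - ((p + 1 : ℕ) : ℝ) := fun p => by ring
    simp only [e3, hc0]
    push_cast
    simp only [pow_zero, mul_one, one_mul, sub_zero, mul_assoc]
    ring

/-! ### Windows on the standard torus -/

/-- Smooth functions on the standard torus whose closed support lies in the image of the cube with
centre `c` and side length `L`. -/
structure IsWindow (L : ℝ) (c : Fin n → ℝ) (f : (Fin n → ℝ) → ℂ) : Prop where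
  test : IsTestFunction (2 * Real.pi) f
  support : ∀ x ∈ tsupport f, ∃ m : Fin n → ℤ, (fun i => x i + 2 * Real.pi * (m i : ℝ)) ∈ cube L c

namespace IsWindow

variable {L : ℝ} {c : Fin n → ℝ} {f h : (Fin n → ℝ) → ℂ}

lemma pd (hf : IsWindow L c f) (i : Fin n) : IsWindow L c (pd i f) := by
  refine ⟨hf.test.pd i, fun x hx => hf.support x ?_⟩
  have h1 : tsupport (ToroidalPsDO.pd i f) ⊆ tsupport (fderiv ℝ f) := by
    refine closure_mono fun y hy => ?_
    rw [Function.mem_support] at hy ⊢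
    intro h0
    exact hy (by rw [ToroidalPsDO.pd, h0]; rfl)
  exact tsupport_fderiv_subset ℝ (h1 hx)

lemma add (hf : IsWindow L c f) (hh : IsWindow L c h) : IsWindow L c fun x => f x + h x := by
  refine ⟨hf.test.add hh.test, fun x hx => ?_⟩
  rcases tsupport_add f h hx with h1 | h1
  · exact hf.support x h1
  · exact hh.support x h1

lemma mul_test (hf : IsWindow L c f) (hh : IsTestFunction (2 * Real.pi) h) :
    IsWindow L c fun x => f x * h x :=
  ⟨hf.test.mul hh, fun x hx => hf.support x (tsupport_mul_subset_left hx)⟩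

lemma const_mul (hf : IsWindow L c f) (a : ℂ) : IsWindow L c fun x => a * f x :=
  ⟨hf.test.const_mul a, fun x hx => hf.support x (tsupport_mul_subset_right (f := fun _ => a) hx)⟩

lemma zero : IsWindow L c fun _ => 0 :=
  ⟨⟨contDiff_const, fun _ _ => rfl⟩, fun x hx => by simp [tsupport] at hx⟩

lemma sum {ι : Type*} {s : Finset ι} {f : ι → (Fin n → ℝ) → ℂ}
    (hf : ∀ j ∈ s, IsWindow L c (f j)) : IsWindow L c fun x => ∑ j ∈ s, f j x := by
  classical
  induction s using Finset.induction_on with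
  | empty => simpa using zero
  | insert a s ha ih =>
    simp only [Finset.sum_insert ha]
    exact (hf a (Finset.mem_insert_self a s)).add
      (ih fun j hj => hf j (Finset.mem_insert_of_mem hj))

end IsWindow

lemma eq_zero_of_two_pi_mul_lt {L : ℝ} (hL : L ≤ 2 * Real.pi) {m : ℤ}
    (h : |2 * Real.pi * (m : ℝ)| < L) : m = 0 := by
  have hpi := Real.pi_pos
  rw [abs_mul, abs_of_pos (by positivity)] at h
  have h1 : |(m : ℝ)| < 1 := by
    by_contra h2
    rw [not_lt] at h2
    nlinarith
  rw [← Int.cast_abs] at h1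
  exact Int.abs_lt_one_iff.1 (by exact_mod_cast h1)

/-- The image of the cube in the torus does not meet the rest of the closed cube. -/
lemma mem_cube_of_translate_mem {L : ℝ} (hL : L ≤ 2 * Real.pi) {c x : Fin n → ℝ}
    {m : Fin n → ℤ} (hm : (fun i => x i + 2 * Real.pi * (m i : ℝ)) ∈ cube L c) {i : Fin n}
    (hx : |x i - c i| ≤ L / 2) : m i = 0 ∧ x i ∈ Set.Ioo (c i - L / 2) (c i + L / 2) := by
  have h1 := hm i
  simp only [Set.mem_Ioo] at h1
  rw [abs_le] at hx
  have h2 : m i = 0 := by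
    apply eq_zero_of_two_pi_mul_lt hL
    rw [abs_lt]
    constructor <;> linarith [h1.1, h1.2, hx.1, hx.2]
  rw [h2] at h1
  exact ⟨h2, by simpa using h1⟩

lemma IsWindow.faceMatching {L : ℝ} (hL0 : 0 < L) (hL : L ≤ 2 * Real.pi) {c : Fin n → ℝ}
    {f : (Fin n → ℝ) → ℂ} (hf : IsWindow L c f) : FaceMatching L c f := by
  refine ⟨hf.test.smooth, fun i x hx => ?_⟩
  have key : ∀ z : Fin n → ℝ, |z i - c i| = L / 2 → ∀ᶠ y in 𝓝 z, f y = 0 := by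
    intro z hz
    have h1 : z ∉ tsupport f := by
      intro hz'
      obtain ⟨m, hm⟩ := hf.support z hz'
      obtain ⟨_, h2⟩ := mem_cube_of_translate_mem hL hm hz.le
      have h3 : |z i - c i| < L / 2 := by
        rw [abs_lt]; constructor <;> linarith [h2.1, h2.2]
      linarith
    exact notMem_tsupport_iff_eventuallyEq.1 h1
  have h1 := key x (by
    rw [hx, show c i - L / 2 - c i = -(L / 2) by ring, abs_neg, abs_of_pos (by linarith)])
  have h2 := key (x + Pi.single i L) (by
    rw [Pi.add_apply, hx, Pi.single_eq_same, show c i - L / 2 + L - c i = L / 2 by ring,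
      abs_of_pos (by linarith)])
  have h3 : ContinuousAt (fun y : Fin n → ℝ => y + Pi.single i L) x := by fun_prop
  filter_upwards [h1, h3.eventually h2] with y hy1 hy2
  rw [hy1, hy2]

lemma cube_eq_ball {L : ℝ} (hL : 0 < L) (c : Fin n → ℝ) : cube L c = Metric.ball c (L / 2) := by
  ext x
  rw [Metric.mem_ball, dist_pi_lt_iff (by linarith)]
  refine forall_congr' fun i => ?_
  rw [Real.dist_eq, abs_lt, Set.mem_Ioo]
  constructor <;> rintro ⟨h1, h2⟩ <;> constructor <;> linarith

lemma IsWindow.hasSum {L : ℝ} (hL0 : 0 < L) (hL : L ≤ 2 * Real.pi) {c : Fin n → ℝ}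
    {f : (Fin n → ℝ) → ℂ} (hf : IsWindow L c f) {x : Fin n → ℝ} (hx : x ∈ cube L c) :
    HasSum (fun k => fourierOn L c f k * expo L k x) (f x) := by
  have hcl : IsClosed (tsupport f ∩ Metric.closedBall c (L / 2)) :=
    (isClosed_tsupport f).inter Metric.isClosed_closedBall
  have hmem : ∀ z, z ∈ Metric.closedBall c (L / 2) ↔ ∀ i, |z i - c i| ≤ L / 2 := by
    intro z
    rw [Metric.mem_closedBall, dist_pi_le_iff (by linarith)]
    rfl
  have hsub : tsupport f ∩ Metric.closedBall c (L / 2) ⊆ Metric.ball c (L / 2) := by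
    rintro z ⟨h1, h2⟩
    rw [← cube_eq_ball hL0]
    obtain ⟨m, hm⟩ := hf.support z h1
    exact fun i => (mem_cube_of_translate_mem hL hm ((hmem z).1 h2 i)).2
  obtain ⟨ρ, hρ, hsub'⟩ := exists_lt_subset_ball hcl hsub
  refine hasSum_fourierOn_of_support hL0 c hf.test.smooth.continuous hρ (fun z hz hz' i => ?_)
    (((hf.faceMatching hL0 hL).rapidDecay hL0).summable_norm hL0).of_norm hx
  have h1 := hsub' ⟨subset_tsupport f hz', (hmem z).2 hz⟩
  have h2 := dist_le_pi_dist z c i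
  rw [Real.dist_eq] at h2
  exact h2.trans (Metric.mem_ball.1 h1).le

/-! ### Twisted Fourier coefficients -/

/-- The function `f e_ξ`, with the exponential of the standard torus. -/
def twist (f : (Fin n → ℝ) → ℂ) (ξ : Fin n → ℤ) : (Fin n → ℝ) → ℂ :=
  fun y => f y * expo (2 * Real.pi) ξ y

lemma IsWindow.twist {L : ℝ} {c : Fin n → ℝ} {f : (Fin n → ℝ) → ℂ} (hf : IsWindow L c f)
    (ξ : Fin n → ℤ) : IsWindow L c (twist f ξ) :=
  hf.mul_test (isTestFunction_expo (by have := Real.pi_pos; positivity) ξ)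

lemma pd_twist {f : (Fin n → ℝ) → ℂ} (hf : ContDiff ℝ ∞ f) (ξ : Fin n → ℤ) (i : Fin n) :
    pd i (twist f ξ) = fun y => twist (pd i f) ξ y + Complex.I * ξ i * twist f ξ y := by
  unfold twist
  rw [pd_mul hf (contDiff_expo _ ξ), pd_expo]
  funext y
  have hpi : (Real.pi : ℂ) ≠ 0 := by exact_mod_cast Real.pi_ne_zero
  have h1 : (2 * Real.pi / ((2 * Real.pi : ℝ) : ℂ) : ℂ) = 1 := by
    push_cast
    field_simp
  rw [h1]
  ring

/-- The weight `1 + A |2πk/L - ξ|²`. -/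
def shiftWeight (A L : ℝ) (k ξ : Fin n → ℤ) : ℝ :=
  1 + A * ∑ i, (2 * Real.pi / L * (k i : ℝ) - ξ i) ^ 2

section Twisted

variable {L : ℝ} (hL0 : 0 < L) (hL : L ≤ 2 * Real.pi) {c : Fin n → ℝ}

include hL0 hL

lemma fourierOn_twist_pd {f : (Fin n → ℝ) → ℂ} (hf : IsWindow L c f) (ξ k : Fin n → ℤ)
    (i : Fin n) : fourierOn L c (twist (pd i f) ξ) k =
      Complex.I * (2 * Real.pi / L * k i - ξ i) * fourierOn L c (twist f ξ) k := by
  have h1 := fourierOn_pd hL0 ((hf.twist ξ).faceMatching hL0 hL) i k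
  rw [pd_twist hf.test.smooth, fourierOn_add L c ((hf.pd i).twist ξ).test.smooth.continuous
    ((hf.twist ξ).const_mul _).test.smooth.continuous, fourierOn_const_mul] at h1
  linear_combination h1

lemma fourierOn_twist_pd_pd {f : (Fin n → ℝ) → ℂ} (hf : IsWindow L c f) (ξ k : Fin n → ℤ)
    (i : Fin n) : fourierOn L c (twist (pd i (pd i f)) ξ) k =
      -(2 * Real.pi / L * k i - ξ i) ^ 2 * fourierOn L c (twist f ξ) k := by
  rw [fourierOn_twist_pd hL0 hL (hf.pd i), fourierOn_twist_pd hL0 hL hf]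
  linear_combination (2 * Real.pi / L * k i - ξ i : ℂ) ^ 2 * fourierOn L c (twist f ξ) k *
    Complex.I_sq

omit hL0 hL in
lemma fourierOn_twist_sum {ι : Type*} (s : Finset ι) {f : ι → (Fin n → ℝ) → ℂ}
    (hf : ∀ j ∈ s, IsWindow L c (f j)) (ξ k : Fin n → ℤ) :
    fourierOn L c (twist (fun y => ∑ j ∈ s, f j y) ξ) k =
      ∑ j ∈ s, fourierOn L c (twist (f j) ξ) k := by
  rw [← fourierOn_sum s L c fun j hj => ((hf j hj).twist ξ).test.smooth.continuous]
  congr 1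
  funext y
  simp only [twist, Finset.sum_mul]

omit hL0 hL in
lemma fourierOn_twist_add {f h : (Fin n → ℝ) → ℂ} (hf : IsWindow L c f) (hh : IsWindow L c h)
    (ξ k : Fin n → ℤ) : fourierOn L c (twist (fun y => f y + h y) ξ) k =
      fourierOn L c (twist f ξ) k + fourierOn L c (twist h ξ) k := by
  rw [← fourierOn_add L c (hf.twist ξ).test.smooth.continuous
    (hh.twist ξ).test.smooth.continuous]
  congr 1
  funext y
  simp only [twist, add_mul]

omit hL0 hL in
lemma fourierOn_twist_const_mul (f : (Fin n → ℝ) → ℂ) (a : ℂ)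
    (ξ k : Fin n → ℤ) : fourierOn L c (twist (fun y => a * f y) ξ) k =
      a * fourierOn L c (twist f ξ) k := by
  rw [← fourierOn_const_mul]
  congr 1
  funext y
  simp only [twist, mul_assoc]

omit hL0 hL in
lemma IsWindow.laplace {f : (Fin n → ℝ) → ℂ} (hf : IsWindow L c f) :
    IsWindow L c fun y => ∑ i, ToroidalPsDO.pd i (ToroidalPsDO.pd i f) y :=
  IsWindow.sum fun i _ => (hf.pd i).pd i

lemma fourierOn_twist_helm (A : ℝ) {f : (Fin n → ℝ) → ℂ} (hf : IsWindow L c f)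
    (ξ k : Fin n → ℤ) : fourierOn L c (twist (helm A f) ξ) k =
      shiftWeight A L k ξ * fourierOn L c (twist f ξ) k := by
  unfold helm
  rw [fourierOn_twist_add hf (hf.laplace.const_mul _), fourierOn_twist_const_mul,
    fourierOn_twist_sum _ fun i _ => (hf.pd i).pd i]
  simp only [fourierOn_twist_pd_pd hL0 hL hf, ← Finset.sum_mul, Finset.sum_neg_distrib]
  unfold shiftWeight
  push_cast
  ring

end Twisted

/-! ### Families of windows that depend polynomially on the frequency -/

/-- Families of windows that are polynomials of degree at most `p` in `ξ`. -/
inductive IsPolyFamily (L : ℝ) (c : Fin n → ℝ) :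
    ℕ → ((Fin n → ℤ) → (Fin n → ℝ) → ℂ) → Prop
  | const (p : ℕ) (f : (Fin n → ℝ) → ℂ) (hf : IsWindow L c f) : IsPolyFamily L c p fun _ => f
  | add {p : ℕ} {h h' : (Fin n → ℤ) → (Fin n → ℝ) → ℂ} (hh : IsPolyFamily L c p h)
      (hh' : IsPolyFamily L c p h') : IsPolyFamily L c p fun ξ y => h ξ y + h' ξ y
  | coord_mul {p : ℕ} {h : (Fin n → ℤ) → (Fin n → ℝ) → ℂ} (i : Fin n)
      (hh : IsPolyFamily L c p h) : IsPolyFamily L c (p + 1) fun ξ y => (ξ i : ℂ) * h ξ y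

namespace IsPolyFamily

variable {L : ℝ} {c : Fin n → ℝ} {p : ℕ} {h : (Fin n → ℤ) → (Fin n → ℝ) → ℂ}

lemma succ (hh : IsPolyFamily L c p h) : IsPolyFamily L c (p + 1) h := by
  induction hh with
  | const p f hf => exact const _ f hf
  | add _ _ ih ih' => exact add ih ih'
  | coord_mul i _ ih => exact coord_mul i ih

lemma isWindow (hh : IsPolyFamily L c p h) (ξ : Fin n → ℤ) : IsWindow L c (h ξ) := by
  induction hh with
  | const p f hf => exact hf
  | add _ _ ih ih' => exact ih.add ih'
  | coord_mul i _ ih => exact ih.const_mul _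

lemma const_mul (hh : IsPolyFamily L c p h) (a : ℂ) :
    IsPolyFamily L c p fun ξ y => a * h ξ y := by
  induction hh with
  | const p f hf => exact const _ _ (hf.const_mul a)
  | add _ _ ih ih' =>
    have := add ih ih'
    simpa only [mul_add] using this
  | coord_mul i _ ih =>
    have := coord_mul i ih
    simpa only [mul_left_comm a] using this

lemma pd (hh : IsPolyFamily L c p h) (i : Fin n) : IsPolyFamily L c p fun ξ => pd i (h ξ) := by
  induction hh with
  | const p f hf => exact const _ _ (hf.pd i)
  | add h1 h2 ih ih' =>
    have := add ih ih'
    simp only [pd_add (h1.isWindow _).test.smooth (h2.isWindow _).test.smooth]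
    exact this
  | coord_mul j h1 ih =>
    have := coord_mul j ih
    simp only [pd_const_mul (h1.isWindow _).test.smooth]
    exact this

lemma sum {ι : Type*} {s : Finset ι} {h : ι → (Fin n → ℤ) → (Fin n → ℝ) → ℂ}
    (hh : ∀ j ∈ s, IsPolyFamily L c p (h j)) :
    IsPolyFamily L c p fun ξ y => ∑ j ∈ s, h j ξ y := by
  classical
  induction s using Finset.induction_on with
  | empty => simpa using const p _ IsWindow.zero
  | insert a s ha ih =>
    simp only [Finset.sum_insert ha]
    exact (hh a (Finset.mem_insert_self a s)).add
      (ih fun j hj => hh j (Finset.mem_insert_of_mem hj))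

lemma isSym (hh : IsPolyFamily L c p h) (l : ℕ) : IsSym l p fun y ξ => h ξ y := by
  have hpi := Real.pi_pos
  induction hh with
  | const p f hf =>
    exact (IsSym.of_const (exists_bound_of_periodic (by positivity) hf.test.smooth.continuous
      hf.test.periodic)).mono_order (Nat.cast_nonneg p)
  | add _ _ ih ih' => exact ih.add ih'
  | coord_mul i _ ih =>
    have := (IsSym.coord (T := Fin n → ℝ) (l := l) i).mul ih
    push_cast
    rwa [add_comm]

lemma helm (hh : IsPolyFamily L c p h) (A : ℝ) : IsPolyFamily L c p fun ξ => helm A (h ξ) :=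
  hh.add ((IsPolyFamily.sum fun i _ => (hh.pd i).pd i).const_mul _)

end IsPolyFamily

/-- The operator `e_{-ξ} (1 - A Δ) e_ξ - (1 + A |ξ|²) = -A Δ - 2 i A ξ · ∇` on families. -/
def lam (A : ℝ) (h : (Fin n → ℤ) → (Fin n → ℝ) → ℂ) : (Fin n → ℤ) → (Fin n → ℝ) → ℂ :=
  fun ξ y => (-A : ℂ) * ∑ i, pd i (pd i (h ξ)) y +
    (-2 * Complex.I * A) * ∑ i, (ξ i : ℂ) * pd i (h ξ) y

lemma IsPolyFamily.lam {L A : ℝ} {c : Fin n → ℝ} {p : ℕ} {h : (Fin n → ℤ) → (Fin n → ℝ) → ℂ}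
    (hh : IsPolyFamily L c p h) : IsPolyFamily L c (p + 1) (lam A h) :=
  ((IsPolyFamily.sum fun i _ => (hh.pd i).pd i).const_mul _).succ.add
    ((IsPolyFamily.sum fun i _ => (hh.pd i).coord_mul i).const_mul _)

lemma IsPolyFamily.lam_iterate {L A : ℝ} {c : Fin n → ℝ} {f : (Fin n → ℝ) → ℂ}
    (hf : IsWindow L c f) (p : ℕ) : IsPolyFamily L c p ((ToroidalPsDO.lam A)^[p] fun _ => f) := by
  induction p with
  | zero => exact IsPolyFamily.const 0 f hf
  | succ p ih => rw [Function.iterate_succ_apply']; exact ih.lam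

section Twisted

variable {L : ℝ} (hL0 : 0 < L) (hL : L ≤ 2 * Real.pi) {c : Fin n → ℝ}

include hL0 hL

lemma fourierOn_twist_lam (A : ℝ) {p : ℕ} {h : (Fin n → ℤ) → (Fin n → ℝ) → ℂ}
    (hh : IsPolyFamily L c p h) (ξ k : Fin n → ℤ) :
    fourierOn L c (twist (lam A h ξ) ξ) k =
      (weight A L k - weight A (2 * Real.pi) ξ : ℝ) * fourierOn L c (twist (h ξ) ξ) k := by
  have hw := hh.isWindow ξ
  unfold lam
  rw [fourierOn_twist_add (hw.laplace.const_mul _)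
    ((IsWindow.sum fun i _ => (hw.pd i).const_mul _).const_mul _), fourierOn_twist_const_mul,
    fourierOn_twist_const_mul, fourierOn_twist_sum _ fun i _ => (hw.pd i).pd i,
    fourierOn_twist_sum _ fun i _ => (hw.pd i).const_mul _]
  simp only [fourierOn_twist_const_mul, fourierOn_twist_pd_pd hL0 hL hw,
    fourierOn_twist_pd hL0 hL hw]
  unfold weight
  have hpi : (2 * Real.pi) ≠ 0 := by have := Real.pi_pos; positivity
  rw [div_self hpi]
  push_cast
  rw [Finset.mul_sum, Finset.mul_sum, ← Finset.sum_add_distrib, add_sub_add_left_eq_sub,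
    ← mul_sub, ← Finset.sum_sub_distrib, Finset.mul_sum, Finset.sum_mul]
  refine Finset.sum_congr rfl fun i _ => ?_
  linear_combination (-2 * A * ξ i * (2 * Real.pi / L * k i - ξ i) *
    fourierOn L c (twist (h ξ) ξ) k) * Complex.I_sq

lemma fourierOn_twist_lam_iterate (A : ℝ) {f : (Fin n → ℝ) → ℂ}
    (hf : IsWindow L c f) (p : ℕ) (ξ k : Fin n → ℤ) :
    fourierOn L c (twist ((lam A)^[p] (fun _ => f) ξ) ξ) k =
      ((weight A L k - weight A (2 * Real.pi) ξ) ^ p : ℝ) * fourierOn L c (twist f ξ) k := by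
  induction p with
  | zero => simp
  | succ p ih =>
    rw [Function.iterate_succ_apply', fourierOn_twist_lam hL0 hL A
      (IsPolyFamily.lam_iterate hf p), ih]
    push_cast
    ring

/-- Decay of twisted Fourier coefficients away from the twisting frequency. -/
lemma exists_norm_fourierOn_twist_le {A : ℝ} (hA : 0 ≤ A) (M : ℕ) {p : ℕ}
    {h : (Fin n → ℤ) → (Fin n → ℝ) → ℂ} (hh : IsPolyFamily L c p h) :
    ∃ C : ℝ, 0 ≤ C ∧ ∀ ξ k, ‖fourierOn L c (twist (h ξ) ξ) k‖ ≤
      C * bracket ξ ^ (p : ℝ) * (shiftWeight A L k ξ ^ M)⁻¹ := by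
  have hpos : ∀ ξ k : Fin n → ℤ, 0 < shiftWeight A L k ξ := by
    intro ξ k
    have : 0 ≤ A * ∑ i, (2 * Real.pi / L * (k i : ℝ) - ξ i) ^ 2 :=
      mul_nonneg hA (Finset.sum_nonneg fun i _ => sq_nonneg _)
    unfold shiftWeight; linarith
  induction M generalizing h with
  | zero =>
    obtain ⟨C, hC0, hC⟩ := (hh.isSym 0).bound
    refine ⟨C, hC0, fun ξ k => ?_⟩
    rw [pow_zero, inv_one, mul_one]
    refine norm_fourierOn_le hL0 c (fun y _ => ?_) k
    rw [twist, norm_mul, norm_expo, mul_one]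
    exact hC y ξ
  | succ M ih =>
    obtain ⟨C, hC0, hC⟩ := ih (hh.helm A)
    refine ⟨C, hC0, fun ξ k => ?_⟩
    have h1 := hC ξ k
    rw [fourierOn_twist_helm hL0 hL A (hh.isWindow ξ), norm_mul, Complex.norm_real,
      Real.norm_eq_abs, abs_of_pos (hpos ξ k)] at h1
    rw [pow_succ, mul_inv, ← mul_assoc, ← div_eq_mul_inv _ (shiftWeight A L k ξ),
      le_div_iff₀ (hpos ξ k), mul_comm]
    exact h1

end Twisted

lemma one_le_shiftWeight {A : ℝ} (hA : 0 ≤ A) (L : ℝ) (k ξ : Fin n → ℤ) :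
    1 ≤ shiftWeight A L k ξ := by
  have : 0 ≤ A * ∑ i, (2 * Real.pi / L * (k i : ℝ) - ξ i) ^ 2 :=
    mul_nonneg hA (Finset.sum_nonneg fun i _ => sq_nonneg _)
  unfold shiftWeight; linarith

/-- Peetre's inequality. -/
lemma weight_le_two_mul {A : ℝ} (hA : 0 ≤ A) (L : ℝ) (k ξ : Fin n → ℤ) :
    weight A (2 * Real.pi) ξ ≤ 2 * (weight A L k * shiftWeight A L k ξ) := by
  have hpi : (2 * Real.pi) ≠ 0 := by have := Real.pi_pos; positivity
  unfold weight shiftWeight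
  rw [div_self hpi]
  set S := ∑ i, (2 * Real.pi / L * (k i : ℝ)) ^ 2
  set Q := ∑ i, (2 * Real.pi / L * (k i : ℝ) - ξ i) ^ 2
  have hS : 0 ≤ S := Finset.sum_nonneg fun i _ => sq_nonneg _
  have hQ : 0 ≤ Q := Finset.sum_nonneg fun i _ => sq_nonneg _
  have h1 : ∑ i, (1 * (ξ i : ℝ)) ^ 2 ≤ 2 * S + 2 * Q := by
    rw [Finset.mul_sum, Finset.mul_sum, ← Finset.sum_add_distrib]
    refine Finset.sum_le_sum fun i _ => ?_
    nlinarith [sq_nonneg (2 * (2 * Real.pi / L * (k i : ℝ)) - ξ i)]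
  have h2 := mul_le_mul_of_nonneg_left h1 hA
  have h3 : 0 ≤ (A * S) * (A * Q) := by positivity
  nlinarith

/-- The sum of the shifted weights is bounded uniformly in the shift, which may be replaced by the
nearest point of the dual lattice. -/
lemma exists_tsum_shiftWeight_le {A L : ℝ} (hA : 0 < A) (hL : 0 < L) :
    ∃ C : ℝ, 0 ≤ C ∧ ∀ ξ : Fin n → ℤ, Summable (fun k => (shiftWeight A L k ξ ^ n)⁻¹) ∧
      ∑' k, (shiftWeight A L k ξ ^ n)⁻¹ ≤ C := by
  have hpi := Real.pi_pos
  set D : ℝ := 2 + 2 * A * (n * (Real.pi / L) ^ 2) with hD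
  have hD0 : 0 < D := by positivity
  have hs := summable_inv_weight_pow (n := n) hA hL
  have hw : ∀ k : Fin n → ℤ, 0 ≤ (weight A L k ^ n)⁻¹ := fun k =>
    inv_nonneg.2 (pow_nonneg (weight_pos hA.le L k).le n)
  refine ⟨D ^ n * ∑' k : Fin n → ℤ, (weight A L k ^ n)⁻¹,
    mul_nonneg (by positivity) (tsum_nonneg hw), fun ξ => ?_⟩
  -- `2π k₀ / L` is the point of the dual lattice nearest to `ξ`
  let k₀ : Fin n → ℤ := fun i => round ((ξ i : ℝ) * L / (2 * Real.pi))
  have hk₀ : ∀ i, (2 * Real.pi / L * (k₀ i : ℝ) - ξ i) ^ 2 ≤ (Real.pi / L) ^ 2 := by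
    intro i
    have h1 := abs_sub_round ((ξ i : ℝ) * L / (2 * Real.pi))
    have h2 : 2 * Real.pi / L * (k₀ i : ℝ) - ξ i =
        -(2 * Real.pi / L * ((ξ i : ℝ) * L / (2 * Real.pi) - k₀ i)) := by
      field_simp
      ring
    rw [h2, neg_sq]
    have h3 : |2 * Real.pi / L * ((ξ i : ℝ) * L / (2 * Real.pi) - k₀ i)| ≤ Real.pi / L := by
      rw [abs_mul, abs_of_pos (by positivity)]
      refine (mul_le_mul_of_nonneg_left h1 (by positivity)).trans (le_of_eq ?_)
      ring
    exact sq_le_sq' (abs_le.1 h3).1 (abs_le.1 h3).2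
  have hcomp : ∀ k : Fin n → ℤ, weight A L (k - k₀) ≤ D * shiftWeight A L k ξ := by
    intro k
    unfold weight shiftWeight
    set Q := ∑ i, (2 * Real.pi / L * (k i : ℝ) - ξ i) ^ 2
    have hQ : 0 ≤ Q := Finset.sum_nonneg fun i _ => sq_nonneg _
    have h1 : ∑ i, (2 * Real.pi / L * (((k - k₀) i : ℤ) : ℝ)) ^ 2 ≤
        2 * Q + 2 * (n * (Real.pi / L) ^ 2) := by
      have h2 : ∑ i : Fin n, (2 * Real.pi / L * (k₀ i : ℝ) - ξ i) ^ 2 ≤ n * (Real.pi / L) ^ 2 := by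
        refine (Finset.sum_le_sum fun i _ => hk₀ i).trans (le_of_eq ?_)
        simp
      have h3 : ∑ i, (2 * Real.pi / L * (((k - k₀) i : ℤ) : ℝ)) ^ 2 ≤
          2 * Q + 2 * ∑ i : Fin n, (2 * Real.pi / L * (k₀ i : ℝ) - ξ i) ^ 2 := by
        rw [Finset.mul_sum, Finset.mul_sum, ← Finset.sum_add_distrib]
        refine Finset.sum_le_sum fun i _ => ?_
        simp only [Pi.sub_apply]
        push_cast
        nlinarith [sq_nonneg ((2 * Real.pi / L * (k i : ℝ) - ξ i) +
          (2 * Real.pi / L * (k₀ i : ℝ) - ξ i))]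
      linarith
    have h4 := mul_le_mul_of_nonneg_left h1 hA.le
    have h5 : 0 ≤ A * Q := mul_nonneg hA.le hQ
    have h6 : 0 ≤ 2 * A * (n * (Real.pi / L) ^ 2) := by positivity
    rw [hD]
    nlinarith
  have hle : ∀ k, (shiftWeight A L k ξ ^ n)⁻¹ ≤ D ^ n * (weight A L (k - k₀) ^ n)⁻¹ := by
    intro k
    have hz := one_pos.trans_le (one_le_shiftWeight hA.le L k ξ)
    have hw := weight_pos hA.le L (k - k₀)
    rw [← div_eq_mul_inv, le_div_iff₀ (pow_pos hw n), inv_mul_le_iff₀ (pow_pos hz n), ← mul_pow,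
      mul_comm]
    exact pow_le_pow_left₀ hw.le (hcomp k) n
  have hs' : Summable fun k : Fin n → ℤ => D ^ n * (weight A L (k - k₀) ^ n)⁻¹ :=
    ((Equiv.subRight k₀).summable_iff.2 hs).mul_left _
  have hsum : Summable fun k => (shiftWeight A L k ξ ^ n)⁻¹ := hs'.of_nonneg_of_le
    (fun k => inv_nonneg.2 (pow_nonneg (zero_le_one.trans (one_le_shiftWeight hA.le L k ξ)) n)) hle
  refine ⟨hsum, (hsum.tsum_le_tsum hle hs').trans (le_of_eq ?_)⟩
  rw [tsum_mul_left]
  congr 1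
  exact (Equiv.subRight k₀).tsum_eq fun k => (weight A L k ^ n)⁻¹

/-! ### Asymptotic expansion of the conjugated multiplier -/

/-- The Fourier multiplier of `(1 - A Δ)^{-1/2}` on the torus of period `L`. -/
def invSqrtWeight (A L : ℝ) (k : Fin n → ℤ) : ℂ := ((weight A L k ^ (-(1 / 2) : ℝ) : ℝ) : ℂ)

lemma norm_invSqrtWeight_le_one {A : ℝ} (hA : 0 ≤ A) (L : ℝ) (k : Fin n → ℤ) :
    ‖invSqrtWeight A L k‖ ≤ 1 := by
  rw [invSqrtWeight, Complex.norm_real, Real.norm_eq_abs,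
    abs_of_nonneg (Real.rpow_nonneg (weight_pos hA L k).le _)]
  exact Real.rpow_le_one_of_one_le_of_nonpos (one_le_weight hA L k) (by norm_num)

/-- `e_{-ξ} (1 - A Δ)^{-1/2} e_ξ f`, where `(1 - A Δ)^{-1/2}` acts by Fourier series on the cube. -/
def conjOp (A L : ℝ) (c : Fin n → ℝ) (f : (Fin n → ℝ) → ℂ) (ξ : Fin n → ℤ) :
    (Fin n → ℝ) → ℂ :=
  fun y => expo (2 * Real.pi) (-ξ) y * multiplier L c (invSqrtWeight A L) (twist f ξ) y

section Expansion

variable {A L : ℝ} (hA : 0 < A) (hL0 : 0 < L) (hL : L ≤ 2 * Real.pi) {c : Fin n → ℝ}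

include hA in
/-- A quantitative form of Peetre's inequality for the two terms of the Taylor remainder. -/
lemma weight_rpow_add_le (N : ℕ) (k ξ : Fin n → ℤ) :
    weight A (2 * Real.pi) ξ ^ (-(1 / 2) - N : ℝ) + weight A L k ^ (-(1 / 2) - N : ℝ) ≤
      weight A (2 * Real.pi) ξ ^ (-(1 / 2) - N : ℝ) * (1 + 2 ^ (N + 1)) *
        shiftWeight A L k ξ ^ (N + 1) := by
  have hX := weight_pos hA.le (2 * Real.pi) ξ
  have hY := weight_pos hA.le L k
  have hZ1 := one_le_shiftWeight hA.le L k ξ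
  have hZ := one_pos.trans_le hZ1
  have hP := weight_le_two_mul hA.le L k ξ
  set X := weight A (2 * Real.pi) ξ
  set Y := weight A L k
  set Z := shiftWeight A L k ξ
  have hneg : (-(1 / 2) - N : ℝ) ≤ 0 := by
    have : (0 : ℝ) ≤ N := Nat.cast_nonneg N
    linarith
  have h1 : Y ^ (-(1 / 2) - N : ℝ) ≤ X ^ (-(1 / 2) - N : ℝ) * (2 * Z) ^ (N + 1) := by
    have h2 : X / (2 * Z) ≤ Y := by
      rw [div_le_iff₀ (by positivity)]; linarith
    refine (Real.rpow_le_rpow_of_nonpos (by positivity) h2 hneg).trans ?_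
    rw [div_eq_mul_inv, Real.mul_rpow hX.le (by positivity), Real.inv_rpow (by positivity),
      ← Real.rpow_neg (by positivity)]
    refine mul_le_mul_of_nonneg_left ?_ (Real.rpow_nonneg hX.le _)
    rw [← Real.rpow_natCast]
    refine Real.rpow_le_rpow_of_exponent_le (by linarith) ?_
    push_cast
    linarith
  have h3 : (1 : ℝ) ≤ Z ^ (N + 1) := one_le_pow₀ hZ1
  have h4 := Real.rpow_nonneg hX.le (-(1 / 2) - N : ℝ)
  rw [mul_pow] at h1
  nlinarith [mul_le_mul_of_nonneg_left h3 h4]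

include hA hL0 hL

/-- The asymptotic expansion of `e_{-ξ} (1 - A Δ)^{-1/2} e_ξ f`: Taylor's formula for the `-1/2`
power is applied on the Fourier side, where `1 - A Δ` has the eigenvalues `weight A L k`, around
the value `weight A (2π) ξ`; powers of the difference correspond to powers of `lam A`. -/
lemma exists_conjOp_expansion {f : (Fin n → ℝ) → ℂ} (hf : IsWindow L c f) (N : ℕ) :
    ∃ (b : ℕ → ℝ) (C : ℝ), b 0 = 1 ∧ 0 ≤ C ∧ ∀ ξ, ∀ y ∈ cube L c,
      ‖conjOp A L c f ξ y - ∑ p ∈ Finset.range N,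
        ((b p * weight A (2 * Real.pi) ξ ^ (-(1 / 2) - p : ℝ) : ℝ) : ℂ) *
          (lam A)^[p] (fun _ => f) ξ y‖ ≤ C * bracket ξ ^ (-1 - N : ℝ) := by
  have hpi := Real.pi_pos
  obtain ⟨b, C, hb0, hC0, hC⟩ := exists_taylor_rpow N (s := 1 / 2) (by norm_num)
  -- of the decay of order `n + (N + 1)`, the part `N + 1` compensates Peetre's inequality and the
  -- part `n` makes the sum over `k` converge
  obtain ⟨D, hD0, hD⟩ := exists_norm_fourierOn_twist_le hL0 hL hA.le (n + (N + 1))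
    (IsPolyFamily.lam_iterate (A := A) hf N)
  obtain ⟨E, hE0, hE⟩ := exists_weight_rpow_le (n := n) hA (L := 2 * Real.pi) (by positivity)
    (s := 1 / 2 + N) (by positivity)
  obtain ⟨G, hG0, hG⟩ := exists_tsum_shiftWeight_le (n := n) hA hL0
  refine ⟨b, C * E * (1 + 2 ^ (N + 1)) * D * G, hb0, by positivity, fun ξ y hy => ?_⟩
  set X := weight A (2 * Real.pi) ξ with hX
  have hXpos : 0 < X := weight_pos hA.le _ ξ
  set t : (Fin n → ℤ) → ℂ := fun k => fourierOn L c (twist f ξ) k with ht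
  let R : (Fin n → ℤ) → ℝ := fun k => weight A L k ^ (-(1 / 2) : ℝ) -
    ∑ p ∈ Finset.range N, b p * X ^ (-(1 / 2) - p : ℝ) * (weight A L k - X) ^ p
  have hfm := (hf.twist ξ).faceMatching hL0 hL
  have hsum1 : HasSum (fun k => invSqrtWeight A L k * t k * expo L k y)
      (multiplier L c (invSqrtWeight A L) (twist f ξ) y) :=
    (summable_mul_expo ((rapidDecay_multiplier hL0 (norm_invSqrtWeight_le_one hA.le L)
      hfm).summable_norm hL0) y).hasSum
  have hsum2 : HasSum (fun k => ∑ p ∈ Finset.range N, ((b p * X ^ (-(1 / 2) - p : ℝ) : ℝ) : ℂ) *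
        (((weight A L k - X) ^ p : ℝ) * t k * expo L k y))
      (∑ p ∈ Finset.range N, ((b p * X ^ (-(1 / 2) - p : ℝ) : ℝ) : ℂ) *
        ((lam A)^[p] (fun _ => f) ξ y * expo (2 * Real.pi) ξ y)) := by
    refine hasSum_sum fun p _ => HasSum.mul_left _ ?_
    have h1 := (((IsPolyFamily.lam_iterate (A := A) hf p).isWindow ξ).twist ξ).hasSum hL0 hL hy
    simp only [fourierOn_twist_lam_iterate hL0 hL A hf p ξ] at h1
    exact h1
  have hsum3 := hsum1.sub hsum2
  have hterm : ∀ k, invSqrtWeight A L k * t k * expo L k y - ∑ p ∈ Finset.range N,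
      ((b p * X ^ (-(1 / 2) - p : ℝ) : ℝ) : ℂ) *
        (((weight A L k - X) ^ p : ℝ) * t k * expo L k y) = (R k : ℂ) * t k * expo L k y := by
    intro k
    simp only [R, invSqrtWeight]
    push_cast
    simp only [sub_mul, Finset.sum_mul]
    congr 1
    exact Finset.sum_congr rfl fun p _ => by ring
  simp only [hterm] at hsum3
  obtain ⟨hGs, hGle⟩ := hG ξ
  have hbr := bracket_pos ξ
  have hbound : ∀ k, ‖(R k : ℂ) * t k * expo L k y‖ ≤
      C * E * (1 + 2 ^ (N + 1)) * D * bracket ξ ^ (-1 - N : ℝ) *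
        (shiftWeight A L k ξ ^ n)⁻¹ := by
    intro k
    have hZ := one_pos.trans_le (one_le_shiftWeight hA.le L k ξ)
    have hYpos := weight_pos hA.le L k
    have h1 := hC X (weight A L k) hXpos hYpos
    -- the factor `(Y - X) ^ N` is absorbed by passing from `f` to `lam A` applied `N` times
    have h2 : |weight A L k - X| ^ N * ‖t k‖ ≤
        D * bracket ξ ^ (N : ℝ) * (shiftWeight A L k ξ ^ (n + (N + 1)))⁻¹ := by
      have := hD ξ k
      rwa [fourierOn_twist_lam_iterate hL0 hL A hf, norm_mul, Complex.norm_real, Real.norm_eq_abs,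
        abs_pow] at this
    have h3 := weight_rpow_add_le (L := L) hA N k ξ
    have h4 : X ^ (-(1 / 2) - N : ℝ) ≤ E * bracket ξ ^ (-1 - 2 * N : ℝ) := by
      have := hE ξ
      rwa [show -(1 / 2 + N : ℝ) = -(1 / 2) - N by ring,
        show -2 * (1 / 2 + N : ℝ) = -1 - 2 * N by ring] at this
    have h5 : bracket ξ ^ (-1 - N : ℝ) = bracket ξ ^ (-1 - 2 * N : ℝ) * bracket ξ ^ (N : ℝ) := by
      rw [← Real.rpow_add hbr]; congr 1; ring
    rw [norm_mul, norm_expo, mul_one, norm_mul, Complex.norm_real, Real.norm_eq_abs]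
    have hX' := Real.rpow_nonneg hXpos.le (-(1 / 2) - N : ℝ)
    have hY' := Real.rpow_nonneg hYpos.le (-(1 / 2) - N : ℝ)
    calc |R k| * ‖t k‖ ≤ C * |weight A L k - X| ^ N *
          (X ^ (-(1 / 2) - N : ℝ) + weight A L k ^ (-(1 / 2) - N : ℝ)) * ‖t k‖ :=
          mul_le_mul_of_nonneg_right h1 (norm_nonneg _)
      _ = C * (X ^ (-(1 / 2) - N : ℝ) + weight A L k ^ (-(1 / 2) - N : ℝ)) *
          (|weight A L k - X| ^ N * ‖t k‖) := by ring
      _ ≤ C * (E * bracket ξ ^ (-1 - 2 * N : ℝ) * (1 + 2 ^ (N + 1)) *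
            shiftWeight A L k ξ ^ (N + 1)) *
          (D * bracket ξ ^ (N : ℝ) * (shiftWeight A L k ξ ^ (n + (N + 1)))⁻¹) := by
          refine mul_le_mul (mul_le_mul_of_nonneg_left (h3.trans ?_) hC0) h2 (by positivity)
            (by positivity)
          gcongr
      _ = _ := by
          rw [h5, pow_add]
          field_simp
          ring
  have hfin := hsum3.norm_le_of_bounded (hGs.hasSum.mul_left _) hbound
  have hconj : conjOp A L c f ξ y - ∑ p ∈ Finset.range N,
      ((b p * X ^ (-(1 / 2) - p : ℝ) : ℝ) : ℂ) * (lam A)^[p] (fun _ => f) ξ y =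
      expo (2 * Real.pi) (-ξ) y * (multiplier L c (invSqrtWeight A L) (twist f ξ) y -
        ∑ p ∈ Finset.range N, ((b p * X ^ (-(1 / 2) - p : ℝ) : ℝ) : ℂ) *
        ((lam A)^[p] (fun _ => f) ξ y * expo (2 * Real.pi) ξ y)) := by
    rw [mul_sub, Finset.mul_sum, conjOp]
    congr 1
    refine Finset.sum_congr rfl fun p _ => ?_
    linear_combination (-((b p * X ^ (-(1 / 2) - p : ℝ) : ℝ) : ℂ) *
      (lam A)^[p] (fun _ => f) ξ y) * expo_neg_mul (2 * Real.pi) ξ y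
  rw [hconj, norm_mul, norm_expo, one_mul]
  refine hfin.trans ?_
  have h0 : 0 ≤ C * E * (1 + 2 ^ (N + 1)) * D * bracket ξ ^ (-1 - N : ℝ) := by positivity
  refine (mul_le_mul_of_nonneg_left hGle h0).trans (le_of_eq ?_)
  ring

/-- In the expansion with `N` terms the remainder has order `-1 - N`, so that it satisfies the first
`N` symbol estimates of order `-1`; the `p`-th term has order `-1 - 2 p + p`. -/
lemma isSym_conjOp {f : (Fin n → ℝ) → ℂ} (hf : IsWindow L c f) (N : ℕ) :
    IsSym N (-1) fun (y : cube L c) ξ => conjOp A L c f ξ y := by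
  have hpi := Real.pi_pos
  obtain ⟨b, C, _, _, hC⟩ := exists_conjOp_expansion hA hL0 hL hf N
  have h1 : IsSym N (-1) fun (y : cube L c) ξ => conjOp A L c f ξ y -
      ∑ p ∈ Finset.range N, ((b p * weight A (2 * Real.pi) ξ ^ (-(1 / 2) - p : ℝ) : ℝ) : ℂ) *
          (lam A)^[p] (fun _ => f) ξ y :=
    IsSym.of_bound ⟨C, fun y ξ => hC ξ y y.2⟩
  have h2 : ∀ p ∈ Finset.range N, IsSym N (-1) fun (y : cube L c) ξ =>
      (b p : ℂ) * (((weight A (2 * Real.pi) ξ ^ (-(1 / 2 + p : ℝ)) : ℝ) : ℂ) *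
          (lam A)^[p] (fun _ => f) ξ y) := by
    intro p _
    have h3 : IsSym N p fun (y : cube L c) ξ => (lam A)^[p] (fun _ => f) ξ y :=
      ((IsPolyFamily.lam_iterate (A := A) hf p).isSym N).of_select fun y => Or.inr ⟨y, fun _ => rfl⟩
    refine (((isSym_weight_rpow hA (by positivity) N (s := 1 / 2 + p) (by positivity)).mul
      h3).mono_order ?_).const_mul _
    have : (0 : ℝ) ≤ p := Nat.cast_nonneg p
    linarith
  refine (h1.add (IsSym.sum h2)).congr fun y ξ => ?_
  rw [sub_add, ← Finset.sum_sub_distrib, Finset.sum_eq_zero, sub_zero]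
  intro p _
  rw [show -(1 / 2 + p : ℝ) = -(1 / 2) - p by ring]
  push_cast
  ring

lemma contDiff_conjOp {f : (Fin n → ℝ) → ℂ} (hf : IsWindow L c f) (ξ : Fin n → ℤ) :
    ContDiff ℝ ∞ (conjOp A L c f ξ) :=
  (contDiff_expo _ _).mul (isTestFunction_multiplier hL0 (norm_invSqrtWeight_le_one hA.le L)
    ((hf.twist ξ).faceMatching hL0 hL)).smooth

/-- Conjugated multipliers commute with derivatives: the multiplier commutes with `∂_i`, and the
factors that `∂_i` produces from the two exponentials cancel. -/
lemma pd_conjOp {f : (Fin n → ℝ) → ℂ} (hf : IsWindow L c f) (ξ : Fin n → ℤ) (i : Fin n) :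
    pd i (conjOp A L c f ξ) = conjOp A L c (pd i f) ξ := by
  have hμ := norm_invSqrtWeight_le_one (n := n) hA.le L
  have hfm := (hf.twist ξ).faceMatching hL0 hL
  unfold conjOp
  rw [pd_mul (contDiff_expo _ _) (isTestFunction_multiplier hL0 hμ hfm).smooth,
    pd_multiplier hL0 hμ hfm, pd_expo, pd_twist hf.test.smooth]
  funext y
  rw [multiplier_add hL0 hμ (((hf.pd i).twist ξ).faceMatching hL0 hL)
    (hfm.const_mul _), multiplier_const_mul]
  have hpi : (Real.pi : ℂ) ≠ 0 := by exact_mod_cast Real.pi_ne_zero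
  have h1 : (2 * Real.pi / ((2 * Real.pi : ℝ) : ℂ) : ℂ) = 1 := by
    push_cast
    field_simp
  rw [h1]
  simp only [Pi.neg_apply]
  push_cast
  ring

end Expansion

/-- Families generated by products of a smooth function with a conjugated operator; they are stable
under differentiation in `y`. -/
inductive IsConjFamily (A L : ℝ) (c : Fin n → ℝ) : ((Fin n → ℤ) → (Fin n → ℝ) → ℂ) → Prop
  | base (b f : (Fin n → ℝ) → ℂ) (hb : IsTestFunction (2 * Real.pi) b) (hf : IsWindow L c f) :
      IsConjFamily A L c fun ξ y => b y * conjOp A L c f ξ y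
  | add {q q' : (Fin n → ℤ) → (Fin n → ℝ) → ℂ} (hq : IsConjFamily A L c q)
      (hq' : IsConjFamily A L c q') : IsConjFamily A L c fun ξ y => q ξ y + q' ξ y

namespace IsConjFamily

variable {A L : ℝ} (hA : 0 < A) (hL0 : 0 < L) (hL : L ≤ 2 * Real.pi) {c : Fin n → ℝ}
  {q : (Fin n → ℤ) → (Fin n → ℝ) → ℂ}

include hA hL0 hL

lemma contDiff (hq : IsConjFamily A L c q) (ξ : Fin n → ℤ) : ContDiff ℝ ∞ (q ξ) := by
  induction hq with
  | base b f hb hf => exact hb.smooth.mul (contDiff_conjOp hA hL0 hL hf ξ)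
  | add _ _ ih ih' => exact ih.add ih'

lemma pd (hq : IsConjFamily A L c q) (i : Fin n) : IsConjFamily A L c fun ξ => pd i (q ξ) := by
  induction hq with
  | base b f hb hf =>
    simp only [pd_mul hb.smooth (contDiff_conjOp hA hL0 hL hf _), pd_conjOp hA hL0 hL hf]
    exact (base _ f (hb.pd i) hf).add (base b _ hb (hf.pd i))
  | add h1 h2 ih ih' =>
    simp only [pd_add (h1.contDiff hA hL0 hL _) (h2.contDiff hA hL0 hL _)]
    exact ih.add ih'

lemma pdl (hq : IsConjFamily A L c q) (l : List (Fin n)) :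
    IsConjFamily A L c fun ξ => pdl l (q ξ) := by
  induction l with
  | nil => exact hq
  | cons i l ih => exact ih.pd hA hL0 hL i

lemma isSym (hq : IsConjFamily A L c q) (N : ℕ) :
    IsSym N (-1) fun (y : cube L c) ξ => q ξ y := by
  induction hq with
  | base b f hb hf =>
    have hpi := Real.pi_pos
    obtain ⟨B, hB⟩ := exists_bound_of_periodic (by positivity) hb.smooth.continuous hb.periodic
    have h1 : IsSym N 0 fun (y : cube L c) (_ : Fin n → ℤ) => b y := IsSym.of_const ⟨B, fun y => hB y⟩
    have h2 := h1.mul (isSym_conjOp hA hL0 hL hf N)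
    rwa [zero_add] at h2
  | add _ _ ih ih' => exact ih.add ih'

end IsConjFamily

/-! ### The operators on the subdomains -/

lemma side_pos {K : ℕ} (hK : 2 ≤ K) : 0 < side K := by
  have hK0 : (0 : ℝ) < K := by exact_mod_cast (by omega : 0 < K)
  have := Real.pi_pos
  unfold side
  positivity

lemma side_le {K : ℕ} (hK : 2 ≤ K) : side K ≤ 2 * Real.pi := by
  have hK0 : (0 : ℝ) < K := by exact_mod_cast (by omega : 0 < K)
  have hK2 : (2 : ℝ) ≤ K := by exact_mod_cast hK
  have := Real.pi_pos
  unfold side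
  rw [div_le_iff₀ hK0]
  nlinarith

lemma opS_eq_multiplier {K : ℕ} (a : (Fin n → ℝ) → ℝ) (j : Fin n → Fin K) :
    opS a j = multiplier (side K) (mid j) (invSqrtWeight (a (mid j)) (side K)) := rfl

lemma pdl_const (l : List (Fin n)) (c : ℂ) :
    pdl l (fun _ => c) = fun _ => if l = [] then c else 0 := by
  induction l with
  | nil => simp [pdl]
  | cons i l ih =>
    change pd i (pdl l _) = _
    rw [ih]
    funext x
    simp [pd]

/-- `|ξ|^{-1}` and `⟨ξ⟩^{-1}` are comparable away from zero. -/
lemma half_len_rpow_le (ξ : Fin n → ℤ) (h : 1 ≤ len ξ) :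
    1 / 2 * len ξ ^ (-1 : ℝ) ≤ bracket ξ ^ (-1 : ℝ) := by
  have hb := bracket_pos ξ
  have h2 : bracket ξ ≤ 2 * len ξ := by
    refine (pow_le_pow_iff_left₀ hb.le (by positivity) two_ne_zero).1 ?_
    unfold bracket
    rw [Real.sq_sqrt (by positivity)]
    nlinarith
  rw [Real.rpow_neg_one, Real.rpow_neg_one, ← one_div, div_mul_div_comm, one_mul, ← one_div]
  exact one_div_le_one_div_of_le hb h2

lemma len_le_bracket (ξ : Fin n → ℤ) : len ξ ≤ bracket ξ := by
  unfold bracket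
  exact Real.le_sqrt_of_sq_le (by linarith)

lemma exists_le_weight_rpow {A L : ℝ} (hA : 0 < A) :
    ∃ c : ℝ, 0 < c ∧ ∀ ξ : Fin n → ℤ,
      c * bracket ξ ^ (-1 : ℝ) ≤ weight A L ξ ^ (-(1 / 2) : ℝ) := by
  obtain ⟨C, hC0, hC⟩ := exists_weight_le_bracket_sq (n := n) (L := L) hA
  refine ⟨C ^ (-(1 / 2) : ℝ), Real.rpow_pos_of_pos hC0 _, fun ξ => ?_⟩
  have hb := bracket_pos ξ
  have e : bracket ξ ^ (-1 : ℝ) = (bracket ξ ^ 2) ^ (-(1 / 2) : ℝ) := by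
    rw [← Real.rpow_natCast, ← Real.rpow_mul hb.le]; congr 1; norm_num
  rw [e, ← Real.mul_rpow hC0.le (by positivity)]
  exact Real.rpow_le_rpow_of_nonpos (weight_pos hA.le L ξ) (hC ξ) (by norm_num)

lemma symbol_multiplier {L : ℝ} (hL : 0 < L) (c : Fin n → ℝ) (μ : (Fin n → ℤ) → ℂ)
    (x : Fin n → ℝ) (ξ : Fin n → ℤ) : symbol L (multiplier L c μ) x ξ = μ ξ := by
  unfold symbol multiplier fourierInv
  rw [tsum_eq_single ξ]
  · beta_reduce
    rw [fourierOn_expo hL, if_pos rfl, mul_one]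
    linear_combination μ ξ * expo_neg_mul L ξ x
  · intro k hk
    beta_reduce
    rw [fourierOn_expo hL, if_neg hk, mul_zero, zero_mul]

/-- The Fourier multiplier of `(1 - A Δ)^{-1/2}` is an elliptic operator of order `-1`. -/
lemma isEllipticPeriodicPsDO_multiplier {A L : ℝ} (hA : 0 < A) (hL : 0 < L) (c : Fin n → ℝ) :
    IsEllipticPeriodicPsDO L (-1) 1 0 (multiplier L c (invSqrtWeight A L)) := by
  have hμ := norm_invSqrtWeight_le_one (n := n) hA.le L
  obtain ⟨C, hC0, hC⟩ := derivBound_multiplier hL (c := c) hμ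
  have hadd : ∀ u v, IsTestFunction L u → IsTestFunction L v →
      multiplier L c (invSqrtWeight A L) (u + v) =
        multiplier L c (invSqrtWeight A L) u + multiplier L c (invSqrtWeight A L) v :=
    fun u v hu hv => funext fun x => multiplier_add hL hμ (hu.faceMatching c) (hv.faceMatching c) x
  have hsmul : ∀ (b : ℂ) (u), IsTestFunction L u →
      multiplier L c (invSqrtWeight A L) (b • u) = b • multiplier L c (invSqrtWeight A L) u :=
    fun b u _ => funext fun x => multiplier_const_mul u b x
  refine ⟨⟨fun u hu => isTestFunction_multiplier hL hμ (hu.faceMatching c), hadd, hsmul, ?_, ?_, ?_⟩,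
    ?_⟩
  · intro β
    refine ⟨∑ i, β i + 2 * n, C, fun u hu B hB x => ?_⟩
    rw [mderiv_eq_pdl]
    exact hC u (hu.faceMatching c) (∑ i, β i) B (derivBound_of_mderiv hu.smooth hB) _
      (length_multiList β).le x
  · refine ⟨fun ξ => ⟨?_, fun _ _ => ?_⟩, fun α β => ?_⟩
    · simp only [symbol_multiplier hL]; exact contDiff_const
    · simp only [symbol_multiplier hL]
    · have h1 : IsSym (∑ i, α i) (-2 * (1 / 2)) fun (_ : Fin n → ℝ) (ξ : Fin n → ℤ) =>
          invSqrtWeight A L ξ := isSym_weight_rpow hA hL _ (by norm_num)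
      have h2 : IsSym (∑ i, α i) (-1) fun (x : Fin n → ℝ) ξ =>
          mderiv β (fun y => symbol L (multiplier L c (invSqrtWeight A L)) y ξ) x := by
        rw [show (-1 : ℝ) = -2 * (1 / 2) by norm_num]
        refine h1.of_select fun x => ?_
        simp only [symbol_multiplier hL, mderiv_eq_pdl, pdl_const]
        by_cases hl : multiList β = []
        · exact Or.inr ⟨x, fun ξ => if_pos hl⟩
        · exact Or.inl fun ξ => if_neg hl
      obtain ⟨D, hD⟩ := h2.mdiff_bound
      exact ⟨D, fun x ξ => by simpa using hD x ξ⟩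
  · intro u hu x
    exact hasSum_symbol hL hadd hsmul
      (fun u hu B hB x => (hC u (hu.faceMatching c) 0 B hB).norm_le x) hu x
  · obtain ⟨d, hd0, hd⟩ := exists_le_weight_rpow (n := n) (L := L) hA
    refine ⟨d * (1 / 2), by positivity, 1, one_pos, fun x ξ hξ => ?_⟩
    rw [symbol_multiplier hL, invSqrtWeight, Complex.norm_real, Real.norm_eq_abs,
      abs_of_nonneg (Real.rpow_nonneg (weight_pos hA.le L ξ).le _), mul_assoc]
    exact (mul_le_mul_of_nonneg_left (half_len_rpow_le ξ hξ) hd0.le).trans (hd ξ)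

/-! ### Extension by zero -/

section Extension

variable {K : ℕ} (hK : 2 ≤ K) (j : Fin n → Fin K)

include hK

lemma extendZero_eq {x : Fin n → ℝ} {m : Fin n → ℤ}
    (hm : (fun i => x i + 2 * Real.pi * (m i : ℝ)) ∈ dom j) (v : (Fin n → ℝ) → ℂ) :
    extendZero j v x = v fun i => x i + 2 * Real.pi * (m i : ℝ) := by
  unfold extendZero
  rw [tsum_eq_single m, Set.indicator_of_mem hm]
  intro m' hm'
  apply Set.indicator_of_notMem
  intro h
  apply hm'
  funext i
  have h1 := hm i
  have h2 := h i
  simp only [Set.mem_Ioo] at h1 h2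
  have h3 : m' i - m i = 0 := by
    apply eq_zero_of_two_pi_mul_lt (side_le hK)
    push_cast
    rw [abs_lt]
    constructor <;> linarith [h1.1, h1.2, h2.1, h2.2]
  omega

omit hK in
lemma extendZero_periodic (v : (Fin n → ℝ) → ℂ) (x : Fin n → ℝ) (m : Fin n → ℤ) :
    extendZero j v (fun i => x i + 2 * Real.pi * (m i : ℝ)) = extendZero j v x := by
  unfold extendZero
  rw [← (Equiv.addLeft m).tsum_eq fun m' : Fin n → ℤ =>
    (dom j).indicator v fun i => x i + 2 * Real.pi * (m' i : ℝ)]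
  refine tsum_congr fun m' => ?_
  congr 1
  funext i
  simp only [Equiv.coe_addLeft, Pi.add_apply]
  push_cast
  ring

variable {g : (Fin n → Fin K) → (Fin n → ℝ) → ℝ} (hg : IsWindowFamily g)

include hg

/-- Locally, `g_j` times an extension by zero is zero or a translate of a product. -/
lemma window_extendZero_local (x : Fin n → ℝ) :
    (∀ v, (fun y => (g j y : ℂ) * extendZero j v y) =ᶠ[𝓝 x] fun _ => 0) ∨
      ∃ m : Fin n → ℤ, (x + fun i => 2 * Real.pi * (m i : ℝ)) ∈ dom j ∧
        ∀ v, (fun y => (g j y : ℂ) * extendZero j v y) =ᶠ[𝓝 x] fun y =>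
          (g j (y + fun i => 2 * Real.pi * (m i : ℝ)) : ℂ) *
            v (y + fun i => 2 * Real.pi * (m i : ℝ)) := by
  by_cases hx : x ∈ tsupport (g j)
  · obtain ⟨m, hm⟩ := hg.support j hx
    refine Or.inr ⟨m, hm, fun v => ?_⟩
    have ho : IsOpen (dom j) := isOpen_cube _ _
    have hc : ContinuousAt (fun y : Fin n → ℝ => y + fun i => 2 * Real.pi * (m i : ℝ)) x := by
      fun_prop
    filter_upwards [hc.preimage_mem_nhds (ho.mem_nhds hm)] with y hy
    rw [extendZero_eq hK j (m := m) hy]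
    have := hg.periodic j y m
    congr 2
    exact_mod_cast this.symm
  · left
    intro v
    filter_upwards [notMem_tsupport_iff_eventuallyEq.1 hx] with y hy
    rw [hy]
    simp

lemma isTestFunction_window_extendZero {v : (Fin n → ℝ) → ℂ} (hv : ContDiff ℝ ∞ v) :
    IsTestFunction (2 * Real.pi) fun y => (g j y : ℂ) * extendZero j v y := by
  have hgc : ContDiff ℝ ∞ fun y => (g j y : ℂ) := Complex.ofRealCLM.contDiff.comp (hg.smooth j)
  refine ⟨contDiff_iff_contDiffAt.2 fun x => ?_, fun x m => ?_⟩
  · rcases window_extendZero_local hK j hg x with h | ⟨m, _, h⟩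
    · exact contDiffAt_const.congr_of_eventuallyEq (h v)
    · have h2 : ContDiff ℝ ∞ fun y => (g j (y + fun i => 2 * Real.pi * (m i : ℝ)) : ℂ) *
          v (y + fun i => 2 * Real.pi * (m i : ℝ)) :=
        (hgc.comp (contDiff_id.add contDiff_const)).mul
          (hv.comp (contDiff_id.add contDiff_const))
      exact h2.contDiffAt.congr_of_eventuallyEq (h v)
  · rw [extendZero_periodic, hg.periodic]

lemma derivBound_window_extendZero {v : (Fin n → ℝ) → ℂ} {N : ℕ} {B : ℝ}
    (h : DerivBound N B fun y => (g j y : ℂ) * v y) :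
    DerivBound N B fun y => (g j y : ℂ) * extendZero j v y := by
  intro l hl x
  rcases window_extendZero_local hK j hg x with h' | ⟨m, _, h'⟩
  · rw [(pdl_congr (h' v) l).eq_of_nhds, pdl_zero, norm_zero]
    exact h.nonneg
  · rw [(pdl_congr (h' v) l).eq_of_nhds, pdl_translate fun y => (g j y : ℂ) * v y]
    exact h l hl _

omit hK in
lemma isWindow_of_isWindowFamily : IsWindow (side K) (mid j) fun y => (g j y : ℂ) := by
  refine ⟨⟨Complex.ofRealCLM.contDiff.comp (hg.smooth j), fun x m => ?_⟩, fun x hx => ?_⟩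
  · rw [hg.periodic]
  · exact hg.support j (tsupport_comp_subset (g := ((↑) : ℝ → ℂ)) Complex.ofReal_zero (g j) hx)

end Extension

/-! ### The preconditioner -/

section Preconditioner

variable {K : ℕ} (hK : 2 ≤ K) {a : (Fin n → ℝ) → ℝ} (ha : ∀ x, 0 < a x)
  {g : (Fin n → Fin K) → (Fin n → ℝ) → ℝ} (hg : IsWindowFamily g)

include hK hg

lemma faceMatching_window_mul (j : Fin n → Fin K) {u : (Fin n → ℝ) → ℂ}
    (hu : IsTestFunction (2 * Real.pi) u) :
    FaceMatching (side K) (mid j) fun y => (g j y : ℂ) * u y :=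
  ((isWindow_of_isWindowFamily j hg).mul_test hu).faceMatching (side_pos hK) (side_le hK)

include ha

lemma isTestFunction_opS_window_mul (j : Fin n → Fin K) {u : (Fin n → ℝ) → ℂ}
    (hu : IsTestFunction (2 * Real.pi) u) :
    IsTestFunction (side K) (opS a j fun y => (g j y : ℂ) * u y) :=
  isTestFunction_multiplier (side_pos hK) (norm_invSqrtWeight_le_one (ha _).le _)
    (faceMatching_window_mul hK hg j hu)

lemma isTestFunction_opP {u : (Fin n → ℝ) → ℂ} (hu : IsTestFunction (2 * Real.pi) u) :
    IsTestFunction (2 * Real.pi) (opP a g u) :=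
  IsTestFunction.sum fun j _ => isTestFunction_window_extendZero hK j hg
    (isTestFunction_opS_window_mul hK ha hg j hu).smooth

lemma opP_add {u v : (Fin n → ℝ) → ℂ} (hu : IsTestFunction (2 * Real.pi) u)
    (hv : IsTestFunction (2 * Real.pi) v) : opP a g (u + v) = opP a g u + opP a g v := by
  funext x
  simp only [opP, Pi.add_apply, ← Finset.sum_add_distrib]
  refine Finset.sum_congr rfl fun j _ => ?_
  rcases window_extendZero_local hK j hg x with h | ⟨m, _, h⟩
  · simp only [(h _).eq_of_nhds, add_zero]
  · simp only [(h _).eq_of_nhds, ← mul_add]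
    congr 1
    simp only [mul_add]
    exact multiplier_add (side_pos hK) (norm_invSqrtWeight_le_one (ha _).le _)
      (faceMatching_window_mul hK hg j hu) (faceMatching_window_mul hK hg j hv) _

omit ha in
lemma opP_smul (c : ℂ) (u : (Fin n → ℝ) → ℂ) : opP a g (c • u) = c • opP a g u := by
  funext x
  simp only [opP, Pi.smul_apply, smul_eq_mul, Finset.mul_sum]
  refine Finset.sum_congr rfl fun j _ => ?_
  have h1 : (opS a j fun y => (g j y : ℂ) * (c * u y)) =
      fun y => c * opS a j (fun y => (g j y : ℂ) * u y) y := by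
    funext y
    simp only [mul_left_comm _ c]
    exact multiplier_const_mul _ c y
  rcases window_extendZero_local hK j hg x with h | ⟨m, _, h⟩
  · simp only [(h _).eq_of_nhds, mul_zero]
  · simp only [(h _).eq_of_nhds, h1]
    ring

lemma exists_derivBound_opP (N : ℕ) :
    ∃ C : ℝ, ∀ u, IsTestFunction (2 * Real.pi) u → ∀ B, DerivBound (N + 2 * n) B u →
      DerivBound N (C * B) (opP a g u) := by
  have hpi := Real.pi_pos
  have h1 : ∀ j, ∃ G, DerivBound (N + 2 * n) G fun y => (g j y : ℂ) := fun j =>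
    (isWindow_of_isWindowFamily j hg).test.exists_derivBound (by positivity) _
  choose G hG using h1
  have h2 := fun j : Fin n → Fin K => derivBound_multiplier (side_pos hK) (c := mid j)
    (norm_invSqrtWeight_le_one (n := n) (ha (mid j)).le (side K))
  choose C _ hC using h2
  refine ⟨∑ j, 2 ^ N * (G j * (C j * (2 ^ (N + 2 * n) * G j))), fun u hu B hB => ?_⟩
  have h3 : ∀ j, DerivBound N (2 ^ N * (G j * (C j * (2 ^ (N + 2 * n) * (G j * B)))))
      fun y => (g j y : ℂ) * extendZero j (opS a j fun y => (g j y : ℂ) * u y) y := by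
    intro j
    have hgj := (isWindow_of_isWindowFamily j hg).test.smooth
    refine derivBound_window_extendZero hK j hg (DerivBound.mul hgj
      (isTestFunction_opS_window_mul hK ha hg j hu).smooth
      ((hG j).mono (Nat.le_add_right _ _) le_rfl) ?_)
    exact hC j _ (faceMatching_window_mul hK hg j hu) N _ ((hG j).mul hgj hu.smooth hB)
  have h4 := DerivBound.sum (s := Finset.univ) (fun j _ => (isTestFunction_window_extendZero hK j hg
    (isTestFunction_opS_window_mul hK ha hg j hu).smooth).smooth) fun j _ => h3 j
  refine h4.mono le_rfl (le_of_eq ?_)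
  rw [Finset.sum_mul]
  exact Finset.sum_congr rfl fun j _ => by ring

omit hK hg ha in
/-- The contribution of the subdomain `D_j` to the symbol of `opP`. -/
def symbolTerm (a : (Fin n → ℝ) → ℝ) (g : (Fin n → Fin K) → (Fin n → ℝ) → ℝ)
    (j : Fin n → Fin K) (ξ : Fin n → ℤ) (x : Fin n → ℝ) : ℂ :=
  expo (2 * Real.pi) (-ξ) x *
    ((g j x : ℂ) * extendZero j (opS a j (twist (fun y => (g j y : ℂ)) ξ)) x)

omit hK hg ha in
lemma symbol_opP_eq_sum (x : Fin n → ℝ) (ξ : Fin n → ℤ) :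
    symbol (2 * Real.pi) (opP a g) x ξ = ∑ j, symbolTerm a g j ξ x := by
  simp only [symbol, opP, Finset.mul_sum]
  rfl

lemma contDiff_symbolTerm (j : Fin n → Fin K) (ξ : Fin n → ℤ) :
    ContDiff ℝ ∞ (symbolTerm a g j ξ) := by
  have hpi := Real.pi_pos
  exact (contDiff_expo _ _).mul (isTestFunction_window_extendZero hK j hg
    (isTestFunction_opS_window_mul hK ha hg j
      (isTestFunction_expo (by positivity) ξ)).smooth).smooth

omit ha in
lemma symbolTerm_local (j : Fin n → Fin K) (x : Fin n → ℝ) :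
    (g j x = 0 ∧ ∀ ξ, symbolTerm a g j ξ =ᶠ[𝓝 x] fun _ => 0) ∨
      ∃ v : Fin n → ℝ, x + v ∈ cube (side K) (mid j) ∧ g j (x + v) = g j x ∧
        ∀ ξ, symbolTerm a g j ξ =ᶠ[𝓝 x] fun y => (g j (y + v) : ℂ) *
          conjOp (a (mid j)) (side K) (mid j) (fun y => (g j y : ℂ)) ξ (y + v) := by
  have hpi := Real.pi_pos
  rcases window_extendZero_local hK j hg x with h | ⟨m, hm, h⟩
  · by_cases hgx : g j x = 0
    · refine Or.inl ⟨hgx, fun ξ => ?_⟩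
      filter_upwards [h (opS a j (twist (fun y => (g j y : ℂ)) ξ))] with y hy
      rw [symbolTerm, hy, mul_zero]
    · exfalso
      obtain ⟨m, hm⟩ := hg.support j (subset_tsupport _ hgx)
      have h1 := (h fun _ => 1).eq_of_nhds
      simp only [extendZero_eq hK j hm, mul_one] at h1
      exact hgx (by exact_mod_cast h1)
  · refine Or.inr ⟨_, hm, hg.periodic j x m, fun ξ => ?_⟩
    filter_upwards [h (opS a j (twist (fun y => (g j y : ℂ)) ξ))] with y hy
    rw [symbolTerm, hy, conjOp, opS_eq_multiplier]
    have he : expo (2 * Real.pi) (-ξ) (y + fun i => 2 * Real.pi * (m i : ℝ)) =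
        expo (2 * Real.pi) (-ξ) y := expo_periodic (by positivity) (-ξ) y m
    rw [he]
    ring

lemma isSym_mderiv_symbol_opP (β : Fin n → ℕ) (N : ℕ) :
    IsSym N (-1) fun (x : Fin n → ℝ) ξ =>
      mderiv β (fun y => symbol (2 * Real.pi) (opP a g) y ξ) x := by
  have h1 : ∀ j ∈ (Finset.univ : Finset (Fin n → Fin K)), IsSym N (-1) fun (x : Fin n → ℝ) ξ =>
      pdl (multiList β) (symbolTerm a g j ξ) x := by
    intro j _
    have hw := isWindow_of_isWindowFamily j hg
    have h2 := ((IsConjFamily.base (A := a (mid j)) _ _ hw.test hw).pdl (ha _) (side_pos hK)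
      (side_le hK) (multiList β)).isSym (ha _) (side_pos hK) (side_le hK) N
    refine h2.of_select fun x => ?_
    rcases symbolTerm_local hK hg j x (a := a) with ⟨_, h⟩ | ⟨v, hv, _, h⟩
    · exact Or.inl fun ξ => by rw [(pdl_congr (h ξ) _).eq_of_nhds, pdl_zero]
    · refine Or.inr ⟨⟨x + v, hv⟩, fun ξ => ?_⟩
      rw [(pdl_congr (h ξ) _).eq_of_nhds, pdl_translate fun y => (g j y : ℂ) *
          conjOp (a (mid j)) (side K) (mid j) (fun y => (g j y : ℂ)) ξ y]
  refine (IsSym.sum h1).congr fun x ξ => ?_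
  simp only [symbol_opP_eq_sum, mderiv_eq_pdl]
  rw [pdl_sum fun j _ => contDiff_symbolTerm hK ha hg j ξ]

/-- The principal symbol of `opP` is `∑ g_j² (1 + a(x_j) |ξ|²)^{-1/2}`. -/
lemma exists_norm_symbol_opP_sub_le :
    ∃ C : ℝ, 0 ≤ C ∧ ∀ (x : Fin n → ℝ) (ξ : Fin n → ℤ),
      ‖symbol (2 * Real.pi) (opP a g) x ξ -
        ((∑ j, g j x ^ 2 * weight (a (mid j)) (2 * Real.pi) ξ ^ (-(1 / 2) : ℝ) : ℝ) : ℂ)‖ ≤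
        C * bracket ξ ^ (-2 : ℝ) := by
  have h1 := fun j : Fin n → Fin K => exists_conjOp_expansion (ha (mid j)) (side_pos hK)
    (side_le hK) (isWindow_of_isWindowFamily j hg) 1
  choose b C hb hC0 hC using h1
  refine ⟨∑ j, C j, Finset.sum_nonneg fun j _ => hC0 j, fun x ξ => ?_⟩
  have hbr := bracket_pos ξ
  rw [symbol_opP_eq_sum]
  push_cast
  rw [← Finset.sum_sub_distrib, Finset.sum_mul]
  refine (norm_sum_le _ _).trans (Finset.sum_le_sum fun j _ => ?_)
  rcases symbolTerm_local hK hg j x (a := a) with ⟨h0, h⟩ | ⟨v, hv, h0, h⟩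
  · rw [(h ξ).eq_of_nhds, h0]
    have h2 := mul_nonneg (hC0 j) (Real.rpow_nonneg hbr.le (-2))
    simpa using h2
  · rw [(h ξ).eq_of_nhds, h0]
    have h2 := hC j ξ (x + v) hv
    simp only [Finset.sum_range_one, hb, Nat.cast_zero, sub_zero, one_mul,
      Function.iterate_zero, id_eq, Nat.cast_one, h0] at h2
    have h3 : |g j x| ≤ 1 := by
      rw [← sq_le_one_iff_abs_le_one, ← hg.sum_sq x]
      exact Finset.single_le_sum (f := fun j => g j x ^ 2) (fun j _ => sq_nonneg _)
        (Finset.mem_univ j)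
    have e : (g j x : ℂ) * conjOp (a (mid j)) (side K) (mid j) (fun y => (g j y : ℂ)) ξ (x + v) -
        (g j x : ℂ) ^ 2 * ((weight (a (mid j)) (2 * Real.pi) ξ ^ (-(1 / 2) : ℝ) : ℝ) : ℂ) =
        (g j x : ℂ) * (conjOp (a (mid j)) (side K) (mid j) (fun y => (g j y : ℂ)) ξ (x + v) -
        ((weight (a (mid j)) (2 * Real.pi) ξ ^ (-(1 / 2) : ℝ) : ℝ) : ℂ) * (g j x : ℂ)) := by ring
    rw [e, norm_mul, Complex.norm_real, Real.norm_eq_abs]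
    refine (mul_le_of_le_one_left (norm_nonneg _) h3).trans (h2.trans (le_of_eq ?_))
    norm_num

lemma elliptic_opP : ∃ C : ℝ, 0 < C ∧ ∃ R : ℝ, 0 < R ∧ ∀ (x : Fin n → ℝ) (ξ : Fin n → ℤ),
    R ≤ len ξ → C * len ξ ^ (-1 : ℝ) ≤ ‖symbol (2 * Real.pi) (opP a g) x ξ‖ := by
  obtain ⟨C, hC0, hC⟩ := exists_norm_symbol_opP_sub_le hK ha hg
  have h1 := fun j : Fin n → Fin K => exists_le_weight_rpow (n := n) (L := 2 * Real.pi) (ha (mid j))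
  choose d hd0 hd using h1
  have hne : Nonempty (Fin n → Fin K) := ⟨fun _ => ⟨0, by omega⟩⟩
  obtain ⟨j₀, hj₀⟩ := Finite.exists_min d
  have hdj := hd0 j₀
  -- beyond `2 * C / d j₀` the error is at most half of the principal symbol
  refine ⟨d j₀ / 2 * (1 / 2), by positivity, max 1 (2 * C / d j₀), by positivity,
    fun x ξ hξ => ?_⟩
  have hbr := bracket_pos ξ
  have hbr1 : 0 < bracket ξ ^ (-1 : ℝ) := Real.rpow_pos_of_pos hbr _
  have hmain : d j₀ * bracket ξ ^ (-1 : ℝ) ≤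
      ∑ j, g j x ^ 2 * weight (a (mid j)) (2 * Real.pi) ξ ^ (-(1 / 2) : ℝ) := by
    rw [← one_mul (d j₀ * bracket ξ ^ (-1 : ℝ)), ← congrArg (· * (d j₀ * bracket ξ ^ (-1 : ℝ)))
      (hg.sum_sq x), Finset.sum_mul]
    refine Finset.sum_le_sum fun j _ => mul_le_mul_of_nonneg_left ?_ (sq_nonneg _)
    exact (mul_le_mul_of_nonneg_right (hj₀ j) hbr1.le).trans (hd j ξ)
  have hrem : C * bracket ξ ^ (-2 : ℝ) ≤ d j₀ / 2 * bracket ξ ^ (-1 : ℝ) := by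
    have h2 : 2 * C / d j₀ ≤ bracket ξ :=
      ((le_max_right _ _).trans hξ).trans (len_le_bracket ξ)
    rw [div_le_iff₀ hdj] at h2
    have h3 : bracket ξ ^ (-1 : ℝ) = bracket ξ * bracket ξ ^ (-2 : ℝ) := by
      rw [← Real.rpow_one_add' hbr.le (by norm_num)]; norm_num
    rw [h3]
    have h4 : 0 < bracket ξ ^ (-2 : ℝ) := Real.rpow_pos_of_pos hbr _
    nlinarith
  have hlow : d j₀ / 2 * bracket ξ ^ (-1 : ℝ) ≤ ‖symbol (2 * Real.pi) (opP a g) x ξ‖ := by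
    have h2 := hC x ξ
    have h3 := norm_sub_norm_le (((∑ j, g j x ^ 2 * weight (a (mid j)) (2 * Real.pi) ξ ^
      (-(1 / 2) : ℝ) : ℝ) : ℂ)) (symbol (2 * Real.pi) (opP a g) x ξ)
    rw [norm_sub_rev, Complex.norm_real, Real.norm_eq_abs] at h3
    have h4 := le_abs_self (∑ j, g j x ^ 2 * weight (a (mid j)) (2 * Real.pi) ξ ^ (-(1 / 2) : ℝ))
    linarith
  refine le_trans ?_ hlow
  rw [mul_assoc]
  exact mul_le_mul_of_nonneg_left (half_len_rpow_le ξ ((le_max_left _ _).trans hξ)) (by positivity)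

lemma isEllipticPeriodicPsDO_opP :
    IsEllipticPeriodicPsDO (2 * Real.pi) (-1) 1 0 (opP a g) := by
  have hpi : 0 < 2 * Real.pi := by have := Real.pi_pos; positivity
  refine ⟨⟨fun u hu => isTestFunction_opP hK ha hg hu, fun u v hu hv => opP_add hK ha hg hu hv,
    fun c u _ => opP_smul hK hg c u, fun β => ?_, ⟨fun ξ => ?_, fun α β => ?_⟩, fun u hu x => ?_⟩,
    elliptic_opP hK ha hg⟩
  · obtain ⟨C, hC⟩ := exists_derivBound_opP hK ha hg (∑ i, β i)
    refine ⟨∑ i, β i + 2 * n, C, fun u hu B hB x => ?_⟩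
    rw [mderiv_eq_pdl]
    exact hC u hu B (derivBound_of_mderiv hu.smooth hB) _ (length_multiList β).le x
  · exact (isTestFunction_expo hpi.ne' (-ξ)).mul
      (isTestFunction_opP hK ha hg (isTestFunction_expo hpi.ne' ξ))
  · obtain ⟨D, hD⟩ := (isSym_mderiv_symbol_opP hK ha hg β (∑ i, α i)).mdiff_bound
    exact ⟨D, fun x ξ => by simpa using hD x ξ⟩
  · obtain ⟨C, hC⟩ := exists_derivBound_opP hK ha hg 0
    exact hasSum_symbol hpi (fun u v hu hv => opP_add hK ha hg hu hv)
      (fun c u _ => opP_smul hK hg c u) (fun u hu B hB x => (hC u hu B hB).norm_le x) hu x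

end Preconditioner

end ToroidalPsDO

end

theorem propositionf {n K : ℕ} (hK : 2 ≤ K)
    (a : (Fin n → ℝ) → ℝ) (ha : ∃ C : ℝ, 0 < C ∧ ∀ x, C ≤ a x)
    (g : (Fin n → Fin K) → (Fin n → ℝ) → ℝ) (hg : ToroidalPsDO.IsWindowFamily g) :
    (∀ j : Fin n → Fin K,
      ToroidalPsDO.IsEllipticPeriodicPsDO (4 * Real.pi / K) (-1) 1 0 (ToroidalPsDO.opS a j)) ∧
    ToroidalPsDO.IsEllipticPeriodicPsDO (2 * Real.pi) (-1) 1 0 (ToroidalPsDO.opP a g) := by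
  obtain ⟨C, hC, hCa⟩ := ha
  have ha' : ∀ x, 0 < a x := fun x => hC.trans_le (hCa x)
  exact ⟨fun j => ToroidalPsDO.isEllipticPeriodicPsDO_multiplier (ha' _)
    (ToroidalPsDO.side_pos hK) (ToroidalPsDO.mid j),
    ToroidalPsDO.isEllipticPeriodicPsDO_opP hK ha' hg⟩
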